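/- Notation. For positive integers $s_1,\dots,s_d$ and signs $z_1,\dots,z_d\in\{\pm1\}$ let $$\zeta(s_1,\dots,s_d;z_1,\dots,z_d)=\lim_{M\to\infty}\zeta^{(M)},\qquad \zeta^{(M)}=\sum_{M\ge n_1>\cdots>n_d>0}\frac{z_1^{n_1}\cdots z_d^{n_d}}{n_1^{s_1}\cdots n_d^{s_d}},$$ which converges when $(s_1,z_1)\ne(1,1)$ (the admissible case). A bar over $s_j$ indicates $z_j=-1$; no bar indicates $z_j=1$. For every index $(\mathbf s;\mathbf z)$, admissible or not, the stuffle-regularized value $\zeta_*(\mathbf s;\mathbf z)\in\mathbb R[T]$ is the unique polynomial $P$ with $\zeta^{(M)}(\mathbf s;\mathbf z)=P(\log M+\gamma)+o(1)$ as $M\to\infty$ ($\gamma$ is Euler's constant), and the shuffle-regularized value $\zeta_{\mathrm{sh}}(\mathbf s;\mathbf z)\in\mathbb R[T]$ is the unique polynomial $P$ with $I^{(\varepsilon)}(\mathbf s;\mathbf z)=P(-\log\varepsilon)+o(1)$ as $\varepsilon\to0^+$, where $$I^{(\varepsilon)}(\mathbf s;\mathbf z)=\int_0^{1-\varepsilon}\Big(\frac{dt}{t}\Big)^{s_1-1}\frac{dt}{a_1-t}\cdots\Big(\frac{dt}{t}\Big)^{s_d-1}\frac{dt}{a_d-t},\qquad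 a_i=z_1\cdots z_i,$$ is the iterated integral over $1-\varepsilon>t_1>t_2>\cdots>0$. Theorem. Let $w\ge4$, $u=w-2$, $v=w-1$, and let $\sum$ denote the sum over all positive integers $a,b,c$ with $a+b+c=w$. The limits defining the admissible Euler sums of depth $\le3$ and weight $\le w$ exist, the regularized values $\zeta_*$ and $\zeta_{\mathrm{sh}}$ of all indices of depth $\le 3$ and weight $w$ exist, and the following identities hold (in $\mathbb R[T]$ where regularized values occur): \begin{align*} \sum 2\cdot2^{b-1}\zeta_{\mathrm{sh}}(a,b,c)={}&2\zeta_*(1,1,u)+w\zeta_*(1,v)-2\zeta(u,2)-\zeta(w),\\ \sum 2\cdot2^{b-1}\zeta_{\mathrm{sh}}(a,\bar b,c)={}&4\zeta(u,\bar1,\bar1)-4\zeta(u,\bar1,1)-2\zeta(\bar1,\bar1,u)+2\zeta(\bar1,1,u)+2\zeta_*(1,\bar1,u)\\ &+2\zeta(\bar v,\bar1)-2\zeta(\bar v,1)+u\zeta_*(1,v)+2\zeta_*(1,\bar v)+4\zeta(\bar2,u)+2\zeta(u,2)+\zeta(w)+2\zeta(\bar w),\\ \sum 2\cdot2^{b-1}\zeta(\bar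 a,b,c)={}&2\zeta(\bar1,\bar1,\bar u)+w\zeta(\bar1,\bar v)+2\zeta(\bar v,\bar1)-2\zeta(\bar v,1)\\ &+\zeta(\bar2,\bar u)+\zeta(2,\bar u)+2\zeta(w)-\zeta(\bar w)+\zeta(2)\zeta(\bar u),\\ \sum 2\cdot2^{b-1}\zeta(\bar a,\bar b,c)={}&2\zeta(\bar1,\bar1,\bar u)+u\zeta(\bar1,\bar v)+2\zeta(\bar1,v)+\zeta(\bar2,\bar u)+\zeta(2,\bar u)+\zeta(\bar w),\\ \sum 2^{b-1}\big(\zeta_{\mathrm{sh}}(\bar a,\bar b,\bar c)+\zeta_{\mathrm{sh}}(\bar a,b,\bar c)\big)={}&2\zeta(u,\bar1,1)+2\zeta(\bar1,\bar1,u)-2\zeta(u,\bar1,\bar1)\\ &+v\zeta(\bar1,v)+\zeta(\bar v,1)+\zeta(\bar1,\bar v)-\zeta(\bar v,\bar1)+\zeta(2,u)-\zeta(u,2),\\ \sum 2^{b-1}\big(\zeta_{\mathrm{sh}}(a,b,\bar c)+\zeta_{\mathrm{sh}}(a,\bar b,\bar c)\big)={}&\zeta_*(1,\bar1,\bar u)+\zeta(\bar1,1,\bar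 u)-\zeta(\bar1,\bar1,\bar u)+\zeta_*(1,1,\bar u)-\zeta(\bar v,\bar1)+\zeta(\bar v,1)\\ &+\zeta_*(1,v)+v\zeta_*(1,\bar v)+\zeta(\bar2,\bar u)+\zeta(2,\bar u)+\zeta(\bar w)+3\zeta(\bar2)\zeta(\bar u). \end{align*} -/

import Mathlib

open Filter Topology Polynomial

noncomputable section

namespace EulerSum

/-- An index of an Euler sum: the list `(s₁, z₁), …, (s_d, z_d)` of exponents
(positive in everything below) and signs `z_j = ±1`.  Its length is the depth. -/
abbrev Index : Type := List (ℕ × ℤˣ)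

/-- The unbarred entry `n`, that is, exponent `n` with sign `+1`. -/
def pl (n : ℕ) : ℕ × ℤˣ := (n, 1)

/-- The barred entry, that is, exponent `n` with sign `-1`. -/
def bar (n : ℕ) : ℕ × ℤˣ := (n, -1)

/-- All exponents are positive integers. -/
def IsPos (k : Index) : Prop := ∀ p ∈ k, 1 ≤ p.1

/-- The weight `s₁ + ⋯ + s_d`. -/
def weight (k : Index) : ℕ := (k.map Prod.fst).sum

/-- An index is admissible when `(s₁, z₁) ≠ (1, 1)`. -/
def Admissible (k : Index) : Prop := k.head? ≠ some (pl 1)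

/-- The truncated Euler sum
`∑_{M ≥ n₁ > ⋯ > n_d > 0} z₁^{n₁} ⋯ z_d^{n_d} / (n₁^{s₁} ⋯ n_d^{s_d})`. -/
def truncSum : Index → ℕ → ℝ
  | [], _ => 1
  | (s, z) :: k, M =>
      ∑ n ∈ Finset.Icc 1 M, (((z : ℤ) : ℝ) ^ n / (n : ℝ) ^ s) * truncSum k (n - 1)

/-- The Euler sum of an (admissible) index: the limit of the truncated sums. -/
def eulerZeta (k : Index) : ℝ := limUnder atTop (truncSum k)

/-- The iterated integral
`∫_{x > t₁ > ⋯ > t_n > 0} f₁(t₁) ⋯ f_n(t_n) dt₁ ⋯ dt_n` of a list of functions. -/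
def iterInt : List (ℝ → ℝ) → ℝ → ℝ
  | [], _ => 1
  | f :: l, x => ∫ t in (0 : ℝ)..x, f t * iterInt l t

/-- The list of one-forms
`(dt/t)^{s₁-1} dt/(a₁-t) ⋯ (dt/t)^{s_d-1} dt/(a_d-t)` with `a_i = a z₁ ⋯ z_i`. -/
def forms : ℤˣ → Index → List (ℝ → ℝ)
  | _, [] => []
  | a, (s, z) :: k =>
      List.replicate (s - 1) (fun t : ℝ => 1 / t) ++
        (fun t : ℝ => 1 / ((((a * z : ℤˣ) : ℤ) : ℝ) - t)) :: forms (a * z) k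

/-- The truncated iterated integral from `0` to `1 - ε` attached to an index. -/
def truncInt (k : Index) (ε : ℝ) : ℝ := iterInt (forms 1 k) (1 - ε)

/-- `P` is the stuffle regularization of `k`: the truncated sum up to `M` equals
`P (log M + γ) + o(1)` as `M → ∞`, with `γ` Euler's constant. -/
def IsStuffleReg (k : Index) (P : ℝ[X]) : Prop :=
  Tendsto (fun M : ℕ => truncSum k M -
    P.eval (Real.log M + Real.eulerMascheroniConstant)) atTop (𝓝 0)

/-- `P` is the shuffle regularization of `k`: the truncated integral up to `1 - ε` equals
`P (-log ε) + o(1)` as `ε → 0+`. -/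
def IsShuffleReg (k : Index) (P : ℝ[X]) : Prop :=
  Tendsto (fun ε : ℝ => truncInt k ε - P.eval (-Real.log ε)) (𝓝[>] 0) (𝓝 0)

/-- The stuffle-regularized value, a polynomial in the variable `T = X`. -/
def zetaStuffle (k : Index) : ℝ[X] := Classical.epsilon (IsStuffleReg k)

/-- The shuffle-regularized value, a polynomial in the variable `T = X`. -/
def zetaShuffle (k : Index) : ℝ[X] := Classical.epsilon (IsShuffleReg k)

/-- The triples `(a, b, c)` of positive integers with `a + b + c = w`. -/
def triples (w : ℕ) : Finset (ℕ × ℕ × ℕ) :=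
  (Finset.Icc 1 w ×ˢ Finset.Icc 1 w ×ˢ Finset.Icc 1 w).filter
    fun p => p.1 + p.2.1 + p.2.2 = w

/-- A regularization polynomial is determined by its asymptotics. -/
theorem poly_unique {α : Type*} {l : Filter α} [l.NeBot] {f x : α → ℝ}
    (hx : Tendsto x l atTop) {P Q : ℝ[X]}
    (hP : Tendsto (fun i => f i - P.eval (x i)) l (𝓝 0))
    (hQ : Tendsto (fun i => f i - Q.eval (x i)) l (𝓝 0)) : P = Q := by
  have h : Tendsto (fun i => (P - Q).eval (x i)) l (𝓝 0) := by
    have := hQ.sub hP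
    simpa using this
  by_contra hne
  have hne' : P - Q ≠ 0 := sub_ne_zero.mpr hne
  by_cases hd : 0 < (P - Q).degree
  · have h1 := ((P - Q).abs_tendsto_atTop hd).comp hx
    exact not_tendsto_nhds_of_tendsto_atTop h1 _ h.abs
  · have hc := Polynomial.eq_C_of_degree_le_zero (not_lt.mp hd)
    rw [hc] at h hne'
    simp only [eval_C] at h
    have := tendsto_nhds_unique h tendsto_const_nhds
    exact hne' (by rw [← this]; simp)

theorem IsStuffleReg.unique {k : Index} {P Q : ℝ[X]}
    (hP : IsStuffleReg k P) (hQ : IsStuffleReg k Q) : P = Q :=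
  poly_unique (tendsto_atTop_add_const_right _ _
    (Real.tendsto_log_atTop.comp tendsto_natCast_atTop_atTop)) hP hQ

theorem IsShuffleReg.unique {k : Index} {P Q : ℝ[X]}
    (hP : IsShuffleReg k P) (hQ : IsShuffleReg k Q) : P = Q :=
  poly_unique (tendsto_neg_atBot_atTop.comp Real.tendsto_log_nhdsGT_zero) hP hQ

end EulerSum

end

open EulerSum

/-! For signs `s, p, q` let W(s,p,q) be the sum over a+b+c = w of 2^(b-1) times the shuffle values
with signs (s,p,pq) and (s,q,pq). Taking p = q yields the first four left-hand sides, and W(-1,1,-1)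
and W(1,-1,1) are the last two. So one formula for W suffices; put r = w-3.

Shuffle side. The integral up to 1-ε is the power series in 1-ε whose coefficients are the
increments of the truncated sums (`hasSum_iterInt`), so relations between integrals are relations
between coefficients. Let B_r(X,Y) be the sum of X^b Y^c over b, c ≥ 1 with b+c = r+2. A partial
fraction identity absorbs the powers of two into B_r(1/m,1/n) (`sum_two_pow_eq_bisum`), and another
one sums over a (`sub_mul_sum_bisum`). The outcome, `sum_truncInt_three`, writes W as the sum over
b+c = r+2 of I(b; ps) I(1,c; s,q) - I(b,1,c; sp,p,q).

Regularization. With e₁, e₂ the truncated sums of (1) and (1,1), every truncated sum that occurs is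
α + β e₁ + κ e₂ + O(n^(-1/2)) (`exists_hasReg`). Stuffle regularization sends e₁, e₂ to T and (T² -
ζ(2))/2; shuffle regularization sends them to T and T²/2. The two therefore differ by κ ζ(2)/2, and
W becomes a stuffle-regularized polynomial plus the explicit constant `correction`.

Stuffle side. The same products and triple sums, truncated at M, are `boxSum` and `wedgeSum`. Off
the diagonal B_r(1/m,1/n) = (n^(-r-1) - m^(-r-1))/(m-n), so both become sums of e^n n^(-r-1) φ(n)
with e = pqs and φ made of alternating harmonic sums. These φ are evaluated up to O(log M ·
n/(M-n+1)), an error that the weight n^(-r-1), r ≥ 1, makes negligible (`tendsto_boxSum_sub`).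
Stuffle expansion of the resulting `mainSum` gives the right-hand sides, up to null sequences coming
from two weight-two relations: barred ζ(2) is -ζ(2)/2, and ζ(1,1) with both entries barred minus
ζ(1,1) with only the first barred is barred ζ(2). -/

noncomputable section

namespace EulerSum

open Finset.HasAntidiagonal (antidiagonal)

/-! ### Signs, truncated sums and their stuffle products -/

/-- The real number attached to a sign. -/
def sgn (z : ℤˣ) : ℝ := ((z : ℤ) : ℝ)

@[simp] theorem sgn_one : sgn 1 = 1 := by simp [sgn]
@[simp] theorem sgn_neg_one : sgn (-1) = -1 := by simp [sgn]
theorem sgn_mul (y z : ℤˣ) : sgn (y * z) = sgn y * sgn z := by simp [sgn]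
theorem sgn_mul_self (z : ℤˣ) : sgn z * sgn z = 1 := by
  rcases Int.units_eq_one_or z with h | h <;> simp [h]
@[simp] theorem abs_sgn (z : ℤˣ) : |sgn z| = 1 := by
  rcases Int.units_eq_one_or z with h | h <;> simp [h]
@[simp] theorem abs_sgn_pow (z : ℤˣ) (n : ℕ) : |sgn z ^ n| = 1 := by simp [abs_pow]
theorem sgn_pow_mul_self (z : ℤˣ) (n : ℕ) : sgn z ^ n * sgn z ^ n = 1 := by
  rw [← mul_pow, sgn_mul_self, one_pow]

theorem truncSum_nil (M : ℕ) : truncSum [] M = 1 := rfl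

theorem truncSum_cons (s : ℕ) (z : ℤˣ) (k : Index) (M : ℕ) :
    truncSum ((s, z) :: k) M =
      ∑ n ∈ Finset.Icc 1 M, sgn z ^ n / (n : ℝ) ^ s * truncSum k (n - 1) := rfl

@[simp] theorem truncSum_cons_zero (p : ℕ × ℤˣ) (k : Index) : truncSum (p :: k) 0 = 0 := by
  obtain ⟨s, z⟩ := p
  simp [truncSum_cons]

theorem truncSum_cons_succ (s : ℕ) (z : ℤˣ) (k : Index) (M : ℕ) :
    truncSum ((s, z) :: k) (M + 1) = truncSum ((s, z) :: k) M +
      sgn z ^ (M + 1) / ((M : ℝ) + 1) ^ s * truncSum k M := by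
  rw [truncSum_cons, Finset.sum_Icc_succ_top (by omega), truncSum_cons]
  simp

theorem truncSum_cons_pred (s : ℕ) (z : ℤˣ) (k : Index) {M : ℕ} (hM : 1 ≤ M) :
    truncSum ((s, z) :: k) M = truncSum ((s, z) :: k) (M - 1) +
      sgn z ^ M / (M : ℝ) ^ s * truncSum k (M - 1) := by
  obtain ⟨n, rfl⟩ := Nat.exists_eq_add_of_le' hM
  simpa using truncSum_cons_succ s z k n

theorem truncSum_single (s : ℕ) (z : ℤˣ) (M : ℕ) :
    truncSum [(s, z)] M = ∑ n ∈ Finset.Icc 1 M, sgn z ^ n / (n : ℝ) ^ s := by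
  simp [truncSum_cons, truncSum_nil]

/-- Stuffle product of two truncated sums of depth one. -/
theorem truncSum_mul_single (a b : ℕ) (x y : ℤˣ) (M : ℕ) :
    truncSum [(a, x)] M * truncSum [(b, y)] M =
      truncSum [(a, x), (b, y)] M + truncSum [(b, y), (a, x)] M
        + truncSum [(a + b, x * y)] M := by
  induction M with
  | zero => simp
  | succ M ih =>
    simp only [truncSum_cons_succ, truncSum_nil, sgn_mul, mul_pow, pow_add _ a b]
    have h : (M : ℝ) + 1 ≠ 0 := by positivity
    field_simp at ih ⊢
    linear_combination ((M + 1 : ℝ) ^ a * (M + 1) ^ b) * ih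

/-- Stuffle product of truncated sums of depths one and two. -/
theorem truncSum_mul_pair (a b c : ℕ) (x y z : ℤˣ) (M : ℕ) :
    truncSum [(a, x)] M * truncSum [(b, y), (c, z)] M =
      truncSum [(a, x), (b, y), (c, z)] M + truncSum [(b, y), (a, x), (c, z)] M
        + truncSum [(b, y), (c, z), (a, x)] M
        + truncSum [(a + b, x * y), (c, z)] M + truncSum [(b, y), (a + c, x * z)] M := by
  induction M with
  | zero => simp
  | succ M ih =>
    have h1 := truncSum_mul_single a c x z M
    simp only [truncSum_cons_succ, truncSum_nil, sgn_mul, mul_pow, pow_add _ a b] at ih h1 ⊢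
    have h : (M : ℝ) + 1 ≠ 0 := by positivity
    generalize truncSum [(a, x)] M = A at *
    generalize truncSum [(c, z)] M = B at *
    have e1 : sgn x ^ (M + 1) * sgn y ^ (M + 1) / ((M + 1 : ℝ) ^ a * (M + 1) ^ b) =
      (sgn x ^ (M + 1) / (M + 1 : ℝ) ^ a) * (sgn y ^ (M + 1) / (M + 1 : ℝ) ^ b) := by
      rw [div_mul_div_comm]
    rw [e1]
    linear_combination ih + (sgn y ^ (M + 1) / (M + 1 : ℝ) ^ b) * h1

/-! ### Convergence at rate n^(-1/2) -/

/-- Sequences of size `O(n^{-1/2})`. -/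
def Rate (f : ℕ → ℝ) : Prop := ∃ C : ℝ, ∀ n : ℕ, |f n| ≤ C / √((n : ℝ) + 1)

theorem Rate.add {f g : ℕ → ℝ} (hf : Rate f) (hg : Rate g) : Rate (fun n => f n + g n) := by
  obtain ⟨C, hC⟩ := hf
  obtain ⟨D, hD⟩ := hg
  refine ⟨C + D, fun n => (abs_add_le _ _).trans ?_⟩
  rw [add_div]
  exact add_le_add (hC n) (hD n)

theorem Rate.const_mul {f : ℕ → ℝ} (c : ℝ) (hf : Rate f) : Rate (fun n => c * f n) := by
  obtain ⟨C, hC⟩ := hf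
  refine ⟨|c| * C, fun n => ?_⟩
  rw [abs_mul, mul_div_assoc]
  exact mul_le_mul_of_nonneg_left (hC n) (abs_nonneg _)

theorem tendsto_inv_sqrt_succ : Tendsto (fun n : ℕ => 1 / √((n : ℝ) + 1)) atTop (𝓝 0) := by
  simp only [one_div]
  exact tendsto_inv_atTop_zero.comp (Real.tendsto_sqrt_atTop.comp
    (tendsto_atTop_add_const_right _ _ tendsto_natCast_atTop_atTop))

theorem Rate.tendsto {f : ℕ → ℝ} (hf : Rate f) : Tendsto f atTop (𝓝 0) := by
  obtain ⟨C, hC⟩ := hf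
  refine squeeze_zero_norm (a := fun n : ℕ => C * (1 / √((n : ℝ) + 1))) (fun n => ?_) ?_
  · simpa [div_eq_mul_inv] using hC n
  · simpa using tendsto_inv_sqrt_succ.const_mul C

theorem sqrt_add_two_le (n : ℕ) : √((n : ℝ) + 2) ≤ 3 / 2 * √((n : ℝ) + 1) := by
  rw [Real.sqrt_le_left (by positivity), mul_pow, Real.sq_sqrt (by positivity)]
  have : (0 : ℝ) ≤ n := n.cast_nonneg
  linarith

/-- Telescoping majorant for the sum of n^(-1/2): if a, b are the two roots, then (b-a)(b+a) = 1 and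
b ≤ 3a/2, so b+a ≤ 3a. -/
theorem inv_sqrt_le_sub (n : ℕ) :
    1 / √((n : ℝ) + 1) ≤ 3 * (√((n : ℝ) + 2) - √((n : ℝ) + 1)) := by
  have h0 : 0 < √((n : ℝ) + 1) := Real.sqrt_pos.mpr (by positivity)
  have h1 : 0 ≤ √((n : ℝ) + 2) := Real.sqrt_nonneg _
  have h2 := Real.sq_sqrt (show (0 : ℝ) ≤ (n : ℝ) + 1 by positivity)
  have h3 := Real.sq_sqrt (show (0 : ℝ) ≤ (n : ℝ) + 2 by positivity)
  have h4 := sqrt_add_two_le n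
  rw [div_le_iff₀ h0]
  set a := √((n : ℝ) + 1)
  set b := √((n : ℝ) + 2)
  have hab : (b - a) * (b + a) = 1 := by nlinarith
  have hba : 0 ≤ b - a := by
    by_contra h
    push Not at h
    nlinarith
  nlinarith [mul_le_mul_of_nonneg_left (show b + a ≤ 3 * a by linarith) hba]

theorem inv_mul_sqrt_le_sub (n : ℕ) :
    1 / (((n : ℝ) + 1) * √((n : ℝ) + 1)) ≤
      4 * (1 / √((n : ℝ) + 1) - 1 / √((n : ℝ) + 2)) := by
  have h0 : 0 < √((n : ℝ) + 1) := Real.sqrt_pos.mpr (by positivity)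
  have h1 : 0 < √((n : ℝ) + 2) := Real.sqrt_pos.mpr (by positivity)
  have h2 := Real.sq_sqrt (show (0 : ℝ) ≤ (n : ℝ) + 1 by positivity)
  have h3 := Real.sq_sqrt (show (0 : ℝ) ≤ (n : ℝ) + 2 by positivity)
  have h4 := sqrt_add_two_le n
  set a := √((n : ℝ) + 1)
  set b := √((n : ℝ) + 2)
  have hab : (b - a) * (b + a) = 1 := by nlinarith
  have e : 4 * (1 / a - 1 / b) = 4 / (a * b * (a + b)) := by
    rw [div_sub_div _ _ h0.ne' h1.ne', mul_div_assoc', div_eq_div_iff (by positivity)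
      (by positivity)]
    linear_combination 4 * a * b * hab
  rw [e, ← h2, div_le_div_iff₀ (by positivity) (by positivity)]
  have : a * b * (a + b) ≤ a * (3 / 2 * a) * (a + 3 / 2 * a) := by gcongr
  nlinarith [pow_pos h0 3]

/-- A sequence with steps `O(n^{-3/2})` converges with rate `O(n^{-1/2})`. -/
theorem exists_rate_of_step {f : ℕ → ℝ} {C : ℝ}
    (h : ∀ n : ℕ, |f (n + 1) - f n| ≤ C / (((n : ℝ) + 1) * √((n : ℝ) + 1))) :
    ∃ L, Rate (fun n => f n - L) := by
  have hC : 0 ≤ C := by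
    have := (abs_nonneg _).trans (h 0)
    simpa using this
  -- The majorant telescopes, so the tail from n on is at most 4C/√(n+1); this yields the Cauchy
  -- property and the rate together.
  have key : ∀ n j : ℕ, |f (n + j) - f n| ≤
      4 * C * (1 / √((n : ℝ) + 1) - 1 / √(((n + j : ℕ) : ℝ) + 1)) := by
    intro n j
    induction j with
    | zero => simp
    | succ j ih =>
      have h1 := h (n + j)
      have h2 := mul_le_mul_of_nonneg_left (inv_mul_sqrt_le_sub (n + j)) hC
      rw [← mul_div_assoc, mul_one] at h2
      have h3 : |f (n + (j + 1)) - f n| ≤ |f (n + j + 1) - f (n + j)| + |f (n + j) - f n| := by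
        rw [← add_assoc]
        exact abs_sub_le _ _ _
      have e : ((n + (j + 1) : ℕ) : ℝ) + 1 = ((n + j : ℕ) : ℝ) + 2 := by push_cast; ring
      rw [e]
      linarith
  have key2 : ∀ n m : ℕ, n ≤ m → |f m - f n| ≤ 4 * C * (1 / √((n : ℝ) + 1)) := by
    intro n m hnm
    obtain ⟨j, rfl⟩ := Nat.exists_eq_add_of_le hnm
    refine (key n j).trans (mul_le_mul_of_nonneg_left ?_ (by positivity))
    have : 0 ≤ 1 / √(((n + j : ℕ) : ℝ) + 1) := by positivity
    linarith
  have hc : CauchySeq f := by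
    refine cauchySeq_of_le_tendsto_0' (fun n : ℕ => 4 * C * (1 / √((n : ℝ) + 1))) ?_ ?_
    · intro n m hnm
      rw [dist_comm, Real.dist_eq]
      exact key2 n m hnm
    · simpa using tendsto_inv_sqrt_succ.const_mul (4 * C)
  obtain ⟨L, hL⟩ := cauchySeq_tendsto_of_complete hc
  refine ⟨L, 4 * C, fun n => ?_⟩
  have h1 : Tendsto (fun m => |f m - f n|) atTop (𝓝 |L - f n|) := (hL.sub_const _).abs
  have h2 := le_of_tendsto h1 (eventually_atTop.mpr ⟨n, fun m hm => key2 n m hm⟩)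
  rw [abs_sub_comm]
  simpa [div_eq_mul_inv] using h2

theorem abs_sgn_pow_div (z : ℤˣ) (m s n : ℕ) (x : ℝ) :
    |sgn z ^ m / ((n : ℝ) + 1) ^ s * x| = |x| / ((n : ℝ) + 1) ^ s := by
  rw [abs_mul, abs_div, abs_sgn_pow, abs_of_pos (show (0 : ℝ) < ((n : ℝ) + 1) ^ s by positivity)]
  ring

theorem IsPos.tail {p : ℕ × ℤˣ} {k : Index} (h : IsPos (p :: k)) : IsPos k :=
  fun q hq => h q (List.mem_cons_of_mem _ hq)

theorem IsPos.head {s : ℕ} {z : ℤˣ} {k : Index} (h : IsPos ((s, z) :: k)) : 1 ≤ s :=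
  h (s, z) List.mem_cons_self

theorem abs_truncSum_div_le {k : Index} {C : ℝ}
    (hC : ∀ n : ℕ, |truncSum k n| ≤ C * √((n : ℝ) + 1)) {s : ℕ} (hs : 1 ≤ s) (n : ℕ) :
    |truncSum k n| / ((n : ℝ) + 1) ^ s ≤ C / √((n : ℝ) + 1) := by
  have hs : (n : ℝ) + 1 ≤ ((n : ℝ) + 1) ^ s :=
    le_self_pow₀ (by linarith [n.cast_nonneg (α := ℝ)]) (by omega)
  calc |truncSum k n| / ((n : ℝ) + 1) ^ s
      ≤ C * √((n : ℝ) + 1) / ((n : ℝ) + 1) := by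
        exact div_le_div₀ ((abs_nonneg _).trans (hC n)) (hC n) (by positivity) hs
    _ = C / √((n : ℝ) + 1) := by
      rw [mul_div_assoc, Real.sqrt_div_self', mul_one_div]

/-- The true growth is a power of log n. The crude bound √n is stable under prefixing an entry,
since a further division by n leaves n^(-1/2), whose partial sums are again O(√n). -/
theorem truncSum_growth (k : Index) (hk : IsPos k) :
    ∃ C : ℝ, 0 ≤ C ∧ ∀ n : ℕ, |truncSum k n| ≤ C * √((n : ℝ) + 1) := by
  induction k with
  | nil =>
    refine ⟨1, zero_le_one, fun n => ?_⟩
    simp [truncSum_nil]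
  | cons p k ih =>
    obtain ⟨s, z⟩ := p
    obtain ⟨C, hC0, hC⟩ := ih hk.tail
    refine ⟨3 * C, by positivity, fun n => ?_⟩
    induction n with
    | zero => simp [hC0]
    | succ n ihn =>
      rw [truncSum_cons_succ]
      refine (abs_add_le _ _).trans ?_
      rw [abs_sgn_pow_div]
      have h1 := abs_truncSum_div_le hC hk.head n
      rw [div_eq_mul_one_div C] at h1
      have h2 := mul_le_mul_of_nonneg_left (inv_sqrt_le_sub n) hC0
      have e : ((n + 1 : ℕ) : ℝ) + 1 = (n : ℝ) + 2 := by push_cast; ring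
      rw [e]
      linarith

theorem truncSum_step_le (k : Index) (hk : IsPos k) :
    ∃ C : ℝ, 0 ≤ C ∧ ∀ n : ℕ, |truncSum k (n + 1) - truncSum k n| ≤ C / √((n : ℝ) + 1) := by
  cases k with
  | nil => exact ⟨0, le_rfl, fun n => by simp [truncSum_nil]⟩
  | cons p k =>
    obtain ⟨s, z⟩ := p
    obtain ⟨C, hC0, hC⟩ := truncSum_growth k hk.tail
    refine ⟨C, hC0, fun n => ?_⟩
    rw [truncSum_cons_succ, add_sub_cancel_left, abs_sgn_pow_div]
    exact abs_truncSum_div_le hC hk.head n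

/-! ### Expansions of truncated sums in 1, e₁, e₂ -/

/-- `f` equals `a + b e₁ + c e₂` up to `O(n^{-1/2})`, where `e₁` and `e₂` are the truncated
sums of the indices `(1)` and `(1, 1)`. -/
def HasReg (f : ℕ → ℝ) (a b c : ℝ) : Prop :=
  Rate (fun n => f n - (a + b * truncSum [pl 1] n + c * truncSum [pl 1, pl 1] n))

theorem HasReg.tendsto {f : ℕ → ℝ} {a : ℝ} (h : HasReg f a 0 0) : Tendsto f atTop (𝓝 a) := by
  have := (Rate.tendsto h).add_const a
  simpa using this

theorem hasReg_nil : HasReg (truncSum []) 1 0 0 := ⟨0, fun n => by simp [truncSum_nil]⟩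

/-- Prefixing an unbarred `1`. -/
theorem HasReg.cons_one {k : Index} {a b : ℝ} (h : HasReg (truncSum k) a b 0) :
    ∃ a', HasReg (truncSum (pl 1 :: k)) a' a b := by
  obtain ⟨C, hC⟩ := h
  -- Prefixing 1 turns the constant into e₁ and e₁ into e₂. After subtracting these, a step is the
  -- old error divided by n+1, hence O(n^(-3/2)).
  obtain ⟨L, hL⟩ := exists_rate_of_step (C := C)
    (f := fun n => truncSum (pl 1 :: k) n -
      (a * truncSum [pl 1] n + b * truncSum [pl 1, pl 1] n)) (by
    intro n
    have e : truncSum (pl 1 :: k) (n + 1) - (a * truncSum [pl 1] (n + 1)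
          + b * truncSum [pl 1, pl 1] (n + 1)) - (truncSum (pl 1 :: k) n -
        (a * truncSum [pl 1] n + b * truncSum [pl 1, pl 1] n)) =
        (truncSum k n - (a + b * truncSum [pl 1] n + 0 * truncSum [pl 1, pl 1] n))
          / ((n : ℝ) + 1) := by
      simp only [pl, truncSum_cons_succ, truncSum_nil, sgn_one]
      have : (n : ℝ) + 1 ≠ 0 := by positivity
      field_simp
      ring
    simp only [e]
    rw [abs_div, abs_of_pos (show (0 : ℝ) < (n : ℝ) + 1 by positivity), div_mul_eq_div_div_swap]
    exact div_le_div_of_nonneg_right (hC n) (by positivity))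
  refine ⟨L, ?_⟩
  unfold HasReg
  convert hL using 2
  ring

/-- Prefixing an exponent at least two. -/
theorem exists_hasReg_of_two_le {k : Index} (hk : IsPos k) {s : ℕ} (hs : 2 ≤ s) (z : ℤˣ) :
    ∃ a, HasReg (truncSum ((s, z) :: k)) a 0 0 := by
  obtain ⟨C, hC0, hC⟩ := truncSum_growth k hk
  obtain ⟨L, hL⟩ := exists_rate_of_step (C := C) (f := truncSum ((s, z) :: k)) (by
    intro n
    rw [truncSum_cons_succ, add_sub_cancel_left, abs_sgn_pow_div]
    obtain ⟨t, rfl⟩ := Nat.exists_eq_add_of_le' (show 1 ≤ s by omega)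
    rw [pow_succ, ← div_div, mul_comm, ← div_div]
    exact div_le_div_of_nonneg_right (abs_truncSum_div_le hC (by omega) n) (by positivity))
  exact ⟨L, by simpa [HasReg] using hL⟩

/-- Prefixing a barred `1`. -/
theorem exists_hasReg_bar_one {k : Index} (hk : IsPos k) :
    ∃ a, HasReg (truncSum (bar 1 :: k)) a 0 0 := by
  obtain ⟨C, hC0, hC⟩ := truncSum_growth k hk
  obtain ⟨D, hD0, hD⟩ := truncSum_step_le k hk
  have hr : Rate (fun n => (-1 : ℝ) ^ (n + 1) / 2 * (truncSum k n / ((n : ℝ) + 1))) := by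
    refine ⟨C / 2, fun n => ?_⟩
    have := abs_truncSum_div_le hC le_rfl n
    rw [pow_one] at this
    rw [abs_mul, abs_div, abs_div, abs_pow, abs_neg, abs_one, one_pow,
      abs_of_pos (show (0 : ℝ) < (n : ℝ) + 1 by positivity), abs_of_pos (zero_lt_two' ℝ)]
    calc 1 / 2 * (|truncSum k n| / ((n : ℝ) + 1)) ≤ 1 / 2 * (C / √((n : ℝ) + 1)) := by gcongr
      _ = _ := by ring
  -- The partial sum plus half of the next term is the mean of two consecutive partial sums of an
  -- alternating series. Its steps involve only differences of the coefficients and are O(n^(-3/2)).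
  obtain ⟨L, hL⟩ := exists_rate_of_step (C := (D + C) / 2)
    (f := fun n => truncSum (bar 1 :: k) n +
      (-1 : ℝ) ^ (n + 1) / 2 * (truncSum k n / ((n : ℝ) + 1))) (by
    intro n
    have e : truncSum (bar 1 :: k) (n + 1) +
        (-1 : ℝ) ^ (n + 1 + 1) / 2 * (truncSum k (n + 1) / (((n + 1 : ℕ) : ℝ) + 1)) -
        (truncSum (bar 1 :: k) n + (-1 : ℝ) ^ (n + 1) / 2 * (truncSum k n / ((n : ℝ) + 1))) =
        (-1 : ℝ) ^ n / 2 * ((truncSum k (n + 1) - truncSum k n) / ((n : ℝ) + 2)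
          - truncSum k n / (((n : ℝ) + 1) * ((n : ℝ) + 2))) := by
      simp only [bar, truncSum_cons_succ, sgn_neg_one]
      have : (n : ℝ) + 1 ≠ 0 := by positivity
      have : (n : ℝ) + 2 ≠ 0 := by positivity
      have : (n : ℝ) + 1 + 1 ≠ 0 := by positivity
      push_cast
      field_simp
      ring
    simp only [e]
    rw [abs_mul, abs_div, abs_pow, abs_neg, abs_one, one_pow, abs_of_pos (zero_lt_two' ℝ)]
    have h1 : |(truncSum k (n + 1) - truncSum k n) / ((n : ℝ) + 2)| ≤
        D / √((n : ℝ) + 1) / ((n : ℝ) + 1) := by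
      rw [abs_div, abs_of_pos (show (0 : ℝ) < (n : ℝ) + 2 by positivity)]
      gcongr
      · exact hD n
      · linarith
    have h2 : |truncSum k n / (((n : ℝ) + 1) * ((n : ℝ) + 2))| ≤
        C / √((n : ℝ) + 1) / ((n : ℝ) + 1) := by
      rw [abs_div, abs_of_pos (show (0 : ℝ) < ((n : ℝ) + 1) * ((n : ℝ) + 2) by positivity),
        ← div_div]
      have := abs_truncSum_div_le hC le_rfl n
      rw [pow_one] at this
      gcongr
      linarith
    calc _ ≤ 1 / 2 * (D / √((n : ℝ) + 1) / ((n : ℝ) + 1) + C / √((n : ℝ) + 1) / ((n : ℝ) + 1)) := by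
          gcongr
          exact (abs_sub _ _).trans (add_le_add h1 h2)
      _ = _ := by field_simp)
  refine ⟨L, ?_⟩
  have := hL.add (hr.const_mul (-1))
  unfold HasReg
  convert this using 2
  ring

/-- The number of leading unbarred ones. -/
def lead : Index → ℕ
  | [] => 0
  | p :: k => if p = pl 1 then lead k + 1 else 0

/-- Divergence comes from the leading unbarred ones alone: the first other entry produces a
convergent sum, and each leading 1 raises the degree by one. The vanishing clauses record this
degree, which the induction needs because a third leading 1 would leave the span of 1, e₁, e₂. -/
theorem exists_hasReg (k : Index) (hk : IsPos k) (hl : lead k ≤ 2) :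
    ∃ a b c, HasReg (truncSum k) a b c ∧ (lead k ≤ 1 → c = 0) ∧ (lead k = 0 → b = 0) := by
  induction k with
  | nil => exact ⟨1, 0, 0, hasReg_nil, by simp, by simp⟩
  | cons p k ih =>
    by_cases hp : p = pl 1
    · have e : lead (p :: k) = lead k + 1 := by simp [lead, hp]
      rw [e] at hl ⊢
      obtain ⟨a, b, c, h, hc, hb⟩ := ih hk.tail (by omega)
      obtain rfl := hc (by omega)
      obtain ⟨a', h'⟩ := h.cons_one
      exact ⟨a', a, b, hp ▸ h', fun h => hb (by omega), by omega⟩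
    · have hs := hk p List.mem_cons_self
      obtain ⟨s, z⟩ := p
      rcases Nat.lt_or_ge 1 s with h2 | h2
      · obtain ⟨a, h⟩ := exists_hasReg_of_two_le hk.tail h2 z
        exact ⟨a, 0, 0, h, by simp, by simp⟩
      · obtain rfl : s = 1 := le_antisymm h2 hs
        rcases Int.units_eq_one_or z with rfl | rfl
        · exact absurd rfl hp
        · obtain ⟨a, h⟩ := exists_hasReg_bar_one hk.tail
          exact ⟨a, 0, 0, h, by simp, by simp⟩

theorem lead_eq_zero_of_admissible {k : Index} (hk : Admissible k) : lead k = 0 := by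
  cases k with
  | nil => rfl
  | cons p k =>
    have : p ≠ pl 1 := by simpa [Admissible] using hk
    simp [lead, this]

theorem hasReg_eulerZeta {k : Index} (hk : IsPos k) (ha : Admissible k) :
    HasReg (truncSum k) (eulerZeta k) 0 0 := by
  have h0 := lead_eq_zero_of_admissible ha
  obtain ⟨a, b, c, h, hc, hb⟩ := exists_hasReg k hk (by omega)
  obtain rfl := hc (by omega)
  obtain rfl := hb h0
  rwa [eulerZeta, h.tendsto.limUnder_eq]

/-! ### Iterated integrals as power series in the increments -/

/-- The `n`-th increment of the truncated sums of an index. -/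
def incr : Index → ℕ → ℝ
  | [], n => if n = 0 then 1 else 0
  | (s, z) :: k, n => sgn z ^ n / (n : ℝ) ^ s * truncSum k (n - 1)

theorem incr_cons (s : ℕ) (z : ℤˣ) (k : Index) (n : ℕ) :
    incr ((s, z) :: k) n = sgn z ^ n / (n : ℝ) ^ s * truncSum k (n - 1) := rfl

theorem incr_cons_zero {s : ℕ} (hs : 1 ≤ s) (z : ℤˣ) (k : Index) :
    incr ((s, z) :: k) 0 = 0 := by
  simp [incr_cons, show s ≠ 0 by omega]

theorem truncSum_zero {k : Index} (hk : IsPos k) : truncSum k 0 = incr k 0 := by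
  cases k with
  | nil => simp [incr, truncSum_nil]
  | cons p k => obtain ⟨s, z⟩ := p; simp [incr_cons_zero hk.head]

theorem truncSum_succ (k : Index) (n : ℕ) :
    truncSum k (n + 1) = truncSum k n + incr k (n + 1) := by
  cases k with
  | nil => simp [incr, truncSum_nil]
  | cons p k => obtain ⟨s, z⟩ := p; simp [incr_cons, truncSum_cons_succ]

theorem abs_incr_le (k : Index) (hk : IsPos k) : ∃ C : ℝ, 0 ≤ C ∧ ∀ n, |incr k n| ≤ C := by
  obtain ⟨C, hC0, hC⟩ := truncSum_step_le k hk
  refine ⟨C + |incr k 0|, by positivity, fun n => ?_⟩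
  cases n with
  | zero => linarith
  | succ n =>
    have h := hC n
    rw [truncSum_succ, add_sub_cancel_left] at h
    have h1 : C / √((n : ℝ) + 1) ≤ C := by
      refine div_le_self hC0 ?_
      rw [Real.one_le_sqrt]
      linarith [n.cast_nonneg (α := ℝ)]
    linarith [abs_nonneg (incr k 0)]

theorem summable_mul_pow_of_abs_le {b : ℕ → ℝ} {C : ℝ} (hb : ∀ n, |b n| ≤ C * ((n : ℝ) + 1))
    {x : ℝ} (hx0 : 0 ≤ x) (hx1 : x < 1) : Summable (fun n => ‖b n * x ^ n‖) := by
  have h1 : Summable (fun n : ℕ => (n : ℝ) * x ^ n) := by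
    simpa using summable_pow_mul_geometric_of_norm_lt_one 1
      (show ‖x‖ < 1 by rwa [Real.norm_of_nonneg hx0])
  have h2 := summable_geometric_of_lt_one hx0 hx1
  refine Summable.of_nonneg_of_le (fun _ => norm_nonneg _) (fun n => ?_)
    ((h1.add h2).mul_left C)
  rw [norm_mul, Real.norm_eq_abs, norm_pow, Real.norm_of_nonneg hx0]
  calc |b n| * x ^ n ≤ C * ((n : ℝ) + 1) * x ^ n := by gcongr; exact hb n
    _ = _ := by ring

theorem hasSum_succ_iff {f g : ℕ → ℝ} {S : ℝ} (h0 : f 0 = 0) (h : ∀ n, f (n + 1) = g n) :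
    HasSum f S ↔ HasSum g S := by
  rw [← hasSum_nat_add_iff' (f := f) 1, Finset.sum_range_one, h0, sub_zero]
  simp only [h]

/-- Termwise integration of a power series of radius at least one. -/
theorem hasSum_integral_of_hasSum {b : ℕ → ℝ} {C : ℝ} (hb : ∀ n, |b n| ≤ C * ((n : ℝ) + 1))
    {F : ℝ → ℝ} {x : ℝ} (hx0 : 0 ≤ x) (hx1 : x < 1)
    (hF : ∀ t ∈ Set.Ioc 0 x, HasSum (fun n => b n * t ^ n) (F t)) :
    HasSum (fun n : ℕ => b n / ((n : ℝ) + 1) * x ^ (n + 1)) (∫ t in (0 : ℝ)..x, F t) := by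
  let f : ℕ → C(ℝ, ℝ) := fun n => ⟨fun t => b n * t ^ n, by fun_prop⟩
  have hs : Summable fun i =>
      ‖(f i).restrict (⟨Set.uIcc 0 x, isCompact_uIcc⟩ : TopologicalSpace.Compacts ℝ)‖ := by
    refine Summable.of_nonneg_of_le (fun _ => norm_nonneg _) (fun n => ?_)
      (summable_mul_pow_of_abs_le hb hx0 hx1)
    refine (ContinuousMap.norm_le _ (norm_nonneg _)).mpr fun t => ?_
    obtain ⟨t, ht⟩ := t
    have ht' : t ∈ Set.Icc 0 x := by simpa [Set.uIcc_of_le hx0] using ht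
    simp only [ContinuousMap.restrict_apply, f, ContinuousMap.coe_mk, norm_mul, norm_pow]
    rw [Real.norm_of_nonneg ht'.1, Real.norm_of_nonneg hx0]
    gcongr
    exacts [ht'.1, ht'.2]
  have h := intervalIntegral.hasSum_intervalIntegral_of_summable_norm hs
  have e1 : (∫ t in (0 : ℝ)..x, ∑' i, f i t) = ∫ t in (0 : ℝ)..x, F t := by
    refine intervalIntegral.integral_congr_ae (Eventually.of_forall fun t ht => ?_)
    rw [Set.uIoc_of_le hx0] at ht
    exact (hF t ht).tsum_eq
  rw [e1] at h
  have e2 : (fun n => ∫ t in (0 : ℝ)..x, f n t) =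
      fun n : ℕ => b n / ((n : ℝ) + 1) * x ^ (n + 1) := by
    funext n
    simp only [f, ContinuousMap.coe_mk, intervalIntegral.integral_const_mul, integral_pow]
    ring
  rwa [e2] at h

/-- Truncated iterated integrals are generating functions of increments. -/
theorem hasSum_iterInt (k : Index) (hk : IsPos k) (a : ℤˣ) {x : ℝ} (hx0 : 0 ≤ x) (hx1 : x < 1) :
    HasSum (fun n => sgn a ^ n * incr k n * x ^ n) (iterInt (forms a k) x) := by
  induction k generalizing a x with
  | nil =>
    have := hasSum_single (f := fun n => sgn a ^ n * incr [] n * x ^ n) 0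
      (fun n hn => by simp [incr, hn])
    simpa [incr, forms, iterInt] using this
  | cons p k ih =>
    obtain ⟨s, z⟩ := p
    have hs := hk.head
    obtain ⟨j, rfl⟩ := Nat.exists_eq_add_of_le' hs
    obtain ⟨C, hC0, hC⟩ := truncSum_growth k hk.tail
    have hC' : ∀ n, |truncSum k n| ≤ C * ((n : ℝ) + 1) := fun n => by
      refine (hC n).trans (mul_le_mul_of_nonneg_left ?_ hC0)
      rw [Real.sqrt_le_left (by positivity)]
      nlinarith [n.cast_nonneg (α := ℝ)]
    replace hk := hk.tail
    replace ih := fun b {y : ℝ} hy0 hy1 => ih hk b (x := y) hy0 hy1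
    clear hs
    simp only [forms, Nat.add_sub_cancel]
    -- The innermost form dt/(az - t) of the block turns increments into truncated sums divided by
    -- n; each further dt/t divides the n-th coefficient by n once more.
    induction j generalizing x with
    | zero =>
      simp only [List.replicate_zero, List.nil_append, iterInt]
      have hb : ∀ n, |sgn (a * z) ^ (n + 1) * truncSum k n| ≤ C * ((n : ℝ) + 1) := fun n => by
        rw [abs_mul, abs_sgn_pow, one_mul]
        exact hC' n
      have h := hasSum_integral_of_hasSum hb hx0 hx1
        (F := fun t => 1 / ((((a * z : ℤˣ) : ℤ) : ℝ) - t) * iterInt (forms (a * z) k) t) (by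
        intro t ht
        have ht1 : t < 1 := ht.2.trans_lt hx1
        have hi := ih (a * z) ht.1.le ht1
        obtain ⟨G, hG⟩ : ∃ G, HasSum (fun n => sgn (a * z) ^ (n + 1) * truncSum k n * t ^ n) G :=
          (summable_mul_pow_of_abs_le hb ht.1.le ht1).of_norm
        -- Multiplying the series G of truncated sums by az - t takes differences of its
        -- coefficients, which leaves the series of increments. Hence G is the integrand.
        have h1 := hG.mul_left (sgn (a * z))
        have h2 : HasSum (fun n => if n = 0 then 0 else
            sgn (a * z) ^ n * truncSum k (n - 1) * t ^ n) (t * G) := by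
          refine (hasSum_succ_iff (by simp) fun n => ?_).mpr (hG.mul_left t)
          simp only [Nat.add_sub_cancel, Nat.succ_ne_zero, if_false]
          ring
        have h3 := h1.sub h2
        have e : (fun n => sgn (a * z) * (sgn (a * z) ^ (n + 1) * truncSum k n * t ^ n) -
            if n = 0 then 0 else sgn (a * z) ^ n * truncSum k (n - 1) * t ^ n) =
            fun n => sgn (a * z) ^ n * incr k n * t ^ n := by
          funext n
          have e1 := sgn_mul_self (a * z)
          cases n with
          | zero =>
            rw [← truncSum_zero hk]
            simp only [if_true, pow_zero, zero_add, pow_one]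
            linear_combination truncSum k 0 * e1
          | succ n =>
            have e2 := truncSum_succ k n
            simp only [Nat.add_sub_cancel, Nat.succ_ne_zero, if_false]
            linear_combination sgn (a * z) ^ (n + 1) * t ^ (n + 1) * e2 +
              sgn (a * z) ^ (n + 1) * truncSum k (n + 1) * t ^ (n + 1) * e1
        rw [e] at h3
        have h4 := h3.unique hi
        have hne : sgn (a * z) - t ≠ 0 := by
          rcases Int.units_eq_one_or (a * z) with h | h <;> rw [h] <;> simp
          · linarith
          · linarith [ht.1]
        have e5 : 1 / ((((a * z : ℤˣ) : ℤ) : ℝ) - t) * iterInt (forms (a * z) k) t = G := by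
          change 1 / (sgn (a * z) - t) * _ = G
          rw [← h4]
          field_simp
        rw [e5]
        exact hG)
      refine (hasSum_succ_iff (by simp [incr_cons]) fun n => ?_).mpr h
      rw [incr_cons, sgn_mul, mul_pow]
      push_cast
      simp only [pow_one]
      ring
    | succ j ihj =>
      simp only [List.replicate_succ, List.cons_append, iterInt]
      have hb : ∀ n : ℕ, |sgn a ^ (n + 1) * incr ((j + 1, z) :: k) (n + 1)| ≤
          C * ((n : ℝ) + 1) := fun n => by
        rw [abs_mul, abs_sgn_pow, one_mul, incr_cons]
        push_cast
        rw [abs_sgn_pow_div]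
        refine (div_le_self (abs_nonneg _) ?_).trans (hC' n)
        exact one_le_pow₀ (by linarith [n.cast_nonneg (α := ℝ)])
      have h := hasSum_integral_of_hasSum hb hx0 hx1
        (F := fun t => 1 / t * iterInt (List.replicate j (fun t : ℝ => 1 / t) ++
          (fun t : ℝ => 1 / ((((a * z : ℤˣ) : ℤ) : ℝ) - t)) :: forms (a * z) k) t) (by
        intro t ht
        have h1 := ihj ht.1.le (ht.2.trans_lt hx1)
        rw [hasSum_succ_iff (by simp [incr_cons]) (fun n => rfl)] at h1
        have h2 := h1.mul_left (1 / t)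
        have e : (fun n => 1 / t * (sgn a ^ (n + 1) * incr ((j + 1, z) :: k) (n + 1) *
            t ^ (n + 1))) = fun n => sgn a ^ (n + 1) * incr ((j + 1, z) :: k) (n + 1) * t ^ n := by
          funext n
          have := ht.1.ne'
          field_simp
          ring
        rwa [e] at h2)
      refine (hasSum_succ_iff (by simp [incr_cons]) fun n => ?_).mpr h
      rw [incr_cons, incr_cons]
      push_cast
      rw [pow_succ _ (j + 1), ← div_div]
      ring

theorem hasSum_truncInt (k : Index) (hk : IsPos k) {ε : ℝ} (h0 : 0 < ε) (h1 : ε ≤ 1) :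
    HasSum (fun n => incr k n * (1 - ε) ^ n) (truncInt k ε) := by
  simpa [truncInt] using hasSum_iterInt k hk 1 (x := 1 - ε) (by linarith) (by linarith)

/-! ### Calculus of polynomial asymptotics -/

/-- `f` is negligible with respect to all powers of the scale `x`. -/
def Negl {α : Type*} (l : Filter α) (x f : α → ℝ) : Prop :=
  ∀ j : ℕ, Tendsto (fun i => f i * x i ^ j) l (𝓝 0)

/-- `f` is the polynomial `P` in the scale `x`, up to a negligible error. -/
def HasPoly {α : Type*} (l : Filter α) (x f : α → ℝ) (P : ℝ[X]) : Prop :=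
  Negl l x (fun i => f i - P.eval (x i))

section
variable {α : Type*} {l : Filter α} {x f g : α → ℝ} {P Q : ℝ[X]}

theorem Negl.tendsto (h : Negl l x f) : Tendsto f l (𝓝 0) := by simpa using h 0

theorem Negl.congr (h : Negl l x f) (e : ∀ i, f i = g i) : Negl l x g := by
  rwa [← funext e]

theorem Negl.add (hf : Negl l x f) (hg : Negl l x g) : Negl l x (fun i => f i + g i) := by
  intro j
  simpa [add_mul] using (hf j).add (hg j)

theorem Negl.mul (hf : Negl l x f) (hg : Negl l x g) : Negl l x (fun i => f i * g i) := by
  intro j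
  have := (hf j).mul hg.tendsto
  rw [mul_zero] at this
  refine this.congr fun i => ?_
  ring

theorem Negl.mul_eval (hf : Negl l x f) (P : ℝ[X]) :
    Negl l x (fun i => f i * P.eval (x i)) := by
  induction P using Polynomial.induction_on' with
  | add p q hp hq => exact (hp.add hq).congr fun i => by simp [mul_add]
  | monomial n a =>
    intro j
    have := (hf (n + j)).const_mul a
    rw [mul_zero] at this
    refine this.congr fun i => ?_
    simp only [eval_monomial, pow_add]
    ring

theorem HasPoly.tendsto (h : HasPoly l x f P) :
    Tendsto (fun i => f i - P.eval (x i)) l (𝓝 0) := Negl.tendsto h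

theorem HasPoly.congr (h : HasPoly l x f P) (e : ∀ i, f i = g i) : HasPoly l x g P := by
  rwa [← funext e]

theorem HasPoly.add (hf : HasPoly l x f P) (hg : HasPoly l x g Q) :
    HasPoly l x (fun i => f i + g i) (P + Q) :=
  (Negl.add hf hg).congr fun i => by simp; ring

theorem HasPoly.mul (hf : HasPoly l x f P) (hg : HasPoly l x g Q) :
    HasPoly l x (fun i => f i * g i) (P * Q) :=
  (((Negl.mul hf hg).add (Negl.mul_eval hf Q)).add (Negl.mul_eval hg P)).congr
    fun i => by simp; ring

theorem hasPoly_const (c : ℝ) : HasPoly l x (fun _ => c) (C c) := by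
  intro j
  simpa using tendsto_const_nhds

theorem HasPoly.const_mul (hf : HasPoly l x f P) (c : ℝ) :
    HasPoly l x (fun i => c * f i) (C c * P) := (hasPoly_const c).mul hf

theorem HasPoly.sub (hf : HasPoly l x f P) (hg : HasPoly l x g Q) :
    HasPoly l x (fun i => f i - g i) (P - Q) := by
  have := (hf.add (hg.const_mul (-1))).congr (g := fun i => f i - g i) fun i => by ring
  convert this using 1
  simp [sub_eq_add_neg]

theorem hasPoly_sum {ι : Type*} (s : Finset ι) {F : ι → α → ℝ} {R : ι → ℝ[X]}
    (h : ∀ i ∈ s, HasPoly l x (F i) (R i)) :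
    HasPoly l x (fun a => ∑ i ∈ s, F i a) (∑ i ∈ s, R i) := by
  classical
  induction s using Finset.induction_on with
  | empty => simpa using hasPoly_const (l := l) (x := x) 0
  | insert i s hi ih =>
    simp only [Finset.sum_insert hi]
    exact (h i (Finset.mem_insert_self i s)).add
      (ih fun j hj => h j (Finset.mem_insert_of_mem hj))

theorem tendsto_pow_mul_exp_neg_half (j : ℕ) :
    Tendsto (fun y : ℝ => y ^ j * Real.exp (-y / 2)) atTop (𝓝 0) := by
  have h1 := (Real.tendsto_pow_mul_exp_neg_atTop_nhds_zero j).comp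
    (tendsto_id.atTop_div_const (zero_lt_two' ℝ))
  have h2 := h1.const_mul (2 ^ j)
  rw [mul_zero] at h2
  refine h2.congr fun y => ?_
  simp only [Function.comp_apply, id, div_pow, neg_div]
  field_simp

/-- One criterion for both limits: exp(-x/2) is a multiple of M^(-1/2) on the scale log M + γ, and
is √ε on the scale -log ε. -/
theorem negl_of_le (hx : Tendsto x l atTop) {K : ℝ}
    (h : ∀ᶠ i in l, |f i| ≤ K * (1 + x i) * Real.exp (-x i / 2)) : Negl l x f := by
  intro j
  have h1 := ((tendsto_pow_mul_exp_neg_half j).add (tendsto_pow_mul_exp_neg_half (j + 1))).comp hx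
  have h2 := h1.const_mul K
  simp only [add_zero, mul_zero] at h2
  refine squeeze_zero_norm' ?_ h2
  filter_upwards [h, hx.eventually_ge_atTop 0] with i hi hi0
  rw [norm_mul, Real.norm_eq_abs, norm_pow, Real.norm_of_nonneg hi0]
  calc |f i| * x i ^ j ≤ K * (1 + x i) * Real.exp (-x i / 2) * x i ^ j := by gcongr
    _ = _ := by simp only [Function.comp_apply]; ring

end

/-- The scale `log M + γ`. -/
def logScale (M : ℕ) : ℝ := Real.log M + Real.eulerMascheroniConstant

theorem tendsto_logScale : Tendsto logScale atTop atTop :=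
  tendsto_atTop_add_const_right _ _
    (Real.tendsto_log_atTop.comp tendsto_natCast_atTop_atTop)

theorem tendsto_neg_log : Tendsto (fun ε : ℝ => -Real.log ε) (𝓝[>] 0) atTop :=
  tendsto_neg_atBot_atTop.comp Real.tendsto_log_nhdsGT_zero

theorem sqrt_eq_exp {y : ℝ} (hy : 0 < y) : √y = Real.exp (Real.log y / 2) := by
  rw [Real.sqrt_eq_rpow, Real.rpow_def_of_pos hy]
  congr 1
  ring

theorem Rate.negl {f : ℕ → ℝ} (hf : Rate f) : Negl atTop logScale f := by
  obtain ⟨C, hC⟩ := hf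
  have hC0 : 0 ≤ C := by
    have := (abs_nonneg _).trans (hC 0)
    simpa using this
  refine negl_of_le tendsto_logScale (K := C * Real.exp (Real.eulerMascheroniConstant / 2)) ?_
  filter_upwards [tendsto_logScale.eventually_ge_atTop 0, eventually_ge_atTop 1] with n h1 h2
  have hn : (0 : ℝ) < n := by exact_mod_cast h2
  have e : Real.exp (Real.eulerMascheroniConstant / 2) * Real.exp (-logScale n / 2) =
      1 / √(n : ℝ) := by
    rw [sqrt_eq_exp hn, ← Real.exp_add, one_div, ← Real.exp_neg, logScale]
    congr 1
    ring
  calc |f n| ≤ C / √((n : ℝ) + 1) := hC n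
    _ ≤ C / √(n : ℝ) := by gcongr; linarith
    _ = C * 1 * (1 / √(n : ℝ)) := by ring
    _ ≤ C * (1 + logScale n) * (1 / √(n : ℝ)) := by gcongr; linarith
    _ = _ := by rw [← e]; ring

/-! ### Shuffle products and the passage from sums to integrals -/

theorem hasSum_mul_truncInt {k m : Index} (hk : IsPos k) (hm : IsPos m) {ε : ℝ} (h0 : 0 < ε)
    (h1 : ε ≤ 1) :
    HasSum (fun n => (∑ p ∈ antidiagonal n, incr k p.1 * incr m p.2) * (1 - ε) ^ n)
      (truncInt k ε * truncInt m ε) := by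
  have hs : ∀ k, IsPos k → Summable fun n => ‖incr k n * (1 - ε) ^ n‖ := by
    intro k hk
    obtain ⟨C, hC0, hC⟩ := abs_incr_le k hk
    refine summable_mul_pow_of_abs_le (C := C) (fun n => (hC n).trans ?_) (by linarith)
      (by linarith)
    nlinarith [n.cast_nonneg (α := ℝ)]
  have e := tsum_mul_tsum_eq_tsum_sum_antidiagonal_of_summable_norm (hs k hk) (hs m hm)
  rw [(hasSum_truncInt k hk h0 h1).tsum_eq, (hasSum_truncInt m hm h0 h1).tsum_eq] at e
  have h := (summable_norm_sum_mul_antidiagonal_of_summable_norm (hs k hk) (hs m hm)).of_norm.hasSum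
  rw [← e] at h
  have e2 : (fun n => (∑ p ∈ antidiagonal n, incr k p.1 * incr m p.2) * (1 - ε) ^ n) =
      fun n => ∑ p ∈ antidiagonal n,
        incr k p.1 * (1 - ε) ^ p.1 * (incr m p.2 * (1 - ε) ^ p.2) := by
    funext n
    rw [Finset.sum_mul]
    refine Finset.sum_congr rfl fun p hp => ?_
    rw [← Finset.HasAntidiagonal.mem_antidiagonal.mp hp, pow_add]
    ring
  rwa [e2]

theorem sum_range_succ_eq_sum_Icc (f : ℕ → ℝ) (n : ℕ) :
    ∑ i ∈ Finset.range (n + 1), f i = f 0 + ∑ i ∈ Finset.Icc 1 n, f i := by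
  induction n with
  | zero => simp
  | succ n ih => rw [Finset.sum_range_succ, ih, Finset.sum_Icc_succ_top (by omega), add_assoc]

theorem sum_antidiagonal_eq_sum_Icc {f : ℕ → ℕ → ℝ} (hf : ∀ j, f 0 j = 0) (n : ℕ) :
    ∑ p ∈ antidiagonal n, f p.1 p.2 = ∑ i ∈ Finset.Icc 1 n, f i (n - i) := by
  rw [Finset.Nat.sum_antidiagonal_eq_sum_range_succ f, Nat.succ_eq_add_one,
    sum_range_succ_eq_sum_Icc, hf, zero_add]

theorem sgn_pow_sub (z : ℤˣ) {n i : ℕ} (h : i ≤ n) : sgn z ^ (n - i) = sgn z ^ n * sgn z ^ i := by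
  obtain ⟨j, rfl⟩ := Nat.exists_eq_add_of_le h
  rw [Nat.add_sub_cancel_left, pow_add]
  linear_combination -sgn z ^ j * sgn_pow_mul_self z i

/-- Partial fractions 1/(ij) = (1/i + 1/j)/(i+j) with i+j = n+1; the reflection of i and j
identifies the two resulting sums. -/
theorem sgn_pow_div_mul_conv (p q : ℤˣ) (n : ℕ) :
    ∑ i ∈ Finset.Icc 1 n, sgn p ^ i / (i : ℝ) * (sgn q ^ (n + 1 - i) / ((n + 1 - i : ℕ) : ℝ)) =
      (sgn q ^ (n + 1) + sgn p ^ (n + 1)) / ((n : ℝ) + 1) * truncSum [(1, p * q)] n := by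
  have h1 : ∀ i ∈ Finset.Icc 1 n,
      sgn p ^ i / (i : ℝ) * (sgn q ^ (n + 1 - i) / ((n + 1 - i : ℕ) : ℝ)) =
      sgn q ^ (n + 1) / ((n : ℝ) + 1) * (sgn (p * q) ^ i / i) +
      sgn p ^ (n + 1) / ((n : ℝ) + 1) *
        (sgn (p * q) ^ (n + 1 - i) / ((n + 1 - i : ℕ) : ℝ)) := by
    intro i hi
    rw [Finset.mem_Icc] at hi
    obtain ⟨j, rfl⟩ := Nat.exists_eq_add_of_le hi.2
    have e : i + j + 1 - i = j + 1 := by omega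
    have hi0 : (i : ℝ) ≠ 0 := by
      have : i ≠ 0 := by omega
      exact_mod_cast this
    have hj0 : (j : ℝ) + 1 ≠ 0 := by positivity
    have hij : (i : ℝ) + j + 1 ≠ 0 := by positivity
    rw [e, sgn_mul, mul_pow, mul_pow]
    push_cast
    rw [show i + j + 1 = i + (j + 1) by ring, pow_add, pow_add]
    have hq := sgn_pow_mul_self q i
    have hp := sgn_pow_mul_self p (j + 1)
    field_simp
    linear_combination (-(j + 1) * sgn p ^ i * sgn q ^ (j + 1)) * hq -
      (i * sgn p ^ i * sgn q ^ (j + 1)) * hp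
  rw [Finset.sum_congr rfl h1, Finset.sum_add_distrib, ← Finset.mul_sum, ← Finset.mul_sum,
    truncSum_single]
  have h2 : ∑ i ∈ Finset.Icc 1 n, sgn (p * q) ^ (n + 1 - i) / ((n + 1 - i : ℕ) : ℝ) =
      ∑ i ∈ Finset.Icc 1 n, sgn (p * q) ^ i / (i : ℝ) := by
    refine Finset.sum_nbij' (fun i => n + 1 - i) (fun i => n + 1 - i) ?_ ?_ ?_ ?_ ?_
    · intro i hi; rw [Finset.mem_Icc] at hi ⊢; omega
    · intro i hi; rw [Finset.mem_Icc] at hi ⊢; omega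
    · intro i hi; rw [Finset.mem_Icc] at hi; omega
    · intro i hi; rw [Finset.mem_Icc] at hi; omega
    · intro i hi; rfl
  rw [h2]
  simp only [pow_one]
  ring

/-- Shuffle product of two truncated integrals of weight one. -/
theorem truncInt_mul_truncInt_one (p q : ℤˣ) {ε : ℝ} (h0 : 0 < ε) (h1 : ε ≤ 1) :
    truncInt [(1, p)] ε * truncInt [(1, q)] ε =
      truncInt [(1, q), (1, p * q)] ε + truncInt [(1, p), (1, p * q)] ε := by
  have hp : ∀ k : Index, (∀ a ∈ k, a.1 = 1) → IsPos k := fun k hk a ha => (hk a ha).ge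
  have h := hasSum_mul_truncInt (hp [(1, p)] (by simp)) (hp [(1, q)] (by simp)) h0 h1
  have h' := (hasSum_truncInt [(1, q), (1, p * q)] (hp _ (by simp)) h0 h1).add
    (hasSum_truncInt [(1, p), (1, p * q)] (hp _ (by simp)) h0 h1)
  refine h.unique ?_
  convert h' using 2 with n
  rw [← add_mul]
  congr 1
  rw [sum_antidiagonal_eq_sum_Icc (f := fun i j => incr [(1, p)] i * incr [(1, q)] j)
    (fun j => by simp [incr_cons])]
  cases n with
  | zero => simp [incr_cons]
  | succ n =>
    rw [Finset.sum_Icc_succ_top (by omega)]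
    have := sgn_pow_div_mul_conv p q n
    simp only [incr_cons, truncSum_nil, mul_one, pow_one, Nat.sub_self, Nat.add_sub_cancel]
    rw [this]
    push_cast
    ring

theorem truncInt_nil (ε : ℝ) : truncInt [] ε = 1 := rfl

theorem truncInt_one {ε : ℝ} (h0 : 0 < ε) (h1 : ε ≤ 1) : truncInt [pl 1] ε = -Real.log ε := by
  have h := hasSum_truncInt [pl 1] (by simp [IsPos, pl]) h0 h1
  have h2 := Real.hasSum_pow_div_log_of_abs_lt_one (x := 1 - ε)
    (by rw [abs_lt]; constructor <;> linarith)
  rw [sub_sub_cancel] at h2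
  rw [hasSum_succ_iff (g := fun n : ℕ => (1 - ε) ^ (n + 1) / ((n : ℝ) + 1))
    (by simp [incr_cons, pl]) (fun n => by simp [incr_cons, pl, truncSum_nil]; ring)] at h
  exact h.unique h2

theorem truncInt_one_one {ε : ℝ} (h0 : 0 < ε) (h1 : ε ≤ 1) :
    truncInt [pl 1, pl 1] ε = (-Real.log ε) ^ 2 / 2 := by
  have h := truncInt_mul_truncInt_one 1 1 h0 h1
  have h2 := truncInt_one h0 h1
  simp only [pl, mul_one] at *
  rw [h2] at h
  linarith

/-- The generating function of the increments of a sequence of size `O(n^{-1/2})`. -/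
theorem abs_le_of_hasSum {g δ : ℕ → ℝ} {C ε D : ℝ} (hC : ∀ n : ℕ, |g n| ≤ C / √((n : ℝ) + 1))
    (h0 : 0 < ε) (h1 : ε ≤ 1 / 2) (hδ0 : δ 0 = g 0) (hδ : ∀ n, g (n + 1) = g n + δ (n + 1))
    (hD : HasSum (fun n => δ n * (1 - ε) ^ n) D) :
    |D| ≤ C * (1 + -Real.log ε) * Real.exp (-(-Real.log ε) / 2) := by
  have hC0 : 0 ≤ C := by
    have := (abs_nonneg _).trans (hC 0)
    simpa using this
  set y := 1 - ε with hy
  have hy0 : 1 / 2 ≤ y := by linarith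
  have hy1 : y < 1 := by linarith
  have hsq : 0 < √ε := Real.sqrt_pos.mpr h0
  have hb : ∀ n, |g n| ≤ C * ((n : ℝ) + 1) := fun n => by
    refine (hC n).trans ((div_le_self hC0 ?_).trans ?_)
    · rw [Real.one_le_sqrt]
      linarith [n.cast_nonneg (α := ℝ)]
    · nlinarith [n.cast_nonneg (α := ℝ)]
  have hsum := summable_mul_pow_of_abs_le hb (by linarith : 0 ≤ y) hy1
  obtain ⟨G, hG⟩ := hsum.of_norm
  -- Abel summation: the series of increments is 1-y = ε times the series of the sequence.
  have hDG : D = ε * G := by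
    have h2 : HasSum (fun n => if n = 0 then 0 else g (n - 1) * y ^ n) (y * G) := by
      refine (hasSum_succ_iff (by simp) fun n => ?_).mpr (hG.mul_left y)
      simp only [Nat.add_sub_cancel, Nat.succ_ne_zero, if_false]
      ring
    have h3 := hG.sub h2
    have e : (fun n => g n * y ^ n - if n = 0 then 0 else g (n - 1) * y ^ n) =
        fun n => δ n * y ^ n := by
      funext n
      cases n with
      | zero => simp [hδ0]
      | succ n =>
        simp only [Nat.add_sub_cancel, Nat.succ_ne_zero, if_false, hδ n]
        ring
    rw [e] at h3
    rw [hD.unique h3, hy]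
    ring
  have hlog : HasSum (fun n : ℕ => y ^ n / ((n : ℝ) + 1)) (-Real.log ε / y) := by
    have h := (Real.hasSum_pow_div_log_of_abs_lt_one (x := y)
      (by rw [abs_lt]; constructor <;> linarith)).div_const y
    have e1 : 1 - y = ε := by rw [hy]; ring
    rw [e1] at h
    have e : (fun n : ℕ => y ^ (n + 1) / ((n : ℝ) + 1) / y) =
        fun n : ℕ => y ^ n / ((n : ℝ) + 1) := by
      funext n
      have : y ≠ 0 := by linarith
      rw [pow_succ, mul_div_right_comm, mul_div_cancel_right₀ _ this]
    rwa [e] at h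
  have hgeo := hasSum_geometric_of_lt_one (by linarith : 0 ≤ y) hy1
  have hbound := ((hgeo.mul_left (√ε / 2)).add (hlog.mul_left (1 / (2 * √ε)))).mul_left C
  have hGle : |G| ≤ C * (√ε / 2 * (1 - y)⁻¹ + 1 / (2 * √ε) * (-Real.log ε / y)) := by
    rw [← hG.tsum_eq, ← Real.norm_eq_abs]
    refine (norm_tsum_le_tsum_norm hsum).trans ?_
    rw [← hbound.tsum_eq]
    refine hsum.tsum_le_tsum (fun n => ?_) hbound.summable
    have hn : 0 < √((n : ℝ) + 1) := Real.sqrt_pos.mpr (by positivity)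
    have hn2 := Real.sq_sqrt (show (0 : ℝ) ≤ (n : ℝ) + 1 by positivity)
    rw [norm_mul, norm_pow, Real.norm_eq_abs, Real.norm_of_nonneg (by linarith : 0 ≤ y)]
    -- Weighted AM-GM. It replaces the series of n^(-1/2) y^n by the geometric and the logarithmic
    -- series; the weight √ε makes both contributions O(√ε (1 - log ε)) after multiplication by ε.
    have key : 1 / √((n : ℝ) + 1) ≤ √ε / 2 + 1 / (2 * √ε) * (1 / ((n : ℝ) + 1)) := by
      rw [← hn2, Real.sqrt_sq hn.le]
      have e : √ε / 2 + 1 / (2 * √ε) * (1 / √((n : ℝ) + 1) ^ 2) - 1 / √((n : ℝ) + 1) =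
          (√ε * √((n : ℝ) + 1) - 1) ^ 2 / (2 * √ε * √((n : ℝ) + 1) ^ 2) := by
        field_simp
        ring
      have : 0 ≤ (√ε * √((n : ℝ) + 1) - 1) ^ 2 / (2 * √ε * √((n : ℝ) + 1) ^ 2) := by positivity
      linarith
    calc |g n| * y ^ n ≤ C / √((n : ℝ) + 1) * y ^ n := by gcongr; exact hC n
      _ = C * (1 / √((n : ℝ) + 1)) * y ^ n := by ring
      _ ≤ C * (√ε / 2 + 1 / (2 * √ε) * (1 / ((n : ℝ) + 1))) * y ^ n := by gcongr
      _ = _ := by ring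
  have hl : 0 ≤ -Real.log ε := by
    have := Real.log_nonpos h0.le (by linarith)
    linarith
  have e1 : 1 - y = ε := by rw [hy]; ring
  rw [hDG, abs_mul, abs_of_pos h0, neg_neg, ← sqrt_eq_exp h0]
  rw [e1] at hGle
  have hly : -Real.log ε / y ≤ -Real.log ε * 2 := by
    rw [div_le_iff₀ (by linarith)]
    nlinarith
  calc ε * |G| ≤ ε * (C * (√ε / 2 * ε⁻¹ + 1 / (2 * √ε) * (-Real.log ε / y))) := by gcongr
    _ ≤ ε * (C * (√ε / 2 * ε⁻¹ + 1 / (2 * √ε) * (-Real.log ε * 2))) := by gcongr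
    _ = C * (√ε / 2 + √ε * -Real.log ε) := by
      have := Real.sq_sqrt h0.le
      field_simp
      rw [this]
      ring
    _ ≤ C * (1 + -Real.log ε) * √ε := by nlinarith [mul_nonneg hC0 hsq.le]

theorem isPos_ones : IsPos [pl 1] ∧ IsPos [pl 1, pl 1] := by simp [IsPos, pl]

/-- An Abelian theorem: the expansion of the sums transfers to the integrals, because the integrals
of the empty index, (1) and (1,1) are exactly 1, T and T²/2 at T = -log ε, while the remainder
contributes O(√ε (1 - log ε)). -/
theorem HasReg.hasPoly_truncInt {k : Index} (hk : IsPos k) {a b c : ℝ}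
    (h : HasReg (truncSum k) a b c) :
    HasPoly (𝓝[>] 0) (fun ε => -Real.log ε) (truncInt k) (C a + C b * X + C (c / 2) * X ^ 2) := by
  obtain ⟨K, hK⟩ := h
  refine negl_of_le tendsto_neg_log (K := K) ?_
  filter_upwards [Ioc_mem_nhdsGT (show (0 : ℝ) < 1 / 2 by norm_num)] with ε hε
  have h0 := hε.1
  have h1 : ε ≤ 1 := hε.2.trans (by norm_num)
  have hs := (hasSum_truncInt k hk h0 h1).sub
    ((((hasSum_truncInt [] (by simp [IsPos]) h0 h1).mul_left a).add
    ((hasSum_truncInt [pl 1] isPos_ones.1 h0 h1).mul_left b)).add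
    ((hasSum_truncInt [pl 1, pl 1] isPos_ones.2 h0 h1).mul_left c))
  rw [truncInt_nil, truncInt_one h0 h1, truncInt_one_one h0 h1] at hs
  have e : (fun n => incr k n * (1 - ε) ^ n - (a * (incr [] n * (1 - ε) ^ n) +
      b * (incr [pl 1] n * (1 - ε) ^ n) + c * (incr [pl 1, pl 1] n * (1 - ε) ^ n))) =
      fun n => (incr k n - (a * incr [] n + b * incr [pl 1] n + c * incr [pl 1, pl 1] n)) *
        (1 - ε) ^ n := by
    funext n
    ring
  rw [e] at hs
  have := abs_le_of_hasSum hK h0 hε.2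
    (δ := fun n => incr k n - (a * incr [] n + b * incr [pl 1] n + c * incr [pl 1, pl 1] n))
    (by simp only [truncSum_zero hk, ← truncSum_zero isPos_ones.1, ← truncSum_zero isPos_ones.2]
        simp [incr])
    (fun n => by
      simp only [truncSum_succ]
      simp [incr]
      ring) hs
  convert this using 2
  simp
  ring

/-! ### The two regularizations and their comparison -/

theorem harmonic_eq_truncSum (n : ℕ) : (harmonic n : ℝ) = truncSum [pl 1] n := by
  induction n with
  | zero => simp [pl]
  | succ n ih =>
    rw [harmonic_succ, pl, truncSum_cons_succ, ← pl, ← ih]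
    push_cast
    simp [truncSum_nil]

theorem hasPoly_harmonic : HasPoly atTop logScale (truncSum [pl 1]) X := by
  -- The summand γ covers n = 0, where `Real.log 0 = 0` makes the error γ. For n ≥ 1, γ lies between
  -- H_n - log(n+1) and H_n - log n, so the error is at most 1/n.
  refine Rate.negl ⟨2 + Real.eulerMascheroniConstant, fun n => ?_⟩
  have hγ : 0 < Real.eulerMascheroniConstant :=
    (by norm_num : (0 : ℝ) < 1 / 2).trans Real.one_half_lt_eulerMascheroniConstant
  simp only [eval_X, logScale]
  rw [← harmonic_eq_truncSum]
  cases n with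
  | zero => simp [abs_of_pos hγ]
  | succ n =>
    have h1 := Real.eulerMascheroniConstant_lt_eulerMascheroniSeq' (n + 1)
    have h2 := Real.eulerMascheroniSeq_lt_eulerMascheroniConstant (n + 1)
    rw [Real.eulerMascheroniSeq', if_neg (by omega)] at h1
    rw [Real.eulerMascheroniSeq] at h2
    have hn : (0 : ℝ) < ((n + 1 : ℕ) : ℝ) := by positivity
    have h3 : Real.log (((n + 1 : ℕ) : ℝ) + 1) ≤
        Real.log ((n + 1 : ℕ) : ℝ) + 1 / ((n + 1 : ℕ) : ℝ) := by
      have := Real.log_le_sub_one_of_pos (x := (((n + 1 : ℕ) : ℝ) + 1) / ((n + 1 : ℕ) : ℝ))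
        (by positivity)
      rw [Real.log_div (by positivity) hn.ne', add_div, div_self hn.ne'] at this
      linarith
    have h4 : 1 / ((n + 1 : ℕ) : ℝ) ≤ 2 / √(((n + 1 : ℕ) : ℝ) + 1) := by
      rw [div_le_div_iff₀ hn (Real.sqrt_pos.mpr (by positivity)), one_mul,
        Real.sqrt_le_left (by positivity)]
      push_cast
      nlinarith [n.cast_nonneg (α := ℝ)]
    rw [abs_of_nonneg (by linarith)]
    calc _ ≤ 1 / ((n + 1 : ℕ) : ℝ) := by linarith
      _ ≤ 2 / √(((n + 1 : ℕ) : ℝ) + 1) := h4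
      _ ≤ _ := by gcongr; linarith

theorem isPos_two : IsPos [pl 2] := by simp [IsPos, pl]

theorem admissible_two : Admissible [pl 2] := by simp [Admissible, pl]

/-- The stuffle square e₁² = 2 e₂ + (truncated ζ(2)). The term ζ(2) is what separates the stuffle
from the shuffle regularization. -/
theorem hasPoly_one_one : HasPoly atTop logScale (truncSum [pl 1, pl 1])
    (C (1 / 2) * (X ^ 2 - C (eulerZeta [pl 2]))) := by
  have h2 : HasPoly atTop logScale (truncSum [pl 2]) (C (eulerZeta [pl 2])) := by
    refine (Rate.negl (hasReg_eulerZeta isPos_two admissible_two)).congr fun n => ?_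
    simp
  rw [sq]
  refine (((hasPoly_harmonic.mul hasPoly_harmonic).sub h2).const_mul (1 / 2)).congr fun n => ?_
  have := truncSum_mul_single 1 1 1 1 n
  simp only [pl, mul_one] at *
  rw [this]
  ring

/-- The stuffle regularization of `a + b e₁ + c e₂`. -/
def stufflePoly (a b c : ℝ) : ℝ[X] :=
  C a + C b * X + C c * (C (1 / 2) * (X ^ 2 - C (eulerZeta [pl 2])))

/-- The shuffle regularization of `a + b e₁ + c e₂`. -/
def shufflePoly (a b c : ℝ) : ℝ[X] := C a + C b * X + C (c / 2) * X ^ 2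

theorem HasReg.hasPoly {f : ℕ → ℝ} {a b c : ℝ} (h : HasReg f a b c) :
    HasPoly atTop logScale f (stufflePoly a b c) := by
  have h1 : HasPoly atTop logScale
      (fun n => f n - (a + b * truncSum [pl 1] n + c * truncSum [pl 1, pl 1] n)) 0 :=
    (Rate.negl h).congr fun n => by simp
  have h2 := h1.add (((hasPoly_const a).add (hasPoly_harmonic.const_mul b)).add
    (hasPoly_one_one.const_mul c))
  rw [zero_add] at h2
  exact h2.congr fun n => by ring

theorem zetaStuffle_eq {k : Index} {P : ℝ[X]} (h : IsStuffleReg k P) : zetaStuffle k = P :=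
  IsStuffleReg.unique (Classical.epsilon_spec (p := IsStuffleReg k) ⟨P, h⟩) h

theorem zetaShuffle_eq {k : Index} {P : ℝ[X]} (h : IsShuffleReg k P) : zetaShuffle k = P :=
  IsShuffleReg.unique (Classical.epsilon_spec (p := IsShuffleReg k) ⟨P, h⟩) h

theorem HasReg.zetaStuffle_eq {k : Index} {a b c : ℝ} (h : HasReg (truncSum k) a b c) :
    zetaStuffle k = stufflePoly a b c := EulerSum.zetaStuffle_eq h.hasPoly.tendsto

theorem HasReg.zetaShuffle_eq {k : Index} (hk : IsPos k) {a b c : ℝ}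
    (h : HasReg (truncSum k) a b c) : zetaShuffle k = shufflePoly a b c :=
  EulerSum.zetaShuffle_eq (h.hasPoly_truncInt hk).tendsto

theorem hasPoly_zetaStuffle {k : Index} (hk : IsPos k) (hl : lead k ≤ 2) :
    HasPoly atTop logScale (truncSum k) (zetaStuffle k) := by
  obtain ⟨a, b, c, h, -⟩ := exists_hasReg k hk hl
  rw [h.zetaStuffle_eq]
  exact h.hasPoly

theorem hasPoly_zetaShuffle {k : Index} (hk : IsPos k) (hl : lead k ≤ 2) :
    HasPoly (𝓝[>] 0) (fun ε => -Real.log ε) (truncInt k) (zetaShuffle k) := by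
  obtain ⟨a, b, c, h, -⟩ := exists_hasReg k hk hl
  rw [h.zetaShuffle_eq hk]
  exact h.hasPoly_truncInt hk

/-- The two regularizations agree if there is at most one leading unbarred `1`. -/
theorem zetaShuffle_eq_zetaStuffle {k : Index} (hk : IsPos k) (hl : lead k ≤ 1) :
    zetaShuffle k = zetaStuffle k := by
  obtain ⟨a, b, c, h, hc, -⟩ := exists_hasReg k hk (by omega)
  rw [h.zetaShuffle_eq hk, h.zetaStuffle_eq, hc hl]
  simp [shufflePoly, stufflePoly]

theorem zetaShuffle_eq_C {k : Index} (hk : IsPos k) (ha : Admissible k) :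
    zetaShuffle k = C (eulerZeta k) := by
  rw [(hasReg_eulerZeta hk ha).zetaShuffle_eq hk]
  simp [shufflePoly]

/-- Comparison of the regularizations for two leading unbarred ones. -/
theorem zetaShuffle_one_one_cons {k : Index} (hk : IsPos k) (ha : Admissible k) :
    zetaShuffle (pl 1 :: pl 1 :: k) =
      zetaStuffle (pl 1 :: pl 1 :: k) + C (eulerZeta k * eulerZeta [pl 2] / 2) := by
  obtain ⟨b, h1⟩ := (hasReg_eulerZeta hk ha).cons_one
  obtain ⟨c, h2⟩ := h1.cons_one
  have hk' : IsPos (pl 1 :: pl 1 :: k) := by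
    intro p hp
    simp only [List.mem_cons] at hp
    rcases hp with rfl | rfl | hp
    exacts [le_rfl, le_rfl, hk p hp]
  rw [h2.zetaShuffle_eq hk', h2.zetaStuffle_eq, shufflePoly, stufflePoly]
  have e1 : (C (eulerZeta k / 2) : ℝ[X]) = C (eulerZeta k) * C (1 / 2) := by
    rw [← C_mul]; congr 1; ring
  have e2 : (C (eulerZeta k * eulerZeta [pl 2] / 2) : ℝ[X]) =
      C (eulerZeta k) * C (eulerZeta [pl 2]) * C (1 / 2) := by
    rw [← C_mul, ← C_mul]; congr 1; ring
  rw [e1, e2]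
  ring

theorem tendsto_truncInt {k : Index} (hk : IsPos k) (ha : Admissible k) :
    Tendsto (truncInt k) (𝓝[>] 0) (𝓝 (eulerZeta k)) := by
  have h := ((hasReg_eulerZeta hk ha).hasPoly_truncInt hk).tendsto.add_const (eulerZeta k)
  simpa using h

theorem tendsto_eulerZeta {k : Index} (hk : IsPos k) (ha : Admissible k) :
    Tendsto (truncSum k) atTop (𝓝 (eulerZeta k)) := (hasReg_eulerZeta hk ha).tendsto

/-! ### Two relations in weight two -/

/-- Odd terms cancel, even terms double, and 2/(2n)² = (1/2)/n². -/
theorem truncSum_two_mul (M : ℕ) :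
    truncSum [pl 2] (2 * M) + truncSum [bar 2] (2 * M) = truncSum [pl 2] M / 2 := by
  induction M with
  | zero => simp
  | succ M ih =>
    simp only [pl, bar] at ih ⊢
    rw [show 2 * (M + 1) = 2 * M + 1 + 1 by ring]
    simp only [truncSum_cons_succ, truncSum_nil, sgn_one, sgn_neg_one, one_pow]
    have h1 : (-1 : ℝ) ^ (2 * M + 1) = -1 := Odd.neg_one_pow ⟨M, rfl⟩
    have h2 : (-1 : ℝ) ^ (2 * M + 1 + 1) = 1 := by rw [pow_succ, h1]; norm_num
    rw [h1, h2]
    push_cast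
    have e : (2 : ℝ) * M + 1 + 1 = 2 * (M + 1) := by ring
    rw [e, mul_pow]
    have h3 : (M : ℝ) + 1 ≠ 0 := by positivity
    have h4 : (2 : ℝ) * M + 1 ≠ 0 := by positivity
    field_simp
    field_simp at ih
    linear_combination (2 * (2 * M + 1 : ℝ) ^ 2 * (M + 1 : ℝ) ^ 2) * ih

theorem isPos_bar_two : IsPos [bar 2] := by simp [IsPos, bar]

theorem admissible_bar_two : Admissible [bar 2] := by simp [Admissible, pl, bar]

theorem eulerZeta_bar_two : eulerZeta [bar 2] = -eulerZeta [pl 2] / 2 := by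
  have h2 : Tendsto (fun M : ℕ => 2 * M) atTop atTop :=
    tendsto_id.const_mul_atTop' (by norm_num)
  have h := ((tendsto_eulerZeta isPos_two admissible_two).comp h2).add
    ((tendsto_eulerZeta isPos_bar_two admissible_bar_two).comp h2)
  have h' := (tendsto_eulerZeta isPos_two admissible_two).div_const 2
  have := tendsto_nhds_unique (h.congr fun M => truncSum_two_mul M) h'
  linarith

theorem tendsto_bar_two : Tendsto (fun M => truncSum [bar 2] M + truncSum [pl 2] M / 2) atTop
    (𝓝 0) := by
  have := (tendsto_eulerZeta isPos_bar_two admissible_bar_two).add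
    ((tendsto_eulerZeta isPos_two admissible_two).div_const 2)
  rw [eulerZeta_bar_two] at this
  convert this using 2
  ring

/-- Double shuffle: the square of barred ζ(1) is 2ζ(1,1) with the first entry barred by shuffle, and
2ζ(1,1) with both entries barred plus ζ(2) by stuffle. Comparing, and writing -ζ(2)/2 as barred
ζ(2), gives the relation. -/
theorem tendsto_bar_one_bar_one : Tendsto (fun M => truncSum [bar 1, bar 1] M
    - truncSum [bar 1, pl 1] M - truncSum [bar 2] M) atTop (𝓝 0) := by
  have p1 : IsPos [bar 1] := by simp [IsPos, bar]
  have a1 : Admissible [bar 1] := by simp [Admissible, pl, bar]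
  have p2 : IsPos [bar 1, pl 1] := by simp [IsPos, bar, pl]
  have a2 : Admissible [bar 1, pl 1] := by simp [Admissible, pl, bar]
  have h1 := ((tendsto_truncInt p1 a1).mul (tendsto_truncInt p1 a1)).sub
    ((tendsto_truncInt p2 a2).const_mul 2)
  have h2 := tendsto_nhds_unique_of_eventuallyEq h1 (tendsto_const_nhds (x := (0 : ℝ))) (by
    filter_upwards [Ioc_mem_nhdsGT zero_lt_one] with ε hε
    have := truncInt_mul_truncInt_one (-1) (-1) hε.1 hε.2
    simp only [mul_neg, mul_one, neg_neg] at this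
    simp only [bar, pl, this]
    ring)
  have s1 := tendsto_eulerZeta p1 a1
  have s2 := tendsto_eulerZeta p2 a2
  have h3 := ((((s1.mul s1).sub (s2.const_mul 2)).div_const 2).sub tendsto_bar_two)
  rw [h2] at h3
  simp only [zero_div, sub_zero] at h3
  refine h3.congr fun M => ?_
  have := truncSum_mul_single 1 1 (-1) (-1) M
  simp only [mul_neg, mul_one, neg_neg] at this
  simp only [bar, pl] at *
  linear_combination this / 2

/-! ### Partial fraction identities -/

/-- The sum of all `X ^ b * Y ^ c` with `b, c ≥ 1` and `b + c = r + 2`. -/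
def bisum (r : ℕ) (X Y : ℝ) : ℝ := ∑ P ∈ antidiagonal r, X ^ (P.1 + 1) * Y ^ (P.2 + 1)

theorem bisum_succ (r : ℕ) (X Y : ℝ) :
    bisum (r + 1) X Y = X * Y ^ (r + 2) + X * bisum r X Y := by
  rw [bisum, Finset.Nat.sum_antidiagonal_succ, bisum, Finset.mul_sum]
  simp only [zero_add, pow_one]
  congr 1
  refine Finset.sum_congr rfl fun P _ => ?_
  ring

theorem bisum_succ' (r : ℕ) (X Y : ℝ) :
    bisum (r + 1) X Y = X ^ (r + 2) * Y + Y * bisum r X Y := by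
  rw [bisum, Finset.Nat.sum_antidiagonal_succ', bisum, Finset.mul_sum]
  simp only [zero_add, pow_one]
  congr 1
  refine Finset.sum_congr rfl fun P _ => ?_
  ring

theorem bisum_zero (X Y : ℝ) : bisum 0 X Y = X * Y := by simp [bisum]

theorem bisum_self (r : ℕ) (X : ℝ) : bisum r X X = (r + 1) * X ^ (r + 2) := by
  induction r with
  | zero => rw [bisum_zero]; simp; ring
  | succ r ih => rw [bisum_succ, ih]; push_cast; ring

/-- A finite geometric sum. On the stuffle side it separates the powers of m and n and leaves only
the coupling 1/(m-n). -/
theorem sub_mul_bisum (r : ℕ) {m n : ℝ} (hm : m ≠ 0) (hn : n ≠ 0) :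
    (m - n) * bisum r (1 / m) (1 / n) = (1 / n) ^ (r + 1) - (1 / m) ^ (r + 1) := by
  have e1 : m * (1 / m) = 1 := by field_simp
  have e2 : n * (1 / n) = 1 := by field_simp
  cases r with
  | zero =>
    rw [bisum_zero, zero_add, pow_one, pow_one]
    linear_combination (1 / n) * e1 - (1 / m) * e2
  | succ r =>
    rw [sub_mul]
    nth_rewrite 1 [bisum_succ]
    rw [bisum_succ']
    linear_combination ((1 / n) ^ (r + 2) + bisum r (1 / m) (1 / n)) * e1 -
      ((1 / m) ^ (r + 2) + bisum r (1 / m) (1 / n)) * e2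

/-- This is the source of the weights 2^(b-1). Write B_r for the right side, X = 1/m, Y = 1/n. Then
m B_(r+1) = B_r + Y^(r+2) and n B_(r+1) = B_r + X^(r+2), so (m+n) B_(r+1) = 2 B_r + X^(r+2) +
Y^(r+2); iterating doubles the factor each time. -/
theorem sum_two_pow_eq_bisum (r : ℕ) {m n : ℝ} (hm : m ≠ 0) (hn : n ≠ 0) (hmn : m + n ≠ 0) :
    ∑ Q ∈ antidiagonal r, 2 ^ Q.1 * (1 / (m + n)) ^ (Q.1 + 1) *
      ((1 / m) ^ (Q.2 + 1) + (1 / n) ^ (Q.2 + 1)) = bisum r (1 / m) (1 / n) := by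
  have e1 : m * (1 / m) = 1 := by field_simp
  have e2 : n * (1 / n) = 1 := by field_simp
  have e3 : (m + n) * (1 / (m + n)) = 1 := by field_simp
  induction r with
  | zero =>
    rw [bisum_zero]
    simp only [Finset.Nat.antidiagonal_zero, Finset.sum_singleton, zero_add, pow_zero, pow_one, one_mul]
    field_simp
    ring
  | succ r ih =>
    rw [Finset.Nat.sum_antidiagonal_succ]
    have h : ∑ Q ∈ antidiagonal r, 2 ^ (Q.1 + 1) * (1 / (m + n)) ^ (Q.1 + 1 + 1) *
        ((1 / m) ^ (Q.2 + 1) + (1 / n) ^ (Q.2 + 1)) =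
        2 * (1 / (m + n)) * bisum r (1 / m) (1 / n) := by
      rw [← ih, Finset.mul_sum]
      refine Finset.sum_congr rfl fun P _ => ?_
      ring
    rw [h]
    have h1 := bisum_succ r (1 / m) (1 / n)
    have h2 := bisum_succ' r (1 / m) (1 / n)
    simp only [pow_zero, zero_add, pow_one, one_mul]
    linear_combination bisum (r + 1) (1 / m) (1 / n) * e3 - (1 / (m + n)) * m * h1 -
      (1 / (m + n)) * n * h2 -
      (1 / (m + n)) * ((1 / n) ^ (r + 2) + bisum r (1 / m) (1 / n)) * e1 -
      (1 / (m + n)) * ((1 / m) ^ (r + 2) + bisum r (1 / m) (1 / n)) * e2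

/-- Carries out the sum over the first exponent a, with L the outermost summation index: again a
geometric sum, now in 1/L against 1/m. -/
theorem sub_mul_sum_bisum (r : ℕ) {L m : ℝ} (hL : L ≠ 0) (hm : m ≠ 0) (Y : ℝ) :
    (L - m) * ∑ P ∈ antidiagonal r, (1 / L) ^ (P.1 + 1) * bisum P.2 (1 / m) Y =
      bisum r (1 / m) Y - bisum r (1 / L) Y := by
  have e1 : m * (1 / m) = 1 := by field_simp
  have e2 : L * (1 / L) = 1 := by field_simp
  induction r with
  | zero =>
    simp only [Finset.Nat.antidiagonal_zero, Finset.sum_singleton, zero_add, pow_one, bisum_zero]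
    linear_combination (1 / m) * Y * e2 - (1 / L) * Y * e1
  | succ r ih =>
    rw [Finset.Nat.sum_antidiagonal_succ]
    have h : ∑ P ∈ antidiagonal r, (1 / L) ^ (P.1 + 1 + 1) * bisum P.2 (1 / m) Y =
        (1 / L) * ∑ P ∈ antidiagonal r, (1 / L) ^ (P.1 + 1) * bisum P.2 (1 / m) Y := by
      rw [Finset.mul_sum]
      refine Finset.sum_congr rfl fun P _ => ?_
      ring
    rw [h]
    have h1 := bisum_succ r (1 / m) Y
    have h2 := bisum_succ r (1 / L) Y
    simp only [zero_add, pow_one]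
    linear_combination (1 / L) * ih + bisum (r + 1) (1 / m) Y * e2 - (1 / L) * m * h1
      - (1 / L) * (Y ^ (r + 2) + bisum r (1 / m) Y) * e1 + h2

/-! ### The weighted shuffle formula, coefficient by coefficient -/

theorem sum_triples (r : ℕ) {M : Type*} [AddCommMonoid M] (f : ℕ × ℕ × ℕ → M) :
    ∑ t ∈ triples (r + 3), f t =
      ∑ P ∈ antidiagonal r, ∑ Q ∈ antidiagonal P.2, f (P.1 + 1, Q.1 + 1, Q.2 + 1) := by
  rw [Finset.sum_sigma']
  refine Finset.sum_nbij' (fun t => ⟨(t.1 - 1, t.2.1 + t.2.2 - 2), (t.2.1 - 1, t.2.2 - 1)⟩)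
    (fun P => (P.1.1 + 1, P.2.1 + 1, P.2.2 + 1)) ?_ ?_ ?_ ?_ ?_
  · rintro ⟨a, b, c⟩ h
    simp only [triples, Finset.mem_filter, Finset.mem_product, Finset.mem_Icc] at h
    simp only [Finset.mem_sigma, Finset.HasAntidiagonal.mem_antidiagonal]
    omega
  · rintro ⟨⟨a, b⟩, c, d⟩ h
    simp only [Finset.mem_sigma, Finset.HasAntidiagonal.mem_antidiagonal] at h
    simp only [triples, Finset.mem_filter, Finset.mem_product, Finset.mem_Icc]
    omega
  · rintro ⟨a, b, c⟩ h
    simp only [triples, Finset.mem_filter, Finset.mem_product, Finset.mem_Icc] at h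
    simp only [Prod.mk.injEq]
    omega
  · rintro ⟨⟨a, b⟩, c, d⟩ h
    simp only [Finset.mem_sigma, Finset.HasAntidiagonal.mem_antidiagonal] at h
    obtain ⟨h1, rfl⟩ := h
    simp
    omega
  · rintro ⟨a, b, c⟩ h
    simp only [triples, Finset.mem_filter, Finset.mem_product, Finset.mem_Icc] at h
    congr 1
    simp only [Prod.mk.injEq]
    omega

theorem sum_Icc_pair_eq (K : ℕ) (g : ℕ → ℕ → ℝ) :
    ∑ k ∈ Finset.Icc 1 K, ∑ n ∈ Finset.Icc 1 (k - 1), g k n =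
      ∑ m ∈ Finset.Icc 1 K, ∑ n ∈ Finset.Icc 1 (K - m), g (m + n) n := by
  rw [Finset.sum_sigma', Finset.sum_sigma']
  refine Finset.sum_nbij' (fun x => ⟨x.1 - x.2, x.2⟩) (fun x => ⟨x.1 + x.2, x.2⟩) ?_ ?_ ?_ ?_ ?_
  · rintro ⟨a, b⟩ h
    simp only [Finset.mem_sigma, Finset.mem_Icc] at h ⊢
    omega
  · rintro ⟨a, b⟩ h
    simp only [Finset.mem_sigma, Finset.mem_Icc] at h ⊢
    omega
  · rintro ⟨a, b⟩ h
    simp only [Finset.mem_sigma, Finset.mem_Icc] at h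
    simp
    omega
  · rintro ⟨a, b⟩ h
    simp
  · rintro ⟨a, b⟩ h
    simp only [Finset.mem_sigma, Finset.mem_Icc] at h
    simp only
    congr 1
    omega

theorem sum_Icc_pair_swap (K : ℕ) (g : ℕ → ℕ → ℝ) :
    ∑ m ∈ Finset.Icc 1 K, ∑ n ∈ Finset.Icc 1 (K - m), g m n =
      ∑ m ∈ Finset.Icc 1 K, ∑ n ∈ Finset.Icc 1 (K - m), g n m := by
  refine Finset.sum_comm' fun a b => ?_
  simp only [Finset.mem_Icc]
  omega

theorem sum_Icc_reflect (K : ℕ) (g : ℕ → ℝ) :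
    ∑ k ∈ Finset.Icc 1 K, g k = ∑ k ∈ Finset.Icc 1 K, g (K + 1 - k) := by
  refine Finset.sum_nbij' (fun i => K + 1 - i) (fun i => K + 1 - i) ?_ ?_ ?_ ?_ ?_
  · intro i hi; rw [Finset.mem_Icc] at hi ⊢; omega
  · intro i hi; rw [Finset.mem_Icc] at hi ⊢; omega
  · intro i hi; rw [Finset.mem_Icc] at hi; omega
  · intro i hi; rw [Finset.mem_Icc] at hi; omega
  · intro i hi
    rw [Finset.mem_Icc] at hi
    congr 1
    omega

theorem incr_three (a b c : ℕ) (x y z : ℤˣ) (K : ℕ) :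
    incr [(a, x), (b, y), (c, z)] (K + 1) =
      sgn x ^ (K + 1) * (1 / ((K : ℝ) + 1)) ^ a * ∑ k ∈ Finset.Icc 1 K,
        ∑ n ∈ Finset.Icc 1 (k - 1),
          sgn y ^ k * (1 / (k : ℝ)) ^ b * (sgn z ^ n * (1 / (n : ℝ)) ^ c) := by
  rw [incr_cons, truncSum_cons]
  simp only [truncSum_single, Finset.mul_sum, Nat.add_sub_cancel]
  push_cast
  simp only [div_eq_mul_inv, one_mul, inv_pow]

/-- Both sides of the weighted shuffle formula, as a double sum. -/
theorem sum_incr_three_left (r K : ℕ) (s p q : ℤˣ) :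
    ∑ t ∈ triples (r + 3), 2 ^ (t.2.1 - 1) *
      (incr [(t.1, s), (t.2.1, p), (t.2.2, p * q)] (K + 1)
        + incr [(t.1, s), (t.2.1, q), (t.2.2, p * q)] (K + 1)) =
    ∑ m ∈ Finset.Icc 1 K, ∑ n ∈ Finset.Icc 1 (K - m),
      sgn s ^ (K + 1) * (sgn p ^ m * sgn q ^ n) *
        ((bisum r (1 / (m : ℝ)) (1 / (n : ℝ)) - bisum r (1 / ((K : ℝ) + 1)) (1 / (n : ℝ))) /
          ((K : ℝ) + 1 - m)) := by
  rw [sum_triples]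
  have h1 : ∀ a b c : ℕ, 2 ^ (b + 1 - 1) *
      (incr [(a + 1, s), (b + 1, p), (c + 1, p * q)] (K + 1)
        + incr [(a + 1, s), (b + 1, q), (c + 1, p * q)] (K + 1)) =
      ∑ m ∈ Finset.Icc 1 K, ∑ n ∈ Finset.Icc 1 (K - m),
        sgn s ^ (K + 1) * (sgn p ^ m * sgn q ^ n) * ((1 / ((K : ℝ) + 1)) ^ (a + 1) *
          (2 ^ b * (1 / ((m : ℝ) + n)) ^ (b + 1) *
            ((1 / (m : ℝ)) ^ (c + 1) + (1 / (n : ℝ)) ^ (c + 1)))) := by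
    intro a b c
    rw [incr_three, incr_three, sum_Icc_pair_eq, sum_Icc_pair_eq]
    -- With m the difference of the two inner indices, the first term has sign p^(m+n) (pq)^n = p^m
    -- q^n. Exchanging m and n gives the second term the same sign, so the two combine into m^(-c-1)
    -- + n^(-c-1).
    rw [sum_Icc_pair_swap K (fun m n => sgn q ^ (m + n) * (1 / ((m + n : ℕ) : ℝ)) ^ (b + 1) *
      (sgn (p * q) ^ n * (1 / (n : ℝ)) ^ (c + 1)))]
    rw [← mul_add, ← Finset.sum_add_distrib, Finset.mul_sum, Finset.mul_sum]
    refine Finset.sum_congr rfl fun m _ => ?_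
    rw [← Finset.sum_add_distrib, Finset.mul_sum, Finset.mul_sum]
    refine Finset.sum_congr rfl fun n _ => ?_
    have e1 := sgn_pow_mul_self p n
    have e2 := sgn_pow_mul_self q m
    rw [Nat.add_sub_cancel, sgn_mul, mul_pow, mul_pow, pow_add (sgn p), pow_add (sgn q)]
    push_cast
    rw [add_comm (n : ℝ) m]
    linear_combination
      (2 ^ b * sgn s ^ (K + 1) * (1 / ((K : ℝ) + 1)) ^ (a + 1) * (1 / ((m : ℝ) + n)) ^ (b + 1) *
        sgn p ^ m * sgn q ^ n) * ((1 / (n : ℝ)) ^ (c + 1) * e1 + (1 / (m : ℝ)) ^ (c + 1) * e2)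
  simp only [h1]
  have h2 : ∀ P ∈ antidiagonal r, ∑ Q ∈ antidiagonal P.2, ∑ m ∈ Finset.Icc 1 K,
      ∑ n ∈ Finset.Icc 1 (K - m),
        sgn s ^ (K + 1) * (sgn p ^ m * sgn q ^ n) * ((1 / ((K : ℝ) + 1)) ^ (P.1 + 1) *
          (2 ^ Q.1 * (1 / ((m : ℝ) + n)) ^ (Q.1 + 1) *
            ((1 / (m : ℝ)) ^ (Q.2 + 1) + (1 / (n : ℝ)) ^ (Q.2 + 1)))) =
      ∑ m ∈ Finset.Icc 1 K, ∑ n ∈ Finset.Icc 1 (K - m),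
        sgn s ^ (K + 1) * (sgn p ^ m * sgn q ^ n) * ((1 / ((K : ℝ) + 1)) ^ (P.1 + 1) *
          bisum P.2 (1 / (m : ℝ)) (1 / (n : ℝ))) := by
    intro P _
    rw [Finset.sum_comm]
    refine Finset.sum_congr rfl fun m hm => ?_
    rw [Finset.sum_comm]
    refine Finset.sum_congr rfl fun n hn => ?_
    rw [Finset.mem_Icc] at hm hn
    have hm0 : (0 : ℝ) < m := by exact_mod_cast hm.1
    have hn0 : (0 : ℝ) < n := by exact_mod_cast hn.1
    rw [← Finset.mul_sum, ← Finset.mul_sum, sum_two_pow_eq_bisum P.2 hm0.ne' hn0.ne'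
      (by positivity)]
  rw [Finset.sum_congr rfl h2, Finset.sum_comm]
  refine Finset.sum_congr rfl fun m hm => ?_
  rw [Finset.sum_comm]
  refine Finset.sum_congr rfl fun n hn => ?_
  rw [Finset.mem_Icc] at hm
  have hm0 : (0 : ℝ) < m := by exact_mod_cast hm.1
  have hK : (m : ℝ) ≤ K := by exact_mod_cast hm.2
  rw [← Finset.mul_sum, ← sub_mul_sum_bisum r (by positivity) hm0.ne',
    mul_div_cancel_left₀ _ (by linarith)]

/-- In the Cauchy product m is the index of the depth-one factor and K+1-m the outer index of the
other, whence the denominator K+1-m and the sign s^(K+1) p^m q^n. Reflecting the middle index k to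
K+1-m gives the subtracted sum the same denominator and sign. The term m = K+1 drops out, as
increments vanish at 0. -/
theorem sum_incr_three_right (r K : ℕ) (s p q : ℤˣ) :
    ∑ P ∈ antidiagonal r,
      ((∑ A ∈ antidiagonal (K + 1),
        incr [(P.1 + 1, p * s)] A.1 * incr [(1, s), (P.2 + 1, q)] A.2)
        - incr [(P.1 + 1, s * p), (1, p), (P.2 + 1, q)] (K + 1)) =
    ∑ m ∈ Finset.Icc 1 K, ∑ n ∈ Finset.Icc 1 (K - m),
      sgn s ^ (K + 1) * (sgn p ^ m * sgn q ^ n) *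
        ((bisum r (1 / (m : ℝ)) (1 / (n : ℝ)) - bisum r (1 / ((K : ℝ) + 1)) (1 / (n : ℝ))) /
          ((K : ℝ) + 1 - m)) := by
  have h1 : ∀ b c : ℕ, (∑ A ∈ antidiagonal (K + 1),
        incr [(b + 1, p * s)] A.1 * incr [(1, s), (c + 1, q)] A.2)
        - incr [(b + 1, s * p), (1, p), (c + 1, q)] (K + 1) =
      ∑ m ∈ Finset.Icc 1 K, ∑ n ∈ Finset.Icc 1 (K - m),
        sgn s ^ (K + 1) * (sgn p ^ m * sgn q ^ n) *
          (((1 / (m : ℝ)) ^ (b + 1) * (1 / (n : ℝ)) ^ (c + 1) -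
            (1 / ((K : ℝ) + 1)) ^ (b + 1) * (1 / (n : ℝ)) ^ (c + 1)) / ((K : ℝ) + 1 - m)) := by
    intro b c
    rw [sum_antidiagonal_eq_sum_Icc
      (f := fun i j => incr [(b + 1, p * s)] i * incr [(1, s), (c + 1, q)] j)
      (fun j => by simp [incr_cons]), Finset.sum_Icc_succ_top (by omega), Nat.sub_self,
      incr_cons_zero le_rfl, mul_zero, add_zero, incr_three,
      sum_Icc_reflect K (fun k => ∑ n ∈ Finset.Icc 1 (k - 1),
        sgn p ^ k * (1 / (k : ℝ)) ^ 1 * (sgn q ^ n * (1 / (n : ℝ)) ^ (c + 1))),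
      Finset.mul_sum, ← Finset.sum_sub_distrib]
    refine Finset.sum_congr rfl fun m hm => ?_
    rw [Finset.mem_Icc] at hm
    obtain ⟨j, rfl⟩ := Nat.exists_eq_add_of_le hm.2
    have ej : m + j + 1 - m = j + 1 := by omega
    rw [ej, incr_cons, incr_cons, truncSum_nil, truncSum_single, Nat.add_sub_cancel,
      Nat.add_sub_cancel_left, Finset.mul_sum, Finset.mul_sum, Finset.mul_sum,
      ← Finset.sum_sub_distrib]
    refine Finset.sum_congr rfl fun n _ => ?_
    have hm0 : (m : ℝ) ≠ 0 := by
      have : m ≠ 0 := by omega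
      exact_mod_cast this
    have e0 : ((m + j : ℕ) : ℝ) + 1 - m = j + 1 := by push_cast; ring
    rw [e0, show m + j + 1 = m + (j + 1) by ring, sgn_mul, sgn_mul, mul_pow, mul_pow,
      pow_add (sgn s), pow_add (sgn p)]
    have e1 := sgn_pow_mul_self s m
    have e2 := sgn_pow_mul_self p (j + 1)
    push_cast
    simp only [div_eq_mul_inv, one_mul, mul_one, pow_one, inv_pow]
    have hj : ((j : ℝ) + 1) ≠ 0 := by positivity
    linear_combination (-(sgn s ^ m * sgn s ^ (j + 1) * sgn p ^ m * sgn q ^ n *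
      (((m : ℝ) + j + 1) ^ (b + 1))⁻¹ * ((n : ℝ) ^ (c + 1))⁻¹ * ((j : ℝ) + 1)⁻¹)) * e2
  simp only [h1]
  rw [Finset.sum_comm]
  refine Finset.sum_congr rfl fun m _ => ?_
  rw [Finset.sum_comm]
  refine Finset.sum_congr rfl fun n _ => ?_
  rw [← Finset.mul_sum, ← Finset.sum_div, Finset.sum_sub_distrib]
  rfl

theorem hasSum_of_eq {f g : ℕ → ℝ} {S : ℝ} (h : HasSum g S) (e : ∀ n, f n = g n) :
    HasSum f S := by
  rwa [funext e]

/-- The weighted shuffle formula for truncated integrals. -/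
theorem sum_truncInt_three (r : ℕ) (s p q : ℤˣ) {ε : ℝ} (h0 : 0 < ε) (h1 : ε ≤ 1) :
    ∑ t ∈ triples (r + 3), 2 ^ (t.2.1 - 1) *
      (truncInt [(t.1, s), (t.2.1, p), (t.2.2, p * q)] ε
        + truncInt [(t.1, s), (t.2.1, q), (t.2.2, p * q)] ε) =
    ∑ P ∈ antidiagonal r,
      (truncInt [(P.1 + 1, p * s)] ε * truncInt [(1, s), (P.2 + 1, q)] ε
        - truncInt [(P.1 + 1, s * p), (1, p), (P.2 + 1, q)] ε) := by
  have hpos : ∀ t ∈ triples (r + 3), ∀ x y z : ℤˣ, IsPos [(t.1, x), (t.2.1, y), (t.2.2, z)] := by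
    intro t ht x y z
    simp only [triples, Finset.mem_filter, Finset.mem_product, Finset.mem_Icc] at ht
    simp only [IsPos, List.mem_cons, List.not_mem_nil, or_false]
    rintro a (rfl | rfl | rfl) <;> simp only <;> omega
  have hL := hasSum_sum fun t ht =>
    (((hasSum_truncInt _ (hpos t ht s p (p * q)) h0 h1).add
      (hasSum_truncInt _ (hpos t ht s q (p * q)) h0 h1)).mul_left ((2 : ℝ) ^ (t.2.1 - 1)))
  have hR := hasSum_sum (s := antidiagonal r) fun P _ =>
    ((hasSum_mul_truncInt (k := [(P.1 + 1, p * s)]) (m := [(1, s), (P.2 + 1, q)])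
      (by simp [IsPos]) (by simp [IsPos]) h0 h1).sub
      (hasSum_truncInt [(P.1 + 1, s * p), (1, p), (P.2 + 1, q)] (by simp [IsPos]) h0 h1))
  have key : ∀ n, ∑ t ∈ triples (r + 3), (2 : ℝ) ^ (t.2.1 - 1) *
      (incr [(t.1, s), (t.2.1, p), (t.2.2, p * q)] n
        + incr [(t.1, s), (t.2.1, q), (t.2.2, p * q)] n) =
      ∑ P ∈ antidiagonal r,
        ((∑ A ∈ antidiagonal n, incr [(P.1 + 1, p * s)] A.1 * incr [(1, s), (P.2 + 1, q)] A.2)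
          - incr [(P.1 + 1, s * p), (1, p), (P.2 + 1, q)] n) := by
    intro n
    cases n with
    | zero =>
      rw [Finset.sum_eq_zero, Finset.sum_eq_zero]
      · intro P _
        simp [incr_cons]
      · intro t ht
        have := hpos t ht 1 1 1
        rw [incr_cons_zero this.head, incr_cons_zero this.head]
        simp
    | succ K => rw [sum_incr_three_left, sum_incr_three_right]
  refine hL.unique (hasSum_of_eq hR fun n => ?_)
  have h := congrArg (fun x => x * (1 - ε) ^ n) (key n)
  simp only [Finset.sum_mul _ _ ((1 - ε) ^ n)] at h
  refine Eq.trans (Finset.sum_congr rfl fun t _ => ?_) (h.trans (Finset.sum_congr rfl fun P _ => ?_))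
  · ring
  · rw [sub_mul, Finset.sum_mul]

/-! ### Alternating harmonic sums and outer sums -/

/-- The truncated sums of `z ^ n / n`. -/
abbrev harm (z : ℤˣ) (M : ℕ) : ℝ := truncSum [(1, z)] M

theorem harm_zero (z : ℤˣ) : harm z 0 = 0 := truncSum_cons_zero _ _

theorem harm_succ (z : ℤˣ) (M : ℕ) :
    harm z (M + 1) = harm z M + sgn z ^ (M + 1) / ((M : ℝ) + 1) := by
  rw [harm, truncSum_cons_succ, truncSum_nil, pow_one, mul_one]

theorem harm_one_nonneg (M : ℕ) : 0 ≤ harm 1 M := by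
  rw [harm, truncSum_single]
  refine Finset.sum_nonneg fun n _ => ?_
  simp

theorem abs_sum_div_sub_le {f : ℕ → ℝ} {B : ℝ} (a n : ℕ)
    (hf : ∀ i, 1 ≤ i → i ≤ a + n → |f i| ≤ B) :
    |∑ i ∈ Finset.Icc 1 (a + n), f i / (i : ℝ) - ∑ i ∈ Finset.Icc 1 a, f i / (i : ℝ)| ≤
      B * (n / ((a : ℝ) + 1)) := by
  induction n with
  | zero => simp
  | succ n ih =>
    have h1 := ih fun i h h' => hf i h (by omega)
    have h2 := hf (a + (n + 1)) (by omega) le_rfl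
    rw [← add_assoc, Finset.sum_Icc_succ_top (by omega), add_sub_right_comm]
    refine (abs_add_le _ _).trans ?_
    have h3 : |f (a + n + 1) / ((a + n + 1 : ℕ) : ℝ)| ≤ B / ((a : ℝ) + 1) := by
      rw [abs_div, Nat.abs_cast]
      refine div_le_div₀ ((abs_nonneg _).trans h2) h2 (by positivity) ?_
      push_cast
      linarith [n.cast_nonneg (α := ℝ)]
    push_cast at h3 ⊢
    have e : B * (((n : ℝ) + 1) / ((a : ℝ) + 1)) =
      B * (n / ((a : ℝ) + 1)) + B / ((a : ℝ) + 1) := by ring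
    rw [e]
    exact add_le_add h1 h3

theorem harm_eq_sum (z : ℤˣ) (M : ℕ) :
    harm z M = ∑ n ∈ Finset.Icc 1 M, sgn z ^ n / (n : ℝ) := by
  rw [harm, truncSum_single]
  simp only [pow_one]

theorem abs_harm_sub_le (z : ℤˣ) (a n : ℕ) :
    |harm z (a + n) - harm z a| ≤ n / ((a : ℝ) + 1) := by
  rw [harm_eq_sum, harm_eq_sum, ← one_mul ((n : ℝ) / _)]
  exact abs_sum_div_sub_le a n fun i _ _ => by simp

theorem abs_harm_le (z : ℤˣ) (M : ℕ) : |harm z M| ≤ harm 1 M := by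
  rw [harm_eq_sum, harm_eq_sum]
  refine (Finset.abs_sum_le_sum_abs _ _).trans (Finset.sum_le_sum fun n _ => ?_)
  rw [abs_div, abs_sgn_pow, sgn_one, one_pow, Nat.abs_cast]

theorem harm_one_mono : Monotone (harm 1) := by
  refine monotone_nat_of_le_succ fun n => ?_
  rw [harm_succ, sgn_one, one_pow]
  have : 0 ≤ 1 / ((n : ℝ) + 1) := by positivity
  linarith

theorem abs_harm_sub_le_harm_one (z : ℤˣ) {n M : ℕ} (h : n ≤ M) :
    |harm z M - harm z n| ≤ harm 1 M := by
  obtain ⟨j, rfl⟩ := Nat.exists_eq_add_of_le h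
  clear h
  have : |harm z (n + j) - harm z n| ≤ harm 1 (n + j) - harm 1 n := by
    induction j with
    | zero => simp
    | succ j ih =>
      rw [← add_assoc, harm_succ, harm_succ, sgn_one, one_pow, add_sub_right_comm]
      refine (abs_add_le _ _).trans ?_
      rw [abs_div, abs_sgn_pow, abs_of_pos (by positivity : (0 : ℝ) < ((n + j : ℕ) : ℝ) + 1)]
      linarith
  linarith [harm_one_nonneg n]

theorem abs_harm_two_mul_le (z : ℤˣ) {n M : ℕ} (h : n ≤ M + M) : |harm z n| ≤ 1 + harm 1 M := by
  have h1 := (abs_le.mp (abs_harm_sub_le 1 M M)).2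
  have h2 : (M : ℝ) / (M + 1) ≤ 1 := by
    rw [div_le_one (by positivity)]
    linarith
  linarith [abs_harm_le z n, harm_one_mono h]

/-- The sum of `e ^ n / n ^ u * φ n` over `1 ≤ n ≤ M`. -/
def outer (u : ℕ) (e : ℤˣ) (M : ℕ) (φ : ℕ → ℝ) : ℝ :=
  ∑ n ∈ Finset.Icc 1 M, sgn e ^ n / (n : ℝ) ^ u * φ n

theorem outer_add (u : ℕ) (e : ℤˣ) (M : ℕ) (φ ψ : ℕ → ℝ) :
    outer u e M (fun n => φ n + ψ n) = outer u e M φ + outer u e M ψ := by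
  simp only [outer, mul_add, Finset.sum_add_distrib]

theorem outer_sub (u : ℕ) (e : ℤˣ) (M : ℕ) (φ ψ : ℕ → ℝ) :
    outer u e M (fun n => φ n - ψ n) = outer u e M φ - outer u e M ψ := by
  simp only [outer, mul_sub, Finset.sum_sub_distrib]

theorem outer_const_mul (u : ℕ) (e : ℤˣ) (M : ℕ) (c : ℝ) (φ : ℕ → ℝ) :
    outer u e M (fun n => c * φ n) = c * outer u e M φ := by
  simp only [outer, Finset.mul_sum]
  exact Finset.sum_congr rfl fun n _ => by ring

theorem outer_const (u : ℕ) (e : ℤˣ) (M : ℕ) (c : ℝ) :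
    outer u e M (fun _ => c) = c * truncSum [(u, e)] M := by
  rw [truncSum_single, outer, Finset.mul_sum]
  exact Finset.sum_congr rfl fun n _ => by ring

theorem outer_congr (u : ℕ) (e : ℤˣ) (M : ℕ) {φ ψ : ℕ → ℝ}
    (h : ∀ n, 1 ≤ n → n ≤ M → φ n = ψ n) : outer u e M φ = outer u e M ψ := by
  refine Finset.sum_congr rfl fun n hn => ?_
  rw [Finset.mem_Icc] at hn
  rw [h n hn.1 hn.2]

theorem outer_truncSum_pred (u : ℕ) (e : ℤˣ) (M : ℕ) (k : Index) :
    outer u e M (fun n => truncSum k (n - 1)) = truncSum ((u, e) :: k) M := rfl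

theorem outer_truncSum_cons (u : ℕ) (e : ℤˣ) (M a : ℕ) (y : ℤˣ) (k : Index) :
    outer u e M (fun n => truncSum ((a, y) :: k) n) =
      truncSum ((u, e) :: (a, y) :: k) M + truncSum ((u + a, e * y) :: k) M := by
  rw [truncSum_cons u, truncSum_cons (u + a), ← Finset.sum_add_distrib]
  refine Finset.sum_congr rfl fun n hn => ?_
  simp only
  rw [truncSum_cons_pred a y k (Finset.mem_Icc.mp hn).1, sgn_mul, mul_pow, pow_add,
    ← div_mul_div_comm]
  ring

theorem sum_mul_sum_Icc_pred (f g : ℕ → ℝ) (M : ℕ) :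
    ∑ k ∈ Finset.Icc 1 M, f k * ∑ n ∈ Finset.Icc 1 (k - 1), g n =
      ∑ n ∈ Finset.Icc 1 M, g n *
        (∑ k ∈ Finset.Icc 1 M, f k - ∑ k ∈ Finset.Icc 1 n, f k) := by
  induction M with
  | zero => simp
  | succ M ih =>
    rw [Finset.sum_Icc_succ_top (by omega), ih, Finset.sum_Icc_succ_top (by omega) (fun n => g n * _)]
    rw [Finset.sum_Icc_succ_top (by omega) f, Nat.add_sub_cancel, Finset.mul_sum, sub_self, mul_zero,
      add_zero, ← Finset.sum_add_distrib]
    refine Finset.sum_congr rfl fun n _ => ?_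
    ring

/-- The term m = n is zero by the convention x/0 = 0. The terms m > n give the sum up to M-n; those
with m < n, reflected, give the sum up to n-1 with a minus sign. -/
theorem sum_pow_div_sub (z : ℤˣ) {n M : ℕ} (hn : 1 ≤ n) (hM : n ≤ M) :
    ∑ m ∈ Finset.Icc 1 M, sgn z ^ m / ((m : ℝ) - n) =
      sgn z ^ n * (harm z (M - n) - harm z (n - 1)) := by
  induction M, hM using Nat.le_induction with
  | base =>
    obtain ⟨K, rfl⟩ := Nat.exists_eq_add_of_le' hn
    rw [Nat.sub_self, harm_zero, Nat.add_sub_cancel, Finset.sum_Icc_succ_top (by omega), sub_self,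
      div_zero, add_zero, sum_Icc_reflect, harm_eq_sum, zero_sub, ← Finset.sum_neg_distrib,
      Finset.mul_sum]
    refine Finset.sum_congr rfl fun m hm => ?_
    rw [Finset.mem_Icc] at hm
    rw [sgn_pow_sub z (by omega), Nat.cast_sub (by omega), sub_sub_cancel_left, mul_div_assoc,
      div_neg]
  | succ M hM ih =>
    obtain ⟨j, rfl⟩ := Nat.exists_eq_add_of_le hM
    rw [Finset.sum_Icc_succ_top (by omega), ih, Nat.add_sub_cancel_left,
      show n + j + 1 - n = j + 1 by omega, harm_succ, show n + j + 1 = n + (j + 1) by ring, pow_add]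
    push_cast
    rw [add_sub_cancel_left]
    ring

theorem sum_pow_div_sub_pred (q : ℤˣ) {k m : ℕ} (hk : 1 ≤ k) (hm : k ≤ m) :
    ∑ n ∈ Finset.Icc 1 (k - 1), sgn q ^ n / ((m : ℝ) - n) =
      sgn q ^ m * (harm q (m - 1) - harm q (m - k)) := by
  induction k, hk using Nat.le_induction with
  | base => simp
  | succ k hk ih =>
    obtain ⟨K, rfl⟩ := Nat.exists_eq_add_of_le' hk
    obtain ⟨j, rfl⟩ := Nat.exists_eq_add_of_le hm
    have h := ih (by omega)
    rw [Nat.add_sub_cancel] at h ⊢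
    rw [Finset.sum_Icc_succ_top (by omega), h, show K + 1 + 1 + j - (K + 1) = j + 1 by omega,
      show K + 1 + 1 + j - (K + 1 + 1) = j by omega, harm_succ,
      show K + 1 + 1 + j = (K + 1) + (j + 1) by ring, pow_add]
    push_cast
    have e : (K : ℝ) + 1 + (j + 1) - (K + 1) = j + 1 := by ring
    rw [e]
    have := sgn_pow_mul_self q (j + 1)
    linear_combination (-sgn q ^ (K + 1) / ((j : ℝ) + 1)) * this

/-- Passing from m to m+1 adds precisely the convolution evaluated in `sgn_pow_div_mul_conv`. -/
theorem sum_harm_conv (p q : ℤˣ) (m : ℕ) :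
    ∑ k ∈ Finset.Icc 1 m, sgn p ^ k / (k : ℝ) * harm q (m - k) =
      truncSum [(1, q), (1, p * q)] m + truncSum [(1, p), (1, p * q)] m := by
  induction m with
  | zero => simp
  | succ m ih =>
    rw [Finset.sum_Icc_succ_top (by omega), Nat.sub_self, harm_zero, mul_zero, add_zero,
      truncSum_cons_succ, truncSum_cons_succ 1 p]
    have h : ∀ k ∈ Finset.Icc 1 m, sgn p ^ k / (k : ℝ) * harm q (m + 1 - k) =
        sgn p ^ k / (k : ℝ) * harm q (m - k) +
        sgn p ^ k / (k : ℝ) * (sgn q ^ (m + 1 - k) / ((m + 1 - k : ℕ) : ℝ)) := by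
      intro k hk
      rw [Finset.mem_Icc] at hk
      rw [show m + 1 - k = m - k + 1 by omega, harm_succ]
      push_cast
      ring
    rw [Finset.sum_congr rfl h, Finset.sum_add_distrib, ih, sgn_pow_div_mul_conv]
    ring

/-- The convention x/0 = 0 kills the last two terms on the diagonal, so later sums run over all m
and n without a side condition. -/
theorem bisum_eq (r : ℕ) {m n : ℕ} (hm : 1 ≤ m) (hn : 1 ≤ n) :
    bisum r (1 / (m : ℝ)) (1 / (n : ℝ)) = (if n = m then ((r : ℝ) + 1) / (m : ℝ) ^ (r + 2) else 0) +
      1 / (n : ℝ) ^ (r + 1) / ((m : ℝ) - n) - 1 / (m : ℝ) ^ (r + 1) / ((m : ℝ) - n) := by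
  have hm0 : (m : ℝ) ≠ 0 := by
    have : m ≠ 0 := by omega
    exact_mod_cast this
  have hn0 : (n : ℝ) ≠ 0 := by
    have : n ≠ 0 := by omega
    exact_mod_cast this
  by_cases h : n = m
  · subst h
    rw [bisum_self, if_pos rfl]
    simp [div_eq_mul_inv]
  · have hmn : (m : ℝ) - n ≠ 0 := by
      rw [sub_ne_zero]
      exact_mod_cast Ne.symm h
    have := sub_mul_bisum r hm0 hn0
    rw [if_neg h, zero_add, ← sub_div, eq_div_iff hmn, mul_comm, this]
    simp [div_eq_mul_inv]

/-! ### Asymptotics of the inner sums -/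

/-- The inner sum of the first box contribution. -/
def boxInner (s q : ℤˣ) (M m : ℕ) : ℝ :=
  ∑ k ∈ Finset.Icc 1 M, sgn s ^ k / (k : ℝ) *
    ∑ n ∈ Finset.Icc 1 (k - 1), sgn q ^ (m + n) / ((m : ℝ) - n)

theorem sum_pow_add_div_sub_succ (q : ℤˣ) (m k : ℕ) :
    ∑ n ∈ Finset.Icc 1 k, sgn q ^ (m + 1 + n) / (((m + 1 : ℕ) : ℝ) - n) =
      ∑ n ∈ Finset.Icc 1 k, sgn q ^ (m + n) / ((m : ℝ) - n) +
        (sgn q ^ m / m - sgn q ^ (m + k) / ((m : ℝ) - k)) := by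
  induction k with
  | zero => simp
  | succ k ih =>
    rw [Finset.sum_Icc_succ_top (by omega), Finset.sum_Icc_succ_top (by omega), ih,
      show m + 1 + (k + 1) = m + k + 2 by ring, pow_add _ _ 2, sq, sgn_mul_self]
    push_cast
    rw [add_sub_add_right_eq_sub]
    ring

/-- Raising m by one shifts the range of n and leaves boundary terms, one of which has denominator
k(m+1-k). Partial fractions in k turn it into harmonic sums; the final square corrects for k = m+1,
where that boundary term is zero by convention. -/
theorem boxInner_succ (s q : ℤˣ) {M m : ℕ} (hm : m + 1 ≤ M) :
    boxInner s q M (m + 1) = boxInner s q M m + harm s M * (sgn q ^ m / m) -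
      sgn q ^ (m + 1) / ((m : ℝ) + 1) * harm (s * q) M +
      sgn s ^ (m + 1) / ((m : ℝ) + 1) * (harm (s * q) (M - (m + 1)) - harm (s * q) m) +
      sgn s ^ (m + 1) / ((m : ℝ) + 1) ^ 2 := by
  have h1 : boxInner s q M (m + 1) = boxInner s q M m + harm s M * (sgn q ^ m / m) -
      ∑ k ∈ Finset.Icc 1 M, sgn q ^ (m + 1) / ((m : ℝ) + 1) * (sgn (s * q) ^ k / (k : ℝ) -
        sgn (s * q) ^ k / ((k : ℝ) - (m + 1 : ℕ)) -
        if k = m + 1 then sgn (s * q) ^ k / (k : ℝ) else 0) := by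
    rw [boxInner, boxInner, harm_eq_sum, Finset.sum_mul, ← Finset.sum_add_distrib,
      ← Finset.sum_sub_distrib]
    refine Finset.sum_congr rfl fun k hk => ?_
    rw [Finset.mem_Icc] at hk
    obtain ⟨j, rfl⟩ := Nat.exists_eq_add_of_le' hk.1
    rw [Nat.add_sub_cancel, sum_pow_add_div_sub_succ, sgn_mul, mul_pow]
    have hj : (j : ℝ) + 1 ≠ 0 := by positivity
    have hm0 : (m : ℝ) + 1 ≠ 0 := by positivity
    have e1 := sgn_mul_self q
    by_cases h : j = m
    · subst h
      simp
      ring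
    · have h' : (j : ℝ) - m ≠ 0 := by
        rw [sub_ne_zero]
        exact_mod_cast h
      have h'' : (m : ℝ) - j ≠ 0 := by
        rw [sub_ne_zero]
        exact_mod_cast Ne.symm h
      rw [if_neg (by omega)]
      push_cast
      rw [add_sub_add_right_eq_sub, pow_add, pow_succ (sgn q), pow_succ (sgn q)]
      have e2 : sgn q ^ m / ((m : ℝ) + 1) * (sgn s ^ (j + 1) * sgn q ^ j) *
          (1 / ((j : ℝ) + 1) - 1 / ((j : ℝ) - m)) =
          sgn s ^ (j + 1) / ((j : ℝ) + 1) * (sgn q ^ m * sgn q ^ j / ((m : ℝ) - j)) := by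
        have e3 : (1 / ((j : ℝ) + 1) - 1 / ((j : ℝ) - m)) =
          ((m : ℝ) + 1) * (1 / ((j : ℝ) + 1) * (1 / ((m : ℝ) - j))) := by
          rw [← neg_sub (m : ℝ) j] at h' ⊢
          field_simp
          ring
        rw [e3]
        field_simp
      linear_combination e2 + (sgn q ^ m / ((m : ℝ) + 1) * (sgn s ^ (j + 1) * sgn q ^ j) *
          (1 / ((j : ℝ) + 1) - 1 / ((j : ℝ) - m))) * e1
  rw [h1, ← Finset.mul_sum, Finset.sum_sub_distrib, Finset.sum_sub_distrib, ← harm_eq_sum,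
    sum_pow_div_sub (s * q) (by omega) hm, Finset.sum_ite_eq' (Finset.Icc 1 M) (m + 1),
    if_pos (Finset.mem_Icc.mpr ⟨by omega, hm⟩), Nat.add_sub_cancel, sgn_mul, mul_pow]
  have e1 := sgn_pow_mul_self q (m + 1)
  push_cast
  have hm0 : (m : ℝ) + 1 ≠ 0 := by positivity
  have e2 : sgn s ^ (m + 1) / ((m : ℝ) + 1) ^ 2 =
    sgn s ^ (m + 1) / ((m : ℝ) + 1) / ((m : ℝ) + 1) := by rw [sq, div_div]
  rw [e2]
  linear_combination (sgn s ^ (m + 1) / ((m : ℝ) + 1) *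
    (harm (s * q) (M - (m + 1)) - harm (s * q) m) +
    sgn s ^ (m + 1) / ((m : ℝ) + 1) / ((m : ℝ) + 1)) * e1

/-- The limiting shape of `boxInner`. -/
def boxInnerMain (s q : ℤˣ) (M m : ℕ) : ℝ :=
  harm s M * harm q (m - 1) - harm (s * q) M * harm q m + harm (s * q) M * harm s m
    - truncSum [(1, s), (1, s * q)] m + truncSum [(2, s)] m - truncSum [(1, s), (1, q)] M

/-- At m = 0 the denominators are -n and the two sides agree exactly. The main term obeys the same
recursion with M in place of M-(m+1) in one harmonic sum, so each step costs at most 1/(M-m). -/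
theorem abs_boxInner_sub_le (s q : ℤˣ) (M m : ℕ) (hm : m ≤ M) :
    |boxInner s q M m - boxInnerMain s q M m| ≤ m / ((M : ℝ) - m + 1) := by
  induction m with
  | zero =>
    have : boxInner s q M 0 = boxInnerMain s q M 0 := by
      rw [boxInner, boxInnerMain, truncSum_cons 1 s [(1, q)]]
      simp [truncSum_single, div_neg]
    simp [this]
  | succ m ih =>
    have hM : ((m : ℝ) + 1) ≤ M := by exact_mod_cast hm
    have e : boxInner s q M (m + 1) - boxInnerMain s q M (m + 1) =
        (boxInner s q M m - boxInnerMain s q M m) -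
        sgn s ^ (m + 1) / ((m : ℝ) + 1) *
          (harm (s * q) (M - (m + 1) + (m + 1)) - harm (s * q) (M - (m + 1))) := by
      rw [boxInner_succ s q hm, boxInnerMain, boxInnerMain, Nat.sub_add_cancel hm,
        truncSum_cons_succ 1 s, truncSum_cons_succ 2 s, truncSum_nil, Nat.add_sub_cancel,
        harm_succ q, harm_succ s]
      have : harm q m = harm q (m - 1) + sgn q ^ m / m := by
        cases m with
        | zero => simp
        | succ m => rw [harm_succ, Nat.add_sub_cancel]; push_cast; rfl
      rw [this]
      ring
    rw [e]
    refine (abs_sub _ _).trans ?_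
    have h1 := ih (by omega)
    have h2 := abs_harm_sub_le (s * q) (M - (m + 1)) (m + 1)
    have hm0 : (0 : ℝ) < (m : ℝ) + 1 := by positivity
    rw [Nat.cast_sub hm] at h2
    push_cast at h2
    rw [abs_mul, abs_div, abs_sgn_pow, abs_of_pos hm0]
    have h3 : 1 / ((m : ℝ) + 1) * |harm (s * q) (M - (m + 1) + (m + 1)) -
        harm (s * q) (M - (m + 1))| ≤ 1 / ((M : ℝ) - m) := by
      calc _ ≤ 1 / ((m : ℝ) + 1) * (((m : ℝ) + 1) / (M - (m + 1) + 1)) := by gcongr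
        _ = 1 / ((M : ℝ) - (m + 1) + 1) := by
          rw [one_div_mul_eq_div, div_div, mul_comm, ← div_div, div_self hm0.ne']
        _ = _ := by congr 1; ring
    have h4 : (m : ℝ) / ((M : ℝ) - m + 1) ≤ m / ((M : ℝ) - m) := by
      gcongr
      · linarith
      · linarith
    push_cast
    calc _ ≤ (m : ℝ) / ((M : ℝ) - m) + 1 / ((M : ℝ) - m) := add_le_add (h1.trans h4) h3
      _ = _ := by rw [← add_div]; congr 1; ring

theorem sum_pow_div_add (s : ℤˣ) (N M : ℕ) :
    ∑ i ∈ Finset.Icc 1 M, sgn s ^ i / ((i : ℝ) + N) =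
      sgn s ^ N * (harm s (M + N) - harm s N) := by
  induction M with
  | zero => simp
  | succ M ih =>
    rw [Finset.sum_Icc_succ_top (by omega), ih, show M + 1 + N = M + N + 1 by ring, harm_succ,
      show M + N + 1 = M + 1 + N by ring, pow_add]
    push_cast
    have := sgn_pow_mul_self s N
    rw [show (M : ℝ) + 1 + N = M + N + 1 by ring]
    linear_combination (-sgn s ^ (M + 1) / ((M : ℝ) + N + 1)) * this

/-- A shifted analogue of a truncated double sum. -/
def shiftSum (s p : ℤˣ) (M l : ℕ) : ℝ :=
  ∑ i ∈ Finset.Icc 1 M, sgn (p * s) ^ i / (i : ℝ) * harm p (i + l)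

/-- The limiting shape of `shiftSum`. -/
def shiftSumMain (s p : ℤˣ) (M l : ℕ) : ℝ :=
  truncSum [(1, p * s), (1, p)] M + truncSum [(2, s)] M
    + harm s M * (harm p l - harm (p * s) l)
    + truncSum [(1, p * s), (1, s)] l + truncSum [(2, p)] l

/-- Induction on the shift: exact at l = 0, and each step replaces the harmonic sum up to M+l+1 by
the one up to M, at cost 1/(M+1). -/
theorem abs_shiftSum_sub_le (s p : ℤˣ) (M l : ℕ) :
    |shiftSum s p M l - shiftSumMain s p M l| ≤ l / ((M : ℝ) + 1) := by
  induction l with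
  | zero =>
    have : shiftSum s p M 0 = shiftSumMain s p M 0 := by
      rw [shiftSum, shiftSumMain, truncSum_cons 1 (p * s) [(1, p)] M, truncSum_single 2 s M]
      simp only [truncSum_cons_zero, sub_self, mul_zero, add_zero]
      rw [← Finset.sum_add_distrib]
      refine Finset.sum_congr rfl fun i hi => ?_
      rw [Finset.mem_Icc] at hi
      obtain ⟨j, rfl⟩ := Nat.exists_eq_add_of_le' hi.1
      rw [harm_succ, Nat.add_sub_cancel, sgn_mul, mul_pow]
      have := sgn_pow_mul_self p (j + 1)
      push_cast
      have hj : (j : ℝ) + 1 ≠ 0 := by positivity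
      rw [pow_one, sq, mul_add, ← div_div]
      linear_combination (sgn s ^ (j + 1) / ((j : ℝ) + 1) / ((j : ℝ) + 1)) * this
    simp [this]
  | succ l ih =>
    have hstep : shiftSum s p M (l + 1) = shiftSum s p M l +
        sgn p ^ (l + 1) / ((l : ℝ) + 1) *
          (harm s M - sgn s ^ (l + 1) * (harm s (M + (l + 1)) - harm s (l + 1))) := by
      rw [← sum_pow_div_add, shiftSum, shiftSum, harm_eq_sum, ← Finset.sum_sub_distrib,
        Finset.mul_sum, ← Finset.sum_add_distrib]
      refine Finset.sum_congr rfl fun i hi => ?_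
      rw [Finset.mem_Icc] at hi
      rw [← add_assoc, harm_succ, show i + l + 1 = i + (l + 1) by ring, pow_add, sgn_mul, mul_pow]
      have := sgn_pow_mul_self p i
      have hi0 : (i : ℝ) ≠ 0 := by
        have : i ≠ 0 := by omega
        exact_mod_cast this
      have hl : (l : ℝ) + 1 ≠ 0 := by positivity
      have hil : (i : ℝ) + (l + 1) ≠ 0 := by positivity
      push_cast
      rw [show (i : ℝ) + l + 1 = i + (l + 1) by ring]
      field_simp
      linear_combination (sgn s ^ i * sgn p ^ (l + 1) * (l + 1)) * this
    have e : shiftSum s p M (l + 1) - shiftSumMain s p M (l + 1) =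
        (shiftSum s p M l - shiftSumMain s p M l) -
        sgn (p * s) ^ (l + 1) / ((l : ℝ) + 1) * (harm s (M + (l + 1)) - harm s M) := by
      rw [hstep, shiftSumMain, shiftSumMain, truncSum_cons_succ 1 (p * s) [(1, s)],
        truncSum_cons_succ 2 p, truncSum_nil, harm_succ p, harm_succ (p * s), harm_succ s l,
        sgn_mul, mul_pow]
      have := sgn_pow_mul_self s (l + 1)
      have hl : (l : ℝ) + 1 ≠ 0 := by positivity
      rw [pow_one, sq, ← div_div]
      linear_combination (sgn p ^ (l + 1) / ((l : ℝ) + 1) / ((l : ℝ) + 1)) * this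
    rw [e]
    refine (abs_sub _ _).trans ?_
    have hl : (0 : ℝ) < (l : ℝ) + 1 := by positivity
    have h2 := abs_harm_sub_le s M (l + 1)
    push_cast at h2 ⊢
    rw [abs_mul, abs_div, abs_sgn_pow, abs_of_pos hl, add_div]
    refine add_le_add ih ?_
    calc 1 / ((l : ℝ) + 1) * |harm s (M + (l + 1)) - harm s M|
        ≤ 1 / ((l : ℝ) + 1) * (((l : ℝ) + 1) / (M + 1)) := by gcongr
      _ = _ := by field_simp

/-- The inner sum of the contribution of `ζ(b, 1, c)`. -/
def tailInner (s p : ℤˣ) (M n : ℕ) : ℝ :=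
  ∑ i ∈ Finset.Icc 1 (M - n), sgn (p * s) ^ i / (i : ℝ) * (harm p (i + n - 1) - harm p n)

/-- The limiting shape of `tailInner`. -/
def tailInnerMain (s p : ℤˣ) (M n : ℕ) : ℝ :=
  shiftSumMain s p M (n - 1) - harm (p * s) M * harm p n

/-- Three replacements: the range of i is extended from M-n to M, the resulting `shiftSum` is
replaced by its main term, and the harmonic sum up to M-n by the one up to M. -/
theorem abs_tailInner_sub_le (s p : ℤˣ) {M n : ℕ} (hn : 1 ≤ n) (hM : n ≤ M) :
    |tailInner s p M n - tailInnerMain s p M n| ≤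
      2 * (1 + harm 1 M) * (n / ((M : ℝ) - n + 1)) := by
  have hM' : (n : ℝ) ≤ M := by exact_mod_cast hM
  -- The argument i+n-1 can exceed M but not 2M, which accounts for the bound 1 + H_M.
  have h1 := abs_sum_div_sub_le (f := fun i => sgn (p * s) ^ i * harm p (i + n - 1))
    (B := 1 + harm 1 M) (M - n) n (fun i h h' => by
      rw [abs_mul, abs_sgn_pow, one_mul]
      exact abs_harm_two_mul_le p (by omega))
  have h2 := abs_shiftSum_sub_le s p M (n - 1)
  have h3 := abs_harm_sub_le (p * s) (M - n) n
  rw [Nat.sub_add_cancel hM, Nat.cast_sub hM] at h1 h3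
  rw [Nat.cast_sub hn] at h2
  have e : tailInner s p M n - tailInnerMain s p M n =
      -(∑ i ∈ Finset.Icc 1 M, sgn (p * s) ^ i * harm p (i + n - 1) / (i : ℝ) -
        ∑ i ∈ Finset.Icc 1 (M - n), sgn (p * s) ^ i * harm p (i + n - 1) / (i : ℝ)) +
      (shiftSum s p M (n - 1) - shiftSumMain s p M (n - 1)) +
      (harm (p * s) M - harm (p * s) (M - n)) * harm p n := by
    have e1 : shiftSum s p M (n - 1) =
        ∑ i ∈ Finset.Icc 1 M, sgn (p * s) ^ i * harm p (i + n - 1) / (i : ℝ) := by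
      refine Finset.sum_congr rfl fun i _ => ?_
      rw [Nat.add_sub_assoc hn]
      ring
    have e2 : tailInner s p M n =
        ∑ i ∈ Finset.Icc 1 (M - n), sgn (p * s) ^ i * harm p (i + n - 1) / (i : ℝ) -
          harm (p * s) (M - n) * harm p n := by
      rw [tailInner, harm_eq_sum (p * s), Finset.sum_mul, ← Finset.sum_sub_distrib]
      refine Finset.sum_congr rfl fun i _ => ?_
      ring
    rw [e1, e2, tailInnerMain]
    ring
  rw [e]
  have h4 := abs_harm_le p n
  have h5 := harm_one_mono hM
  have h6 : ((n : ℝ) - (1 : ℕ)) / ((M : ℝ) + 1) ≤ n / ((M : ℝ) - n + 1) := by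
    refine div_le_div₀ (by positivity) ?_ (by linarith) ?_
    · push_cast
      linarith
    · linarith [n.cast_nonneg (α := ℝ)]
  have h7 : |(harm (p * s) M - harm (p * s) (M - n)) * harm p n| ≤
      n / ((M : ℝ) - n + 1) * harm 1 M := by
    rw [abs_mul]
    exact mul_le_mul h3 (h4.trans h5) (abs_nonneg _) ((abs_nonneg _).trans h3)
  refine (abs_add_le _ _).trans ((add_le_add ((abs_add_le _ _).trans
    (add_le_add ((abs_neg _).trans_le h1) (h2.trans h6))) h7).trans (le_of_eq ?_))
  ring

/-! ### Evaluation of the truncated products and triple sums -/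

/-- Stuffle product side of the weighted sum formula. -/
def boxSum (r : ℕ) (s p q : ℤˣ) (M : ℕ) : ℝ :=
  ∑ P ∈ antidiagonal r, truncSum [(P.1 + 1, p * s)] M * truncSum [(1, s), (P.2 + 1, q)] M

/-- The depth three sums subtracted in the weighted sum formula. -/
def wedgeSum (r : ℕ) (s p q : ℤˣ) (M : ℕ) : ℝ :=
  ∑ P ∈ antidiagonal r, truncSum [(P.1 + 1, s * p), (1, p), (P.2 + 1, q)] M

theorem boxSum_eq_bisum (r : ℕ) (s p q : ℤˣ) (M : ℕ) :
    boxSum r s p q M = ∑ k ∈ Finset.Icc 1 M, sgn s ^ k / (k : ℝ) *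
      ∑ n ∈ Finset.Icc 1 (k - 1), sgn q ^ n *
        ∑ m ∈ Finset.Icc 1 M, sgn (p * s) ^ m * bisum r (1 / (m : ℝ)) (1 / (n : ℝ)) := by
  have h : ∀ P : ℕ × ℕ, truncSum [(P.1 + 1, p * s)] M * truncSum [(1, s), (P.2 + 1, q)] M =
      ∑ k ∈ Finset.Icc 1 M, ∑ n ∈ Finset.Icc 1 (k - 1), ∑ m ∈ Finset.Icc 1 M,
        sgn s ^ k / (k : ℝ) * (sgn q ^ n * (sgn (p * s) ^ m *
          ((1 / (m : ℝ)) ^ (P.1 + 1) * (1 / (n : ℝ)) ^ (P.2 + 1)))) := by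
    intro P
    rw [truncSum_cons 1, truncSum_single, Finset.mul_sum]
    refine Finset.sum_congr rfl fun k _ => ?_
    rw [truncSum_single, Finset.mul_sum, Finset.mul_sum]
    refine Finset.sum_congr rfl fun n _ => ?_
    rw [Finset.sum_mul]
    refine Finset.sum_congr rfl fun m _ => ?_
    simp only [div_eq_mul_inv, one_mul, inv_pow, pow_one]
    ring
  rw [boxSum]
  simp only [h]
  rw [Finset.sum_comm]
  refine Finset.sum_congr rfl fun k _ => ?_
  rw [Finset.sum_comm, Finset.mul_sum]
  refine Finset.sum_congr rfl fun n _ => ?_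
  rw [Finset.sum_comm, Finset.mul_sum, Finset.mul_sum]
  refine Finset.sum_congr rfl fun m _ => ?_
  rw [bisum, Finset.mul_sum, Finset.mul_sum, Finset.mul_sum]

/-- The three parts of `bisum_eq`: the diagonal gives the factor r+1; in the part with n^(-r-1) the
sums over m and k are harmonic; in the part with m^(-r-1) the sums over k and n form `boxInner`. -/
theorem boxSum_eq (r : ℕ) (s p q : ℤˣ) (M : ℕ) :
    boxSum r s p q M = ((r : ℝ) + 1) * truncSum [(1, s), (r + 2, p * q * s)] M
      + outer (r + 1) (p * q * s) M (fun n =>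
          (harm s M - harm s n) * (harm (p * s) (M - n) - harm (p * s) (n - 1)))
      - outer (r + 1) (p * q * s) M (boxInner s q M) := by
  rw [boxSum_eq_bisum]
  have h : ∀ k ∈ Finset.Icc 1 M, sgn s ^ k / (k : ℝ) * ∑ n ∈ Finset.Icc 1 (k - 1), sgn q ^ n *
        ∑ m ∈ Finset.Icc 1 M, sgn (p * s) ^ m * bisum r (1 / (m : ℝ)) (1 / (n : ℝ)) =
      ((r : ℝ) + 1) * (sgn s ^ k / (k : ℝ) ^ 1 * truncSum [(r + 2, p * q * s)] (k - 1)) +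
      sgn s ^ k / (k : ℝ) * ∑ n ∈ Finset.Icc 1 (k - 1),
        sgn (p * q * s) ^ n / (n : ℝ) ^ (r + 1) *
          (harm (p * s) (M - n) - harm (p * s) (n - 1)) -
      ∑ m ∈ Finset.Icc 1 M, sgn (p * q * s) ^ m / (m : ℝ) ^ (r + 1) *
        (sgn s ^ k / (k : ℝ) * ∑ n ∈ Finset.Icc 1 (k - 1), sgn q ^ (m + n) / ((m : ℝ) - n)) := by
    intro k hk
    rw [Finset.mem_Icc] at hk
    have h1 : ∀ n ∈ Finset.Icc 1 (k - 1), sgn q ^ n *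
        ∑ m ∈ Finset.Icc 1 M, sgn (p * s) ^ m * bisum r (1 / (m : ℝ)) (1 / (n : ℝ)) =
        ((r : ℝ) + 1) * (sgn (p * q * s) ^ n / (n : ℝ) ^ (r + 2)) +
        sgn (p * q * s) ^ n / (n : ℝ) ^ (r + 1) *
          (harm (p * s) (M - n) - harm (p * s) (n - 1)) -
        ∑ m ∈ Finset.Icc 1 M, sgn (p * q * s) ^ m / (m : ℝ) ^ (r + 1) *
          (sgn q ^ (m + n) / ((m : ℝ) - n)) := by
      intro n hn
      rw [Finset.mem_Icc] at hn
      have h2 : ∀ m ∈ Finset.Icc 1 M, sgn (p * s) ^ m * bisum r (1 / (m : ℝ)) (1 / (n : ℝ)) =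
          (if n = m then sgn (p * s) ^ m * (((r : ℝ) + 1) / (m : ℝ) ^ (r + 2)) else 0) +
          1 / (n : ℝ) ^ (r + 1) * (sgn (p * s) ^ m / ((m : ℝ) - n)) -
          sgn (p * s) ^ m * (1 / (m : ℝ) ^ (r + 1) / ((m : ℝ) - n)) := by
        intro m hm
        rw [bisum_eq r (Finset.mem_Icc.mp hm).1 hn.1]
        split_ifs <;> ring
      rw [Finset.sum_congr rfl h2, Finset.sum_sub_distrib, Finset.sum_add_distrib,
        ← Finset.mul_sum, sum_pow_div_sub (p * s) hn.1 (by omega), Finset.sum_ite_eq,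
        if_pos (Finset.mem_Icc.mpr ⟨hn.1, by omega⟩), mul_sub, mul_add, Finset.mul_sum]
      congr 1
      · simp only [sgn_mul, mul_pow]
        ring
      · refine Finset.sum_congr rfl fun m _ => ?_
        have := sgn_pow_mul_self q m
        simp only [sgn_mul, mul_pow, pow_add]
        linear_combination (-(sgn p ^ m * sgn s ^ m * sgn q ^ n *
          (1 / (m : ℝ) ^ (r + 1) / ((m : ℝ) - n)))) * this
    rw [Finset.sum_congr rfl h1, Finset.sum_sub_distrib, Finset.sum_add_distrib, ← Finset.mul_sum,
      mul_sub, mul_add, truncSum_single, pow_one]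
    congr 1
    · ring
    · rw [Finset.sum_comm, Finset.mul_sum]
      refine Finset.sum_congr rfl fun m _ => ?_
      rw [← Finset.mul_sum]
      ring
  rw [Finset.sum_congr rfl h, Finset.sum_sub_distrib, Finset.sum_add_distrib, ← Finset.mul_sum,
    ← truncSum_cons, sum_mul_sum_Icc_pred]
  congr 1
  · congr 1
    rw [outer]
    refine Finset.sum_congr rfl fun n _ => ?_
    rw [harm_eq_sum s, harm_eq_sum s]
    ring
  · rw [Finset.sum_comm, outer]
    refine Finset.sum_congr rfl fun m _ => ?_
    rw [← Finset.mul_sum, boxInner]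

theorem wedgeSum_eq_bisum (r : ℕ) (s p q : ℤˣ) (M : ℕ) :
    wedgeSum r s p q M = ∑ m ∈ Finset.Icc 1 M, sgn (p * s) ^ m *
      ∑ k ∈ Finset.Icc 1 (m - 1), sgn p ^ k / (k : ℝ) *
        ∑ n ∈ Finset.Icc 1 (k - 1), sgn q ^ n * bisum r (1 / (m : ℝ)) (1 / (n : ℝ)) := by
  have h : ∀ P : ℕ × ℕ, truncSum [(P.1 + 1, s * p), (1, p), (P.2 + 1, q)] M =
      ∑ m ∈ Finset.Icc 1 M, ∑ k ∈ Finset.Icc 1 (m - 1), ∑ n ∈ Finset.Icc 1 (k - 1),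
        sgn (p * s) ^ m * (sgn p ^ k / (k : ℝ) * (sgn q ^ n *
          ((1 / (m : ℝ)) ^ (P.1 + 1) * (1 / (n : ℝ)) ^ (P.2 + 1)))) := by
    intro P
    rw [truncSum_cons, mul_comm s p]
    refine Finset.sum_congr rfl fun m _ => ?_
    rw [truncSum_cons, Finset.mul_sum]
    refine Finset.sum_congr rfl fun k _ => ?_
    rw [truncSum_single, Finset.mul_sum, Finset.mul_sum]
    refine Finset.sum_congr rfl fun n _ => ?_
    simp only [div_eq_mul_inv, one_mul, inv_pow, pow_one]
    ring
  rw [wedgeSum]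
  simp only [h]
  rw [Finset.sum_comm]
  refine Finset.sum_congr rfl fun m _ => ?_
  rw [Finset.sum_comm, Finset.mul_sum]
  refine Finset.sum_congr rfl fun k _ => ?_
  rw [Finset.sum_comm, Finset.mul_sum, Finset.mul_sum]
  refine Finset.sum_congr rfl fun n _ => ?_
  rw [bisum, Finset.mul_sum, Finset.mul_sum, Finset.mul_sum]

theorem sum_Icc_pair_eq' (K : ℕ) (g : ℕ → ℕ → ℝ) :
    ∑ m ∈ Finset.Icc 1 K, ∑ n ∈ Finset.Icc 1 (m - 1), g m n =
      ∑ n ∈ Finset.Icc 1 K, ∑ i ∈ Finset.Icc 1 (K - n), g (i + n) n := by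
  rw [sum_Icc_pair_eq, sum_Icc_pair_swap]

/-- Here m > k > n, so there is no diagonal. In the part with n^(-r-1), summing over k and then over
i = m-n gives `tailInner`; in the part with m^(-r-1), the sum over n is harmonic and the sum over k
is the convolution `sum_harm_conv`. -/
theorem wedgeSum_eq (r : ℕ) (s p q : ℤˣ) (M : ℕ) :
    wedgeSum r s p q M = outer (r + 1) (p * q * s) M (tailInner s p M)
      - outer (r + 1) (p * q * s) M (fun m => harm p (m - 1) * harm q (m - 1)
          - (truncSum [(1, q), (1, p * q)] m + truncSum [(1, p), (1, p * q)] m)) := by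
  rw [wedgeSum_eq_bisum]
  have h : ∀ m ∈ Finset.Icc 1 M, sgn (p * s) ^ m *
      ∑ k ∈ Finset.Icc 1 (m - 1), sgn p ^ k / (k : ℝ) *
        ∑ n ∈ Finset.Icc 1 (k - 1), sgn q ^ n * bisum r (1 / (m : ℝ)) (1 / (n : ℝ)) =
      ∑ n ∈ Finset.Icc 1 (m - 1), sgn (p * s) ^ m *
        (sgn q ^ n / (n : ℝ) ^ (r + 1) / ((m : ℝ) - n) * (harm p (m - 1) - harm p n)) -
      sgn (p * q * s) ^ m / (m : ℝ) ^ (r + 1) * (harm p (m - 1) * harm q (m - 1)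
          - (truncSum [(1, q), (1, p * q)] m + truncSum [(1, p), (1, p * q)] m)) := by
    intro m hm
    rw [Finset.mem_Icc] at hm
    have h1 : ∀ k ∈ Finset.Icc 1 (m - 1), sgn p ^ k / (k : ℝ) *
        ∑ n ∈ Finset.Icc 1 (k - 1), sgn q ^ n * bisum r (1 / (m : ℝ)) (1 / (n : ℝ)) =
        sgn p ^ k / (k : ℝ) * ∑ n ∈ Finset.Icc 1 (k - 1),
          sgn q ^ n / (n : ℝ) ^ (r + 1) / ((m : ℝ) - n) -
        sgn q ^ m / (m : ℝ) ^ (r + 1) * (sgn p ^ k / (k : ℝ) * harm q (m - 1) -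
          sgn p ^ k / (k : ℝ) * harm q (m - k)) := by
      intro k hk
      rw [Finset.mem_Icc] at hk
      have h2 := sum_pow_div_sub_pred q hk.1 (show k ≤ m by omega)
      have h3 : ∀ n ∈ Finset.Icc 1 (k - 1),
          sgn q ^ n * bisum r (1 / (m : ℝ)) (1 / (n : ℝ)) =
          sgn q ^ n / (n : ℝ) ^ (r + 1) / ((m : ℝ) - n) -
          1 / (m : ℝ) ^ (r + 1) * (sgn q ^ n / ((m : ℝ) - n)) := by
        intro n hn
        rw [Finset.mem_Icc] at hn
        rw [bisum_eq r hm.1 hn.1, if_neg (by omega)]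
        ring
      rw [Finset.sum_congr rfl h3, Finset.sum_sub_distrib, ← Finset.mul_sum, h2]
      ring
    have h4 := sum_harm_conv p q m
    obtain ⟨l, rfl⟩ := Nat.exists_eq_add_of_le' hm.1
    rw [Finset.sum_Icc_succ_top (by omega), Nat.sub_self, harm_zero, mul_zero, add_zero] at h4
    rw [Finset.sum_congr rfl h1, Finset.sum_sub_distrib, ← Finset.mul_sum, Finset.sum_sub_distrib,
      ← Finset.sum_mul, Nat.add_sub_cancel, h4, ← harm_eq_sum, sum_mul_sum_Icc_pred, mul_sub,
      Finset.mul_sum]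
    congr 1
    · refine Finset.sum_congr rfl fun n _ => ?_
      rw [harm_eq_sum p, harm_eq_sum p]
    · simp only [sgn_mul, mul_pow]
      ring
  rw [Finset.sum_congr rfl h, Finset.sum_sub_distrib, sum_Icc_pair_eq']
  congr 1
  rw [outer]
  refine Finset.sum_congr rfl fun n _ => ?_
  rw [tailInner, Finset.mul_sum]
  refine Finset.sum_congr rfl fun i _ => ?_
  push_cast
  rw [add_sub_cancel_right, pow_add]
  simp only [sgn_mul, mul_pow]
  ring

/-- The combination of truncated sums that describes `boxSum - wedgeSum` asymptotically. -/
def mainSum (r : ℕ) (s p q : ℤˣ) (M : ℕ) : ℝ :=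
  ((r : ℝ) + 1) * truncSum [(1, s), (r + 2, p * q * s)] M
    + outer (r + 1) (p * q * s) M (fun n =>
        (harm s M - harm s n) * (harm (p * s) M - harm (p * s) (n - 1)))
    - outer (r + 1) (p * q * s) M (boxInnerMain s q M)
    - outer (r + 1) (p * q * s) M (tailInnerMain s p M)
    + outer (r + 1) (p * q * s) M (fun m => harm p (m - 1) * harm q (m - 1)
        - (truncSum [(1, q), (1, p * q)] m + truncSum [(1, p), (1, p * q)] m))

/-- Since n^(-u) n ≤ 1/n, the sum is dominated by that of 1/(n(M+1-n)), which is 2 H_M/(M+1) by the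
convolution formula. -/
theorem abs_outer_le {u : ℕ} (hu : 2 ≤ u) (e : ℤˣ) {M : ℕ} {φ : ℕ → ℝ} {B : ℝ}
    (h : ∀ n, 1 ≤ n → n ≤ M → |φ n| ≤ B * (n / ((M : ℝ) - n + 1))) :
    |outer u e M φ| ≤ B * (2 / ((M : ℝ) + 1) * harm 1 M) := by
  have h1 := sgn_pow_div_mul_conv 1 1 M
  simp only [mul_one, sgn_one, one_pow] at h1
  rw [show (2 : ℝ) = 1 + 1 by norm_num, ← h1, Finset.mul_sum, outer]
  refine (Finset.abs_sum_le_sum_abs _ _).trans (Finset.sum_le_sum fun n hn => ?_)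
  rw [Finset.mem_Icc] at hn
  have hn0 : (1 : ℝ) ≤ n := by exact_mod_cast hn.1
  have hnM : (n : ℝ) ≤ M := by exact_mod_cast hn.2
  have h2 := h n hn.1 hn.2
  have hx : 0 ≤ B * (n / ((M : ℝ) - n + 1)) := (abs_nonneg _).trans h2
  rw [abs_mul, abs_div, abs_sgn_pow, abs_pow, Nat.abs_cast, Nat.cast_sub (by omega)]
  push_cast
  have h3 : 1 / (n : ℝ) ^ u ≤ 1 / (n : ℝ) ^ 2 :=
    one_div_le_one_div_of_le (by positivity) (pow_le_pow_right₀ hn0 hu)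
  calc 1 / (n : ℝ) ^ u * |φ n| ≤ 1 / (n : ℝ) ^ 2 * (B * (n / ((M : ℝ) - n + 1))) := by
        gcongr
    _ = B * (1 / (n : ℝ) * (1 / ((M : ℝ) + 1 - n))) := by
        have : (M : ℝ) - n + 1 ≠ 0 := by linarith
        rw [show (M : ℝ) + 1 - n = (M : ℝ) - n + 1 by ring]
        field_simp

theorem tendsto_harm_sq_div : Tendsto (fun M : ℕ =>
    3 * (1 + harm 1 M) * (2 / ((M : ℝ) + 1) * harm 1 M)) atTop (𝓝 0) := by
  have hr : Negl atTop logScale (fun M : ℕ => 1 / √((M : ℝ) + 1)) :=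
    Rate.negl ⟨1, fun n => by rw [abs_of_nonneg (by positivity)]⟩
  have hr' : HasPoly atTop logScale (fun M : ℕ => 1 / √((M : ℝ) + 1)) 0 := by
    simpa [HasPoly] using hr
  have h := (((hr'.mul ((hasPoly_const 1).add hasPoly_harmonic)).mul
    (hr'.mul hasPoly_harmonic)).const_mul 6).tendsto
  simp only [zero_mul, mul_zero, eval_zero, sub_zero] at h
  refine h.congr fun M => ?_
  have := Real.sq_sqrt (show (0 : ℝ) ≤ (M : ℝ) + 1 by positivity)
  have e : 2 / ((M : ℝ) + 1) = 2 * (1 / √((M : ℝ) + 1) * (1 / √((M : ℝ) + 1))) := by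
    rw [← sq, div_pow, this]
    ring
  rw [e]
  simp only [pl]
  ring

/-- Relative to n/(M-n+1), the three inner errors are bounded by H_M, 1 and 2(1 + H_M), in total 3(1
+ H_M). -/
theorem tendsto_boxSum_sub (r : ℕ) (hr : 1 ≤ r) (s p q : ℤˣ) :
    Tendsto (fun M => boxSum r s p q M - wedgeSum r s p q M - mainSum r s p q M) atTop (𝓝 0) := by
  refine squeeze_zero_norm (fun M => ?_) tendsto_harm_sq_div
  have e : boxSum r s p q M - wedgeSum r s p q M - mainSum r s p q M =
      outer (r + 1) (p * q * s) M (fun n =>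
        (harm s M - harm s n) * (harm (p * s) (M - n) - harm (p * s) M) -
        (boxInner s q M n - boxInnerMain s q M n) -
        (tailInner s p M n - tailInnerMain s p M n)) := by
    rw [outer_sub, outer_sub, outer_sub, outer_sub, boxSum_eq, wedgeSum_eq, mainSum]
    have : outer (r + 1) (p * q * s) M (fun n =>
          (harm s M - harm s n) * (harm (p * s) (M - n) - harm (p * s) M)) =
        outer (r + 1) (p * q * s) M (fun n =>
          (harm s M - harm s n) * (harm (p * s) (M - n) - harm (p * s) (n - 1))) -
        outer (r + 1) (p * q * s) M (fun n =>
          (harm s M - harm s n) * (harm (p * s) M - harm (p * s) (n - 1))) := by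
      rw [← outer_sub]
      refine outer_congr _ _ _ fun n _ _ => ?_
      ring
    rw [this]
    ring
  rw [e, Real.norm_eq_abs]
  refine abs_outer_le (by omega) _ fun n hn hM => ?_
  have h1 := abs_harm_sub_le_harm_one s hM
  have h2 := abs_harm_sub_le (p * s) (M - n) n
  rw [Nat.sub_add_cancel hM, Nat.cast_sub hM, abs_sub_comm] at h2
  have h3 := abs_boxInner_sub_le s q M n hM
  have h4 := abs_tailInner_sub_le s p hn hM
  have h5 : |(harm s M - harm s n) * (harm (p * s) (M - n) - harm (p * s) M)| ≤
      harm 1 M * (n / ((M : ℝ) - n + 1)) := by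
    rw [abs_mul]
    exact mul_le_mul h1 h2 (abs_nonneg _) (harm_one_nonneg M)
  refine (abs_sub _ _).trans ((add_le_add ((abs_sub _ _).trans (add_le_add h5 h3)) h4).trans ?_)
  refine le_of_eq ?_
  ring

theorem outer_harm_sub (u : ℕ) (e s y : ℤˣ) (M : ℕ) :
    outer u e M (fun n => (harm s M - harm s n) * (harm y M - harm y (n - 1))) =
      harm y M * truncSum [(1, s), (u, e)] M - truncSum [(1, s), (u, e), (1, y)] M := by
  have h : ∀ k : Index, truncSum ((1, s) :: (u, e) :: k) M =
      outer u e M (fun n => (harm s M - harm s n) * truncSum k (n - 1)) := by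
    intro k
    rw [truncSum_cons 1, outer, harm_eq_sum]
    simp only [truncSum_cons u, pow_one]
    rw [sum_mul_sum_Icc_pred]
    refine Finset.sum_congr rfl fun n _ => ?_
    rw [harm_eq_sum]
    ring
  rw [h, h, ← outer_const_mul, ← outer_sub]
  refine outer_congr _ _ _ fun n _ _ => ?_
  rw [truncSum_nil]
  ring

theorem outer_boxInnerMain (u : ℕ) (e s q : ℤˣ) (M : ℕ) :
    outer u e M (boxInnerMain s q M) =
      harm s M * truncSum [(u, e), (1, q)] M
        - harm (s * q) M * (truncSum [(u, e), (1, q)] M + truncSum [(u + 1, e * q)] M)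
        + harm (s * q) M * (truncSum [(u, e), (1, s)] M + truncSum [(u + 1, e * s)] M)
        - (truncSum [(u, e), (1, s), (1, s * q)] M + truncSum [(u + 1, e * s), (1, s * q)] M)
        + (truncSum [(u, e), (2, s)] M + truncSum [(u + 2, e * s)] M)
        - truncSum [(1, s), (1, q)] M * truncSum [(u, e)] M := by
  have : boxInnerMain s q M = fun m => harm s M * harm q (m - 1) - harm (s * q) M * harm q m
      + harm (s * q) M * harm s m - truncSum [(1, s), (1, s * q)] m + truncSum [(2, s)] m
      - truncSum [(1, s), (1, q)] M := rfl
  rw [this, outer_sub, outer_add, outer_sub, outer_add, outer_sub, outer_const_mul,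
    outer_const_mul, outer_const_mul, outer_const, outer_truncSum_pred, outer_truncSum_cons,
    outer_truncSum_cons, outer_truncSum_cons, outer_truncSum_cons]

theorem outer_tailInnerMain (u : ℕ) (e s p : ℤˣ) (M : ℕ) :
    outer u e M (tailInnerMain s p M) =
      (truncSum [(1, p * s), (1, p)] M + truncSum [(2, s)] M) * truncSum [(u, e)] M
        + harm s M * (truncSum [(u, e), (1, p)] M - truncSum [(u, e), (1, p * s)] M)
        + truncSum [(u, e), (1, p * s), (1, s)] M + truncSum [(u, e), (2, p)] M
        - harm (p * s) M * (truncSum [(u, e), (1, p)] M + truncSum [(u + 1, e * p)] M) := by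
  have : tailInnerMain s p M = fun n => (truncSum [(1, p * s), (1, p)] M + truncSum [(2, s)] M)
      + harm s M * (harm p (n - 1) - harm (p * s) (n - 1))
      + truncSum [(1, p * s), (1, s)] (n - 1) + truncSum [(2, p)] (n - 1)
      - harm (p * s) M * harm p n := rfl
  rw [this, outer_sub, outer_add, outer_add, outer_add, outer_const_mul, outer_const_mul,
    outer_const, outer_sub, outer_truncSum_pred, outer_truncSum_pred, outer_truncSum_pred,
    outer_truncSum_pred, outer_truncSum_cons]

theorem outer_harm_mul_harm (u : ℕ) (e p q : ℤˣ) (M : ℕ) :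
    outer u e M (fun m => harm p (m - 1) * harm q (m - 1)
        - (truncSum [(1, q), (1, p * q)] m + truncSum [(1, p), (1, p * q)] m)) =
      truncSum [(u, e), (1, p), (1, q)] M + truncSum [(u, e), (1, q), (1, p)] M
        + truncSum [(u, e), (2, p * q)] M
        - (truncSum [(u, e), (1, q), (1, p * q)] M + truncSum [(u + 1, e * q), (1, p * q)] M
          + (truncSum [(u, e), (1, p), (1, p * q)] M
            + truncSum [(u + 1, e * p), (1, p * q)] M)) := by
  simp only [harm, truncSum_mul_single]
  rw [outer_sub, outer_add, outer_add, outer_add, outer_truncSum_pred, outer_truncSum_pred,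
    outer_truncSum_pred, outer_truncSum_cons, outer_truncSum_cons]

theorem mainSum_eq (r : ℕ) (s p q e : ℤˣ) (he : p * q * s = e) (M : ℕ) :
    mainSum r s p q M = ((r : ℝ) + 1) * truncSum [(1, s), (r + 2, e)] M
      + (truncSum [(1, p * s)] M * truncSum [(1, s), (r + 1, e)] M
        - truncSum [(1, s), (r + 1, e), (1, p * s)] M)
      - (truncSum [(1, s)] M * truncSum [(r + 1, e), (1, q)] M
        - truncSum [(1, s * q)] M *
          (truncSum [(r + 1, e), (1, q)] M + truncSum [(r + 2, e * q)] M)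
        + truncSum [(1, s * q)] M *
          (truncSum [(r + 1, e), (1, s)] M + truncSum [(r + 2, e * s)] M)
        - (truncSum [(r + 1, e), (1, s), (1, s * q)] M
          + truncSum [(r + 2, e * s), (1, s * q)] M)
        + (truncSum [(r + 1, e), (2, s)] M + truncSum [(r + 3, e * s)] M)
        - truncSum [(1, s), (1, q)] M * truncSum [(r + 1, e)] M)
      - ((truncSum [(1, p * s), (1, p)] M + truncSum [(2, s)] M) * truncSum [(r + 1, e)] M
        + truncSum [(1, s)] M *
          (truncSum [(r + 1, e), (1, p)] M - truncSum [(r + 1, e), (1, p * s)] M)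
        + truncSum [(r + 1, e), (1, p * s), (1, s)] M + truncSum [(r + 1, e), (2, p)] M
        - truncSum [(1, p * s)] M *
          (truncSum [(r + 1, e), (1, p)] M + truncSum [(r + 2, e * p)] M))
      + (truncSum [(r + 1, e), (1, p), (1, q)] M + truncSum [(r + 1, e), (1, q), (1, p)] M
        + truncSum [(r + 1, e), (2, p * q)] M
        - (truncSum [(r + 1, e), (1, q), (1, p * q)] M + truncSum [(r + 2, e * q), (1, p * q)] M
          + (truncSum [(r + 1, e), (1, p), (1, p * q)] M
            + truncSum [(r + 2, e * p), (1, p * q)] M))) := by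
  rw [mainSum, he, outer_harm_sub, outer_boxInnerMain, outer_tailInnerMain, outer_harm_mul_harm]

/-! ### From truncations to regularized values -/

theorem lead_le_length (k : Index) : lead k ≤ k.length := by
  induction k with
  | nil => simp [lead]
  | cons p k ih =>
    rw [lead, List.length_cons]
    split_ifs <;> omega

theorem weight_eq_length {k : Index} (h : lead k = k.length) : weight k = k.length := by
  induction k with
  | nil => rfl
  | cons p k ih =>
    rw [lead, List.length_cons] at h
    split_ifs at h with hp
    · subst hp
      have := ih (by omega)
      simp only [weight, List.map_cons, List.sum_cons, List.length_cons, pl] at this ⊢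
      omega

/-- In depth at most 3 only (1,1,1) has three leading ones, and its weight is 3. This is where w ≥ 4
enters the existence statements. -/
theorem lead_le_two {k : Index} (hl : k.length ≤ 3) (hw : 4 ≤ weight k) : lead k ≤ 2 := by
  by_contra h
  have h1 := lead_le_length k
  have h2 := weight_eq_length (k := k) (by omega)
  omega

/-- The weighted sum of shuffle regularized values of depth three. -/
def weightedPoly (r : ℕ) (s p q : ℤˣ) : ℝ[X] :=
  ∑ t ∈ triples (r + 3), C (2 ^ (t.2.1 - 1)) *
    (zetaShuffle [(t.1, s), (t.2.1, p), (t.2.2, p * q)]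
      + zetaShuffle [(t.1, s), (t.2.1, q), (t.2.2, p * q)])

theorem mem_triples {w : ℕ} {t : ℕ × ℕ × ℕ} (ht : t ∈ triples w) :
    1 ≤ t.1 ∧ 1 ≤ t.2.1 ∧ 1 ≤ t.2.2 ∧ t.1 + t.2.1 + t.2.2 = w := by
  simp only [triples, Finset.mem_filter, Finset.mem_product, Finset.mem_Icc] at ht
  omega

theorem isPos_three {a b c : ℕ} (ha : 1 ≤ a) (hb : 1 ≤ b) (hc : 1 ≤ c) (x y z : ℤˣ) :
    IsPos [(a, x), (b, y), (c, z)] := by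
  simp [IsPos, ha, hb, hc]

theorem weightedPoly_eq_sum {r : ℕ} (hr : 1 ≤ r) (s p q : ℤˣ) :
    weightedPoly r s p q = ∑ P ∈ antidiagonal r,
      (zetaShuffle [(P.1 + 1, p * s)] * zetaShuffle [(1, s), (P.2 + 1, q)]
        - zetaShuffle [(P.1 + 1, s * p), (1, p), (P.2 + 1, q)]) := by
  have hA : HasPoly (𝓝[>] 0) (fun ε => -Real.log ε) (fun ε => ∑ t ∈ triples (r + 3),
      2 ^ (t.2.1 - 1) * (truncInt [(t.1, s), (t.2.1, p), (t.2.2, p * q)] ε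
        + truncInt [(t.1, s), (t.2.1, q), (t.2.2, p * q)] ε)) (weightedPoly r s p q) := by
    refine hasPoly_sum _ fun t ht => ?_
    obtain ⟨h1, h2, h3, h4⟩ := mem_triples ht
    have hl : ∀ x y z : ℤˣ, lead [(t.1, x), (t.2.1, y), (t.2.2, z)] ≤ 2 := fun x y z =>
      lead_le_two (by simp) (by simp [weight]; omega)
    exact ((hasPoly_zetaShuffle (isPos_three h1 h2 h3 s p _) (hl _ _ _)).add
      (hasPoly_zetaShuffle (isPos_three h1 h2 h3 s q _) (hl _ _ _))).const_mul _
  have hB : HasPoly (𝓝[>] 0) (fun ε => -Real.log ε) (fun ε => ∑ P ∈ antidiagonal r,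
      (truncInt [(P.1 + 1, p * s)] ε * truncInt [(1, s), (P.2 + 1, q)] ε
        - truncInt [(P.1 + 1, s * p), (1, p), (P.2 + 1, q)] ε))
      (∑ P ∈ antidiagonal r,
      (zetaShuffle [(P.1 + 1, p * s)] * zetaShuffle [(1, s), (P.2 + 1, q)]
        - zetaShuffle [(P.1 + 1, s * p), (1, p), (P.2 + 1, q)])) := by
    refine hasPoly_sum _ fun P hP => ?_
    rw [Finset.HasAntidiagonal.mem_antidiagonal] at hP
    refine ((hasPoly_zetaShuffle (by simp [IsPos]) ?_).mul
      (hasPoly_zetaShuffle (by simp [IsPos]) ?_)).sub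
      (hasPoly_zetaShuffle (isPos_three (by omega) le_rfl (by omega) _ _ _)
        (lead_le_two (by simp) (by simp [weight]; omega)))
    · exact (lead_le_length _).trans (by simp)
    · exact (lead_le_length _).trans (by simp)
  refine poly_unique tendsto_neg_log hA.tendsto (hB.tendsto.congr' ?_)
  filter_upwards [Ioc_mem_nhdsGT zero_lt_one] with ε hε
  rw [sum_truncInt_three r s p q hε.1 hε.2]

theorem admissible_cons {s : ℕ} {z : ℤˣ} {k : Index} (h : s ≠ 1 ∨ z ≠ 1) :
    Admissible ((s, z) :: k) := by
  simp only [Admissible, List.head?_cons, pl, ne_eq, Option.some.injEq, Prod.mk.injEq]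
  tauto

theorem zetaShuffle_one_pair (s q : ℤˣ) (j : ℕ) : zetaShuffle [(1, s), (j + 1, q)] =
    zetaStuffle [(1, s), (j + 1, q)] +
      if s = 1 ∧ q = 1 ∧ j = 0 then C (eulerZeta [pl 2] / 2) else 0 := by
  have hk : IsPos [(1, s), (j + 1, q)] := by simp [IsPos]
  split_ifs with h
  · obtain ⟨rfl, rfl, rfl⟩ := h
    have := zetaShuffle_one_one_cons (k := []) (by simp [IsPos]) (by simp [Admissible])
    have e : eulerZeta [] = 1 := hasReg_nil.tendsto.limUnder_eq
    rw [e, one_mul] at this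
    exact this
  · rw [add_zero]
    refine zetaShuffle_eq_zetaStuffle hk ?_
    simp only [lead, pl, Prod.mk.injEq]
    split_ifs <;> first | omega | (exfalso; apply h; simp_all)

theorem zetaShuffle_triple (s p q : ℤˣ) (i j : ℕ) (hij : 1 ≤ i + j) :
    zetaShuffle [(i + 1, s * p), (1, p), (j + 1, q)] =
    zetaStuffle [(i + 1, s * p), (1, p), (j + 1, q)] +
      if s = 1 ∧ p = 1 ∧ i = 0 then C (eulerZeta [(j + 1, q)] * eulerZeta [pl 2] / 2) else 0 := by
  have hk : IsPos [(i + 1, s * p), (1, p), (j + 1, q)] := by simp [IsPos]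
  split_ifs with h
  · obtain ⟨rfl, rfl, rfl⟩ := h
    exact zetaShuffle_one_one_cons (k := [(j + 1, q)]) (by simp [IsPos])
      (admissible_cons (by omega))
  · rw [add_zero]
    refine zetaShuffle_eq_zetaStuffle hk ?_
    simp only [lead, pl, Prod.mk.injEq]
    split_ifs <;> first | omega | (exfalso; apply h; simp_all)

/-- The difference between the shuffle and the stuffle regularizations. -/
def correction (r : ℕ) (s p q : ℤˣ) : ℝ :=
  (if s = 1 ∧ q = 1 then eulerZeta [(r + 1, p * s)] * eulerZeta [pl 2] / 2 else 0) -
    if s = 1 ∧ p = 1 then eulerZeta [(r + 1, q)] * eulerZeta [pl 2] / 2 else 0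

theorem zetaStuffle_eq_C {k : Index} (hk : IsPos k) (ha : Admissible k) :
    zetaStuffle k = C (eulerZeta k) := by
  rw [(hasReg_eulerZeta hk ha).zetaStuffle_eq]
  simp [stufflePoly]

/-- The regularizations differ only when two unbarred ones lead. In the product this forces c = 1
and s = q = 1; in the triple sum it forces b = 1 and s = p = 1. So only the two ends of the
antidiagonal contribute. -/
theorem weightedPoly_eq_stuffle {r : ℕ} (hr : 1 ≤ r) (s p q : ℤˣ) :
    weightedPoly r s p q = ∑ P ∈ antidiagonal r,
      (zetaStuffle [(P.1 + 1, p * s)] * zetaStuffle [(1, s), (P.2 + 1, q)]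
        - zetaStuffle [(P.1 + 1, s * p), (1, p), (P.2 + 1, q)]) + C (correction r s p q) := by
  rw [weightedPoly_eq_sum hr]
  have h : ∀ P ∈ antidiagonal r,
      zetaShuffle [(P.1 + 1, p * s)] * zetaShuffle [(1, s), (P.2 + 1, q)]
        - zetaShuffle [(P.1 + 1, s * p), (1, p), (P.2 + 1, q)] =
      (zetaStuffle [(P.1 + 1, p * s)] * zetaStuffle [(1, s), (P.2 + 1, q)]
        - zetaStuffle [(P.1 + 1, s * p), (1, p), (P.2 + 1, q)]) +
      ((if P = (r, 0) then (if s = 1 ∧ q = 1 then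
          C (eulerZeta [(r + 1, p * s)] * eulerZeta [pl 2] / 2) else 0) else 0) -
        (if P = (0, r) then (if s = 1 ∧ p = 1 then
          C (eulerZeta [(r + 1, q)] * eulerZeta [pl 2] / 2) else 0) else 0)) := by
    rintro ⟨i, j⟩ hP
    rw [Finset.HasAntidiagonal.mem_antidiagonal] at hP
    simp only at hP ⊢
    rw [zetaShuffle_one_pair, zetaShuffle_triple s p q i j (by omega),
      zetaShuffle_eq_zetaStuffle (k := [(i + 1, p * s)]) (by simp [IsPos])
        ((lead_le_length _).trans (by simp)), mul_add]
    have e1 : zetaStuffle [(i + 1, p * s)] *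
        (if s = 1 ∧ q = 1 ∧ j = 0 then C (eulerZeta [pl 2] / 2) else 0) =
        if (i, j) = (r, 0) then (if s = 1 ∧ q = 1 then
          C (eulerZeta [(r + 1, p * s)] * eulerZeta [pl 2] / 2) else 0) else 0 := by
      by_cases hj : j = 0
      · obtain rfl : i = r := by omega
        subst hj
        rw [zetaStuffle_eq_C (by simp [IsPos]) (admissible_cons (by omega))]
        by_cases hs : s = 1 ∧ q = 1
        · rw [if_pos ⟨hs.1, hs.2, rfl⟩, if_pos rfl, if_pos hs, ← C_mul, mul_div_assoc]
        · rw [if_neg (by tauto), if_pos rfl, if_neg hs, mul_zero]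
      · rw [if_neg (by tauto), if_neg (by simp [hj]), mul_zero]
    have e2 : (if s = 1 ∧ p = 1 ∧ i = 0 then
          (C (eulerZeta [(j + 1, q)] * eulerZeta [pl 2] / 2) : ℝ[X]) else 0) =
        if (i, j) = (0, r) then (if s = 1 ∧ p = 1 then
          C (eulerZeta [(r + 1, q)] * eulerZeta [pl 2] / 2) else 0) else 0 := by
      by_cases hi : i = 0
      · obtain rfl : j = r := by omega
        simp [hi]
      · rw [if_neg (by tauto), if_neg (by simp [hi])]
    rw [e1, e2]
    ring
  rw [Finset.sum_congr rfl h, Finset.sum_add_distrib]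
  congr 1
  rw [Finset.sum_sub_distrib, Finset.sum_ite_eq', Finset.sum_ite_eq',
    if_pos (show (r, 0) ∈ antidiagonal r by simp), if_pos (show (0, r) ∈ antidiagonal r by simp),
    correction]
  split_ifs <;> simp

/-- Equality with a polynomial in `log M + γ` up to `o(1)`. -/
def Asymp (f : ℕ → ℝ) (P : ℝ[X]) : Prop :=
  Tendsto (fun M => f M - P.eval (logScale M)) atTop (𝓝 0)

theorem Asymp.add {f g : ℕ → ℝ} {P Q : ℝ[X]} (hf : Asymp f P) (hg : Asymp g Q) :
    Asymp (fun M => f M + g M) (P + Q) := by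
  have := Tendsto.add hf hg
  rw [add_zero] at this
  refine this.congr fun M => ?_
  rw [eval_add]
  ring

theorem Asymp.const_mul {f : ℕ → ℝ} {P : ℝ[X]} (hf : Asymp f P) (c : ℝ) :
    Asymp (fun M => c * f M) (C c * P) := by
  have := Tendsto.const_mul c hf
  rw [mul_zero] at this
  refine this.congr fun M => ?_
  rw [eval_mul, eval_C]
  ring

theorem Asymp.congr {f g : ℕ → ℝ} {P : ℝ[X]} (hf : Asymp f P) (h : ∀ M, f M = g M) :
    Asymp g P := by
  rwa [← funext h]

theorem asymp_of_tendsto {f : ℕ → ℝ} {c : ℝ} (h : Tendsto f atTop (𝓝 c)) : Asymp f (C c) := by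
  have := h.sub_const c
  rw [sub_self] at this
  refine this.congr fun M => ?_
  rw [eval_C]

theorem asymp_zetaStuffle {k : Index} (hk : IsPos k) (hl : lead k ≤ 2) :
    Asymp (truncSum k) (zetaStuffle k) := (hasPoly_zetaStuffle hk hl).tendsto

/-- The truncated form of `correction`. -/
def correctionSum (r : ℕ) (s p q : ℤˣ) (M : ℕ) : ℝ :=
  (if s = 1 ∧ q = 1 then 1 / 2 * (truncSum [(r + 1, p * s)] M * truncSum [pl 2] M) else 0) -
    if s = 1 ∧ p = 1 then 1 / 2 * (truncSum [(r + 1, q)] M * truncSum [pl 2] M) else 0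

theorem tendsto_correctionSum {r : ℕ} (hr : 1 ≤ r) (s p q : ℤˣ) :
    Tendsto (correctionSum r s p q) atTop (𝓝 (correction r s p q)) := by
  have h : ∀ z : ℤˣ, Tendsto (fun M => 1 / 2 * (truncSum [(r + 1, z)] M * truncSum [pl 2] M)) atTop
      (𝓝 (eulerZeta [(r + 1, z)] * eulerZeta [pl 2] / 2)) := by
    intro z
    have := ((tendsto_eulerZeta (k := [(r + 1, z)]) (by simp [IsPos])
      (admissible_cons (by omega))).mul (tendsto_eulerZeta isPos_two admissible_two)).const_mul
      (1 / 2)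
    convert this using 2
    ring
  refine Tendsto.sub ?_ ?_
  · split_ifs
    exacts [h _, tendsto_const_nhds]
  · split_ifs
    exacts [h _, tendsto_const_nhds]

/-- The weighted sum is determined by the asymptotics of `mainSum`. -/
theorem weightedPoly_eq {r : ℕ} (hr : 1 ≤ r) (s p q : ℤˣ) {Q : ℝ[X]}
    (h : Asymp (fun M => mainSum r s p q M + correctionSum r s p q M) Q) :
    weightedPoly r s p q = Q := by
  have h1 : HasPoly atTop logScale (fun M => boxSum r s p q M - wedgeSum r s p q M)
      (∑ P ∈ antidiagonal r, (zetaStuffle [(P.1 + 1, p * s)] * zetaStuffle [(1, s), (P.2 + 1, q)]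
        - zetaStuffle [(P.1 + 1, s * p), (1, p), (P.2 + 1, q)])) := by
    simp only [boxSum, wedgeSum, ← Finset.sum_sub_distrib]
    refine hasPoly_sum _ fun P hP => ?_
    rw [Finset.HasAntidiagonal.mem_antidiagonal] at hP
    refine ((hasPoly_zetaStuffle (by simp [IsPos]) ?_).mul
      (hasPoly_zetaStuffle (by simp [IsPos]) ?_)).sub
      (hasPoly_zetaStuffle (isPos_three (by omega) le_rfl (by omega) _ _ _)
        (lead_le_two (by simp) (by simp [weight]; omega)))
    · exact (lead_le_length _).trans (by simp)
    · exact (lead_le_length _).trans (by simp)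
  have h2 : Asymp (fun M => boxSum r s p q M - wedgeSum r s p q M) _ := h1.tendsto
  have h3 := (h2.add (asymp_of_tendsto (tendsto_correctionSum hr s p q)))
  rw [← weightedPoly_eq_stuffle hr] at h3
  -- Subtracting the null sequence of `tendsto_boxSum_sub` exchanges box minus wedge for `mainSum`.
  have h4 := h3.add ((asymp_of_tendsto (tendsto_boxSum_sub r hr s p q)).const_mul (-1))
  rw [C_0, mul_zero, add_zero] at h4
  refine poly_unique tendsto_logScale (h4.congr fun M => ?_) h
  ring

/-! ### Stuffle expansion for the six sign patterns -/

theorem truncSum_pair_mul (a b c : ℕ) (x y z : ℤˣ) (M : ℕ) :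
    truncSum [(b, y), (c, z)] M * truncSum [(a, x)] M =
      truncSum [(a, x), (b, y), (c, z)] M + truncSum [(b, y), (a, x), (c, z)] M
        + truncSum [(b, y), (c, z), (a, x)] M
        + truncSum [(a + b, x * y), (c, z)] M + truncSum [(b, y), (a + c, x * z)] M := by
  rw [mul_comm, truncSum_mul_pair]

theorem one_add_add_one (r : ℕ) : 1 + (r + 1) = r + 2 := by ring

theorem two_add_add_one (r : ℕ) : 2 + (r + 1) = r + 3 := by ring

/-- In this and the following identities every product is expanded by the stuffle rules, after which
the equality is linear in the truncated sums and exact for each M. -/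
theorem mainSum_ppp (r M : ℕ) : mainSum r 1 1 1 M + correctionSum r 1 1 1 M =
    2 * truncSum [pl 1, pl 1, pl (r + 1)] M + (r + 3) * truncSum [pl 1, pl (r + 2)] M
      - 2 * truncSum [pl (r + 1), pl 2] M - truncSum [pl (r + 3)] M := by
  rw [mainSum_eq r 1 1 1 1 (by simp)]
  norm_num [mul_assoc, correctionSum, pl, bar, mul_add, mul_sub, add_mul, sub_mul,
    truncSum_mul_pair,
    div_mul_eq_mul_div, truncSum_pair_mul, truncSum_mul_single, one_add_add_one,
    two_add_add_one, add_assoc]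
  ring

/-- The last bracket collects what the expansion leaves over: convergent sums times the two
weight-two combinations that tend to zero. -/
theorem mainSum_pmm (r M : ℕ) : mainSum r 1 (-1) (-1) M + correctionSum r 1 (-1) (-1) M =
    2 * truncSum [pl 1, bar 1, pl (r + 1)] M + (r + 1) * truncSum [pl 1, pl (r + 2)] M
      + 2 * truncSum [pl 1, bar (r + 2)] M
      + (4 * truncSum [pl (r + 1), bar 1, bar 1] M - 4 * truncSum [pl (r + 1), bar 1, pl 1] M
        - 2 * truncSum [bar 1, bar 1, pl (r + 1)] M + 2 * truncSum [bar 1, pl 1, pl (r + 1)] M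
        + 2 * truncSum [bar (r + 2), bar 1] M - 2 * truncSum [bar (r + 2), pl 1] M
        + 4 * truncSum [bar 2, pl (r + 1)] M + 2 * truncSum [pl (r + 1), pl 2] M
        + truncSum [pl (r + 3)] M + 2 * truncSum [bar (r + 3)] M)
      + ((truncSum [bar 1, bar 1] M - truncSum [bar 1, pl 1] M - truncSum [bar 2] M)
          * truncSum [pl (r + 1)] M
        + -2 * ((truncSum [bar 2] M + truncSum [pl 2] M / 2) * truncSum [pl (r + 1)] M)) := by
  rw [mainSum_eq r 1 (-1) (-1) 1 (by simp)]
  norm_num [mul_assoc, correctionSum, pl, bar, mul_add, mul_sub, add_mul, sub_mul,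
    truncSum_mul_pair,
    div_mul_eq_mul_div, truncSum_pair_mul, truncSum_mul_single, one_add_add_one,
    two_add_add_one, add_assoc]
  ring

theorem mainSum_mpp (r M : ℕ) : mainSum r (-1) 1 1 M + correctionSum r (-1) 1 1 M =
    2 * truncSum [bar 1, bar 1, bar (r + 1)] M + (r + 3) * truncSum [bar 1, bar (r + 2)] M
      + 2 * truncSum [bar (r + 2), bar 1] M - 2 * truncSum [bar (r + 2), pl 1] M
      + truncSum [bar 2, bar (r + 1)] M + truncSum [pl 2, bar (r + 1)] M
      + 2 * truncSum [pl (r + 3)] M - truncSum [bar (r + 3)] M + truncSum [pl 2] M * truncSum [bar (r + 1)] M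
      + -2 * ((truncSum [bar 2] M + truncSum [pl 2] M / 2) * truncSum [bar (r + 1)] M) := by
  rw [mainSum_eq r (-1) 1 1 (-1) (by simp)]
  norm_num [mul_assoc, correctionSum, pl, bar, mul_add, mul_sub, add_mul, sub_mul,
    truncSum_mul_pair,
    div_mul_eq_mul_div, truncSum_pair_mul, truncSum_mul_single, one_add_add_one,
    two_add_add_one, add_assoc]
  ring

theorem mainSum_mmm (r M : ℕ) : mainSum r (-1) (-1) (-1) M + correctionSum r (-1) (-1) (-1) M =
    2 * truncSum [bar 1, bar 1, bar (r + 1)] M + (r + 1) * truncSum [bar 1, bar (r + 2)] M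
      + 2 * truncSum [bar 1, pl (r + 2)] M + truncSum [bar 2, bar (r + 1)] M
      + truncSum [pl 2, bar (r + 1)] M + truncSum [bar (r + 3)] M
      + (-1 * ((truncSum [bar 1, bar 1] M - truncSum [bar 1, pl 1] M - truncSum [bar 2] M)
          * truncSum [bar (r + 1)] M)
        + -2 * ((truncSum [bar 2] M + truncSum [pl 2] M / 2) * truncSum [bar (r + 1)] M)) := by
  rw [mainSum_eq r (-1) (-1) (-1) (-1) (by simp)]
  norm_num [mul_assoc, correctionSum, pl, bar, mul_add, mul_sub, add_mul, sub_mul,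
    truncSum_mul_pair,
    div_mul_eq_mul_div, truncSum_pair_mul, truncSum_mul_single, one_add_add_one,
    two_add_add_one, add_assoc]
  ring

theorem mainSum_mpm (r M : ℕ) : mainSum r (-1) 1 (-1) M + correctionSum r (-1) 1 (-1) M =
    2 * truncSum [pl (r + 1), bar 1, pl 1] M + 2 * truncSum [bar 1, bar 1, pl (r + 1)] M
      - 2 * truncSum [pl (r + 1), bar 1, bar 1] M + (r + 2) * truncSum [bar 1, pl (r + 2)] M
      + truncSum [bar (r + 2), pl 1] M + truncSum [bar 1, bar (r + 2)] M
      - truncSum [bar (r + 2), bar 1] M + truncSum [pl 2, pl (r + 1)] M - truncSum [pl (r + 1), pl 2] M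
      + (truncSum [bar 1, bar 1] M - truncSum [bar 1, pl 1] M - truncSum [bar 2] M)
        * truncSum [pl (r + 1)] M := by
  rw [mainSum_eq r (-1) 1 (-1) 1 (by simp)]
  norm_num [mul_assoc, correctionSum, pl, bar, mul_add, mul_sub, add_mul, sub_mul,
    truncSum_mul_pair,
    div_mul_eq_mul_div, truncSum_pair_mul, truncSum_mul_single, one_add_add_one,
    two_add_add_one, add_assoc]
  ring

theorem mainSum_pmp (r M : ℕ) : mainSum r 1 (-1) 1 M + correctionSum r 1 (-1) 1 M =
    truncSum [pl 1, bar 1, bar (r + 1)] M + truncSum [pl 1, pl 1, bar (r + 1)] M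
      + truncSum [pl 1, pl (r + 2)] M + (r + 2) * truncSum [pl 1, bar (r + 2)] M
      + (truncSum [bar 1, pl 1, bar (r + 1)] M - truncSum [bar 1, bar 1, bar (r + 1)] M
        - truncSum [bar (r + 2), bar 1] M + truncSum [bar (r + 2), pl 1] M
        + truncSum [bar 2, bar (r + 1)] M + truncSum [pl 2, bar (r + 1)] M + truncSum [bar (r + 3)] M
        + 3 * truncSum [bar 2] M * truncSum [bar (r + 1)] M)
      + -3 * ((truncSum [bar 2] M + truncSum [pl 2] M / 2) * truncSum [bar (r + 1)] M) := by
  rw [mainSum_eq r 1 (-1) 1 (-1) (by simp)]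
  norm_num [mul_assoc, correctionSum, pl, bar, mul_add, mul_sub, add_mul, sub_mul,
    truncSum_mul_pair,
    div_mul_eq_mul_div, truncSum_pair_mul, truncSum_mul_single, one_add_add_one,
    two_add_add_one, add_assoc]
  ring

/-! ### Passage to the limit and the six identities -/

theorem tendsto_single {r : ℕ} (hr : 1 ≤ r) (z : ℤˣ) :
    Tendsto (truncSum [(r + 1, z)]) atTop (𝓝 (eulerZeta [(r + 1, z)])) :=
  tendsto_eulerZeta (by simp [IsPos]) (admissible_cons (by omega))

theorem tendsto_bar_one_bar_one_mul {r : ℕ} (hr : 1 ≤ r) (z : ℤˣ) (c : ℝ) :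
    Tendsto (fun M => c * ((truncSum [bar 1, bar 1] M - truncSum [bar 1, pl 1] M
      - truncSum [bar 2] M) * truncSum [(r + 1, z)] M)) atTop (𝓝 0) := by
  simpa using (tendsto_bar_one_bar_one.mul (tendsto_single hr z)).const_mul c

theorem tendsto_bar_two_mul {r : ℕ} (hr : 1 ≤ r) (z : ℤˣ) (c : ℝ) :
    Tendsto (fun M => c * ((truncSum [bar 2] M + truncSum [pl 2] M / 2)
      * truncSum [(r + 1, z)] M)) atTop (𝓝 0) := by
  simpa using (tendsto_bar_two.mul (tendsto_single hr z)).const_mul c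

theorem weightedPoly_self (r : ℕ) (s p : ℤˣ) :
    weightedPoly r s p p = ∑ t ∈ triples (r + 3), C (2 * 2 ^ (t.2.1 - 1)) *
      zetaShuffle [(t.1, s), (t.2.1, p), pl t.2.2] := by
  refine Finset.sum_congr rfl fun t _ => ?_
  rw [Int.units_mul_self, ← two_mul, C_mul, ← mul_assoc, mul_comm (C 2), C_ofNat]
  rfl

theorem weightedPoly_bar_self (r : ℕ) (p : ℤˣ) :
    weightedPoly r (-1) p p = C (∑ t ∈ triples (r + 3), 2 * 2 ^ (t.2.1 - 1) *
      eulerZeta [bar t.1, (t.2.1, p), pl t.2.2]) := by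
  rw [weightedPoly_self, map_sum]
  refine Finset.sum_congr rfl fun t ht => ?_
  obtain ⟨h1, h2, h3, -⟩ := mem_triples ht
  have h := zetaShuffle_eq_C (isPos_three h1 h2 h3 (-1) p 1) (admissible_cons (Or.inr (by decide)))
  rw [pl, bar, h, ← C_mul]

theorem asymp_stuffle (k : Index) (hk : IsPos k) (hl : k.length ≤ 3) (hw : 4 ≤ weight k) :
    Asymp (truncSum k) (zetaStuffle k) :=
  asymp_zetaStuffle hk (lead_le_two hl hw)

/-! The weighted sums for the possible signs, in the order of the arguments of `weightedPoly`. -/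

theorem weightedPoly_ppp {r : ℕ} (hr : 1 ≤ r) : weightedPoly r 1 1 1 =
      2 * zetaStuffle [pl 1, pl 1, pl (r + 1)] + ((r + 3 : ℕ) : ℝ[X]) * zetaStuffle [pl 1, pl (r + 2)]
      + C (-2 * eulerZeta [pl (r + 1), pl 2]
        - eulerZeta [pl (r + 3)]) := by
  have h := ((((asymp_stuffle [pl 1, pl 1, pl (r + 1)] (by simp [IsPos, pl]) (by simp)
      (by simp [weight, pl]; omega)).const_mul 2).add
    ((asymp_stuffle [pl 1, pl (r + 2)] (by simp [IsPos, pl]) (by simp)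
      (by simp [weight, pl]; omega)).const_mul ((r + 3 : ℕ) : ℝ))).add
    (asymp_of_tendsto
      (((tendsto_eulerZeta (k := [pl (r + 1), pl 2])
      (by simp [IsPos, pl])
      (admissible_cons (by omega))).const_mul (-2)).sub
      (tendsto_eulerZeta (k := [pl (r + 3)]) (by simp [IsPos, pl])
      (admissible_cons (by omega))))))
  simp only [map_ofNat, map_natCast] at h
  refine weightedPoly_eq hr _ _ _ (h.congr fun M => ?_)
  rw [mainSum_ppp]
  push_cast
  simp only [pl]
  ring

theorem weightedPoly_pmm {r : ℕ} (hr : 1 ≤ r) : weightedPoly r 1 (-1) (-1) =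
      2 * zetaStuffle [pl 1, bar 1, pl (r + 1)] + ((r + 1 : ℕ) : ℝ[X]) * zetaStuffle [pl 1, pl (r + 2)]
      + 2 * zetaStuffle [pl 1, bar (r + 2)]
      + C (4 * eulerZeta [pl (r + 1), bar 1, bar 1]
        - 4 * eulerZeta [pl (r + 1), bar 1, pl 1]
        - 2 * eulerZeta [bar 1, bar 1, pl (r + 1)]
        + 2 * eulerZeta [bar 1, pl 1, pl (r + 1)]
        + 2 * eulerZeta [bar (r + 2), bar 1]
        - 2 * eulerZeta [bar (r + 2), pl 1]
        + 4 * eulerZeta [bar 2, pl (r + 1)]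
        + 2 * eulerZeta [pl (r + 1), pl 2]
        + eulerZeta [pl (r + 3)]
        + 2 * eulerZeta [bar (r + 3)]) := by
  have h := (((((asymp_stuffle [pl 1, bar 1, pl (r + 1)] (by simp [IsPos, pl, bar]) (by simp)
      (by simp [weight, pl, bar]; omega)).const_mul 2).add
    ((asymp_stuffle [pl 1, pl (r + 2)] (by simp [IsPos, pl]) (by simp)
      (by simp [weight, pl]; omega)).const_mul ((r + 1 : ℕ) : ℝ))).add
    ((asymp_stuffle [pl 1, bar (r + 2)] (by simp [IsPos, pl, bar]) (by simp)
      (by simp [weight, pl, bar]; omega)).const_mul 2)).add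
    (asymp_of_tendsto
      (((((((((((tendsto_eulerZeta (k := [pl (r + 1), bar 1, bar 1])
      (by simp [IsPos, pl, bar])
      (admissible_cons (by omega))).const_mul 4).sub
      ((tendsto_eulerZeta (k := [pl (r + 1), bar 1, pl 1]) (by simp [IsPos, pl, bar])
      (admissible_cons (by omega))).const_mul 4)).sub
      ((tendsto_eulerZeta (k := [bar 1, bar 1, pl (r + 1)]) (by simp [IsPos, pl, bar])
      (admissible_cons (Or.inr (by decide)))).const_mul 2)).add
      ((tendsto_eulerZeta (k := [bar 1, pl 1, pl (r + 1)]) (by simp [IsPos, pl, bar])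
      (admissible_cons (Or.inr (by decide)))).const_mul 2)).add
      ((tendsto_eulerZeta (k := [bar (r + 2), bar 1]) (by simp [IsPos, bar])
      (admissible_cons (Or.inr (by decide)))).const_mul 2)).sub
      ((tendsto_eulerZeta (k := [bar (r + 2), pl 1]) (by simp [IsPos, pl, bar])
      (admissible_cons (Or.inr (by decide)))).const_mul 2)).add
      ((tendsto_eulerZeta (k := [bar 2, pl (r + 1)]) (by simp [IsPos, pl, bar])
      (admissible_cons (Or.inr (by decide)))).const_mul 4)).add
      ((tendsto_eulerZeta (k := [pl (r + 1), pl 2]) (by simp [IsPos, pl])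
      (admissible_cons (by omega))).const_mul 2)).add
      (tendsto_eulerZeta (k := [pl (r + 3)]) (by simp [IsPos, pl])
      (admissible_cons (by omega)))).add
      ((tendsto_eulerZeta (k := [bar (r + 3)]) (by simp [IsPos, bar])
      (admissible_cons (Or.inr (by decide)))).const_mul 2))))
  -- The leftover products of `mainSum_pmm` are null sequences and do not change the polynomial.
  have h' := h.add (asymp_of_tendsto
    ((tendsto_bar_one_bar_one_mul hr 1 1).add (tendsto_bar_two_mul hr 1 (-2))))
  simp only [C_0, add_zero, map_ofNat, map_natCast] at h'
  refine weightedPoly_eq hr _ _ _ (h'.congr fun M => ?_)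
  rw [mainSum_pmm]
  push_cast
  simp only [pl, bar]
  ring

theorem weightedPoly_mpp {r : ℕ} (hr : 1 ≤ r) : weightedPoly r (-1) 1 1 =
      C (2 * eulerZeta [bar 1, bar 1, bar (r + 1)]
        + (r + 3 : ℕ) * eulerZeta [bar 1, bar (r + 2)]
        + 2 * eulerZeta [bar (r + 2), bar 1]
        - 2 * eulerZeta [bar (r + 2), pl 1]
        + eulerZeta [bar 2, bar (r + 1)]
        + eulerZeta [pl 2, bar (r + 1)]
        + 2 * eulerZeta [pl (r + 3)]
        - eulerZeta [bar (r + 3)] + eulerZeta [pl 2] * eulerZeta [bar (r + 1)]) := by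
  have h := (asymp_of_tendsto
      ((((((((((tendsto_eulerZeta (k := [bar 1, bar 1, bar (r + 1)])
      (by simp [IsPos, bar])
      (admissible_cons (Or.inr (by decide)))).const_mul 2).add
      ((tendsto_eulerZeta (k := [bar 1, bar (r + 2)]) (by simp [IsPos, bar])
      (admissible_cons (Or.inr (by decide)))).const_mul ((r + 3 : ℕ) : ℝ))).add
      ((tendsto_eulerZeta (k := [bar (r + 2), bar 1]) (by simp [IsPos, bar])
      (admissible_cons (Or.inr (by decide)))).const_mul 2)).sub
      ((tendsto_eulerZeta (k := [bar (r + 2), pl 1]) (by simp [IsPos, pl, bar])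
      (admissible_cons (Or.inr (by decide)))).const_mul 2)).add
      (tendsto_eulerZeta (k := [bar 2, bar (r + 1)]) (by simp [IsPos, bar])
      (admissible_cons (Or.inr (by decide))))).add
      (tendsto_eulerZeta (k := [pl 2, bar (r + 1)]) (by simp [IsPos, pl, bar])
      (admissible_cons (by omega)))).add
      ((tendsto_eulerZeta (k := [pl (r + 3)]) (by simp [IsPos, pl])
      (admissible_cons (by omega))).const_mul 2)).sub
      (tendsto_eulerZeta (k := [bar (r + 3)]) (by simp [IsPos, bar])
      (admissible_cons (Or.inr (by decide))))).add
      ((tendsto_eulerZeta isPos_two admissible_two).mul (tendsto_single hr (-1)))))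
  have h' := h.add (asymp_of_tendsto (tendsto_bar_two_mul hr (-1) (-2)))
  simp only [C_0, add_zero] at h'
  refine weightedPoly_eq hr _ _ _ (h'.congr fun M => ?_)
  rw [mainSum_mpp]
  push_cast
  simp only [pl, bar]

theorem weightedPoly_mmm {r : ℕ} (hr : 1 ≤ r) : weightedPoly r (-1) (-1) (-1) =
      C (2 * eulerZeta [bar 1, bar 1, bar (r + 1)]
        + (r + 1 : ℕ) * eulerZeta [bar 1, bar (r + 2)]
        + 2 * eulerZeta [bar 1, pl (r + 2)]
        + eulerZeta [bar 2, bar (r + 1)]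
        + eulerZeta [pl 2, bar (r + 1)]
        + eulerZeta [bar (r + 3)]) := by
  have h := (asymp_of_tendsto
      (((((((tendsto_eulerZeta (k := [bar 1, bar 1, bar (r + 1)])
      (by simp [IsPos, bar])
      (admissible_cons (Or.inr (by decide)))).const_mul 2).add
      ((tendsto_eulerZeta (k := [bar 1, bar (r + 2)]) (by simp [IsPos, bar])
      (admissible_cons (Or.inr (by decide)))).const_mul ((r + 1 : ℕ) : ℝ))).add
      ((tendsto_eulerZeta (k := [bar 1, pl (r + 2)]) (by simp [IsPos, pl, bar])
      (admissible_cons (Or.inr (by decide)))).const_mul 2)).add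
      (tendsto_eulerZeta (k := [bar 2, bar (r + 1)]) (by simp [IsPos, bar])
      (admissible_cons (Or.inr (by decide))))).add
      (tendsto_eulerZeta (k := [pl 2, bar (r + 1)]) (by simp [IsPos, pl, bar])
      (admissible_cons (by omega)))).add
      (tendsto_eulerZeta (k := [bar (r + 3)]) (by simp [IsPos, bar])
      (admissible_cons (Or.inr (by decide))))))
  have h' := h.add (asymp_of_tendsto
    ((tendsto_bar_one_bar_one_mul hr (-1) (-1)).add (tendsto_bar_two_mul hr (-1) (-2))))
  simp only [C_0, add_zero] at h'
  refine weightedPoly_eq hr _ _ _ (h'.congr fun M => ?_)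
  rw [mainSum_mmm]
  push_cast
  simp only [pl, bar]

theorem weightedPoly_mpm {r : ℕ} (hr : 1 ≤ r) : weightedPoly r (-1) 1 (-1) =
      C (2 * eulerZeta [pl (r + 1), bar 1, pl 1]
        + 2 * eulerZeta [bar 1, bar 1, pl (r + 1)]
        - 2 * eulerZeta [pl (r + 1), bar 1, bar 1]
        + (r + 2 : ℕ) * eulerZeta [bar 1, pl (r + 2)]
        + eulerZeta [bar (r + 2), pl 1]
        + eulerZeta [bar 1, bar (r + 2)]
        - eulerZeta [bar (r + 2), bar 1]
        + eulerZeta [pl 2, pl (r + 1)]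
        - eulerZeta [pl (r + 1), pl 2]) := by
  have h := (asymp_of_tendsto
      ((((((((((tendsto_eulerZeta (k := [pl (r + 1), bar 1, pl 1])
      (by simp [IsPos, pl, bar])
      (admissible_cons (by omega))).const_mul 2).add
      ((tendsto_eulerZeta (k := [bar 1, bar 1, pl (r + 1)]) (by simp [IsPos, pl, bar])
      (admissible_cons (Or.inr (by decide)))).const_mul 2)).sub
      ((tendsto_eulerZeta (k := [pl (r + 1), bar 1, bar 1]) (by simp [IsPos, pl, bar])
      (admissible_cons (by omega))).const_mul 2)).add
      ((tendsto_eulerZeta (k := [bar 1, pl (r + 2)]) (by simp [IsPos, pl, bar])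
      (admissible_cons (Or.inr (by decide)))).const_mul ((r + 2 : ℕ) : ℝ))).add
      (tendsto_eulerZeta (k := [bar (r + 2), pl 1]) (by simp [IsPos, pl, bar])
      (admissible_cons (Or.inr (by decide))))).add
      (tendsto_eulerZeta (k := [bar 1, bar (r + 2)]) (by simp [IsPos, bar])
      (admissible_cons (Or.inr (by decide))))).sub
      (tendsto_eulerZeta (k := [bar (r + 2), bar 1]) (by simp [IsPos, bar])
      (admissible_cons (Or.inr (by decide))))).add
      (tendsto_eulerZeta (k := [pl 2, pl (r + 1)]) (by simp [IsPos, pl])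
      (admissible_cons (by omega)))).sub
      (tendsto_eulerZeta (k := [pl (r + 1), pl 2]) (by simp [IsPos, pl])
      (admissible_cons (by omega)))))
  have h' := h.add (asymp_of_tendsto (tendsto_bar_one_bar_one_mul hr 1 1))
  simp only [C_0, add_zero] at h'
  refine weightedPoly_eq hr _ _ _ (h'.congr fun M => ?_)
  rw [mainSum_mpm]
  push_cast
  simp only [pl, bar]
  ring

theorem weightedPoly_pmp {r : ℕ} (hr : 1 ≤ r) : weightedPoly r 1 (-1) 1 =
      zetaStuffle [pl 1, bar 1, bar (r + 1)] + zetaStuffle [pl 1, pl 1, bar (r + 1)] + zetaStuffle [pl 1, pl (r + 2)]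
      + ((r + 2 : ℕ) : ℝ[X]) * zetaStuffle [pl 1, bar (r + 2)]
      + C (eulerZeta [bar 1, pl 1, bar (r + 1)]
        - eulerZeta [bar 1, bar 1, bar (r + 1)]
        - eulerZeta [bar (r + 2), bar 1]
        + eulerZeta [bar (r + 2), pl 1]
        + eulerZeta [bar 2, bar (r + 1)]
        + eulerZeta [pl 2, bar (r + 1)]
        + eulerZeta [bar (r + 3)] + 3 * eulerZeta [bar 2] * eulerZeta [bar (r + 1)]) := by
  have h := (((((asymp_stuffle [pl 1, bar 1, bar (r + 1)] (by simp [IsPos, pl, bar]) (by simp)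
      (by simp [weight, pl, bar]; omega)).add
    (asymp_stuffle [pl 1, pl 1, bar (r + 1)] (by simp [IsPos, pl, bar]) (by simp)
      (by simp [weight, pl, bar]; omega))).add
    (asymp_stuffle [pl 1, pl (r + 2)] (by simp [IsPos, pl]) (by simp)
      (by simp [weight, pl]; omega))).add
    ((asymp_stuffle [pl 1, bar (r + 2)] (by simp [IsPos, pl, bar]) (by simp)
      (by simp [weight, pl, bar]; omega)).const_mul ((r + 2 : ℕ) : ℝ))).add
    (asymp_of_tendsto
      ((((((((tendsto_eulerZeta (k := [bar 1, pl 1, bar (r + 1)])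
      (by simp [IsPos, pl, bar])
      (admissible_cons (Or.inr (by decide)))).sub
      (tendsto_eulerZeta (k := [bar 1, bar 1, bar (r + 1)]) (by simp [IsPos, bar])
      (admissible_cons (Or.inr (by decide))))).sub
      (tendsto_eulerZeta (k := [bar (r + 2), bar 1]) (by simp [IsPos, bar])
      (admissible_cons (Or.inr (by decide))))).add
      (tendsto_eulerZeta (k := [bar (r + 2), pl 1]) (by simp [IsPos, pl, bar])
      (admissible_cons (Or.inr (by decide))))).add
      (tendsto_eulerZeta (k := [bar 2, bar (r + 1)]) (by simp [IsPos, bar])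
      (admissible_cons (Or.inr (by decide))))).add
      (tendsto_eulerZeta (k := [pl 2, bar (r + 1)]) (by simp [IsPos, pl, bar])
      (admissible_cons (by omega)))).add
      (tendsto_eulerZeta (k := [bar (r + 3)]) (by simp [IsPos, bar])
      (admissible_cons (Or.inr (by decide))))).add
      (((tendsto_eulerZeta isPos_bar_two admissible_bar_two).const_mul 3).mul (tendsto_single hr (-1))))))
  have h' := h.add (asymp_of_tendsto (tendsto_bar_two_mul hr (-1) (-3)))
  simp only [C_0, add_zero, map_natCast] at h'
  refine weightedPoly_eq hr _ _ _ (h'.congr fun M => ?_)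
  rw [mainSum_pmp]
  push_cast
  rfl

end EulerSum

end

theorem mainTheorem5 (w u v : ℕ) (hw : 4 ≤ w) (hu : u + 2 = w) (hv : v + 1 = w) :
    -- the Euler sums and both regularizations exist
    (∀ k : Index, IsPos k → k.length ≤ 3 → weight k ≤ w → Admissible k →
      Tendsto (truncSum k) atTop (𝓝 (eulerZeta k))) ∧
    (∀ k : Index, IsPos k → k.length ≤ 3 → weight k = w →
      IsStuffleReg k (zetaStuffle k) ∧ IsShuffleReg k (zetaShuffle k)) ∧
    -- signs (+, +, +)
    ∑ p ∈ triples w, (C (2 * 2 ^ (p.2.1 - 1)) : ℝ[X]) *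
        zetaShuffle [pl p.1, pl p.2.1, pl p.2.2] =
      2 * zetaStuffle [pl 1, pl 1, pl u] + (w : ℝ[X]) * zetaStuffle [pl 1, pl v]
        + C (-2 * eulerZeta [pl u, pl 2] - eulerZeta [pl w]) ∧
    -- signs (+, -, +)
    ∑ p ∈ triples w, (C (2 * 2 ^ (p.2.1 - 1)) : ℝ[X]) *
        zetaShuffle [pl p.1, bar p.2.1, pl p.2.2] =
      2 * zetaStuffle [pl 1, bar 1, pl u] + (u : ℝ[X]) * zetaStuffle [pl 1, pl v]
        + 2 * zetaStuffle [pl 1, bar v]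
        + C (4 * eulerZeta [pl u, bar 1, bar 1] - 4 * eulerZeta [pl u, bar 1, pl 1]
          - 2 * eulerZeta [bar 1, bar 1, pl u] + 2 * eulerZeta [bar 1, pl 1, pl u]
          + 2 * eulerZeta [bar v, bar 1] - 2 * eulerZeta [bar v, pl 1]
          + 4 * eulerZeta [bar 2, pl u] + 2 * eulerZeta [pl u, pl 2]
          + eulerZeta [pl w] + 2 * eulerZeta [bar w]) ∧
    -- signs (-, +, +)
    ∑ p ∈ triples w, (2 * 2 ^ (p.2.1 - 1) : ℝ) *
        eulerZeta [bar p.1, pl p.2.1, pl p.2.2] =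
      2 * eulerZeta [bar 1, bar 1, bar u] + (w : ℝ) * eulerZeta [bar 1, bar v]
        + 2 * eulerZeta [bar v, bar 1] - 2 * eulerZeta [bar v, pl 1]
        + eulerZeta [bar 2, bar u] + eulerZeta [pl 2, bar u]
        + 2 * eulerZeta [pl w] - eulerZeta [bar w]
        + eulerZeta [pl 2] * eulerZeta [bar u] ∧
    -- signs (-, -, +)
    ∑ p ∈ triples w, (2 * 2 ^ (p.2.1 - 1) : ℝ) *
        eulerZeta [bar p.1, bar p.2.1, pl p.2.2] =
      2 * eulerZeta [bar 1, bar 1, bar u] + (u : ℝ) * eulerZeta [bar 1, bar v]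
        + 2 * eulerZeta [bar 1, pl v] + eulerZeta [bar 2, bar u]
        + eulerZeta [pl 2, bar u] + eulerZeta [bar w] ∧
    -- signs (-, -, -) and (-, +, -)
    ∑ p ∈ triples w, (C (2 ^ (p.2.1 - 1)) : ℝ[X]) *
        (zetaShuffle [bar p.1, bar p.2.1, bar p.2.2]
          + zetaShuffle [bar p.1, pl p.2.1, bar p.2.2]) =
      C (2 * eulerZeta [pl u, bar 1, pl 1] + 2 * eulerZeta [bar 1, bar 1, pl u]
        - 2 * eulerZeta [pl u, bar 1, bar 1] + (v : ℝ) * eulerZeta [bar 1, pl v]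
        + eulerZeta [bar v, pl 1] + eulerZeta [bar 1, bar v]
        - eulerZeta [bar v, bar 1] + eulerZeta [pl 2, pl u]
        - eulerZeta [pl u, pl 2]) ∧
    -- signs (+, +, -) and (+, -, -)
    ∑ p ∈ triples w, (C (2 ^ (p.2.1 - 1)) : ℝ[X]) *
        (zetaShuffle [pl p.1, pl p.2.1, bar p.2.2]
          + zetaShuffle [pl p.1, bar p.2.1, bar p.2.2]) =
      zetaStuffle [pl 1, bar 1, bar u] + zetaStuffle [pl 1, pl 1, bar u]
        + zetaStuffle [pl 1, pl v] + (v : ℝ[X]) * zetaStuffle [pl 1, bar v]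
        + C (eulerZeta [bar 1, pl 1, bar u] - eulerZeta [bar 1, bar 1, bar u]
          - eulerZeta [bar v, bar 1] + eulerZeta [bar v, pl 1]
          + eulerZeta [bar 2, bar u] + eulerZeta [pl 2, bar u] + eulerZeta [bar w]
          + 3 * eulerZeta [bar 2] * eulerZeta [bar u]) := by
  -- Three positive exponents leave r = w-3 to distribute; w ≥ 4 becomes r ≥ 1, so that u = r+1 is
  -- at least 2.
  obtain ⟨r, rfl⟩ : ∃ r, w = r + 3 := ⟨w - 3, by omega⟩
  obtain rfl : u = r + 1 := by omega
  obtain rfl : v = r + 2 := by omega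
  have hr : 1 ≤ r := by omega
  refine ⟨fun k hk _ _ ha => tendsto_eulerZeta hk ha, fun k hk hl hw' => ?_, ?_, ?_, ?_, ?_, ?_, ?_⟩
  · have h := lead_le_two hl (hw.trans_eq hw'.symm)
    exact ⟨(hasPoly_zetaStuffle hk h).tendsto, (hasPoly_zetaShuffle hk h).tendsto⟩
  · exact (weightedPoly_self r 1 1).symm.trans (weightedPoly_ppp hr)
  · exact (weightedPoly_self r 1 (-1)).symm.trans (weightedPoly_pmm hr)
  -- A barred first entry is admissible, so both sides are constant polynomials.
  · exact C_injective ((weightedPoly_bar_self r 1).symm.trans (weightedPoly_mpp hr))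
  · exact C_injective ((weightedPoly_bar_self r (-1)).symm.trans (weightedPoly_mmm hr))
  -- For p ≠ q the third sign is pq = -1, and the two middle signs appear in the opposite order to
  -- the theorem.
  · rw [← weightedPoly_mpm hr]
    refine Finset.sum_congr rfl fun t _ => ?_
    rw [add_comm]
    rfl
  · rw [← weightedPoly_pmp hr]
    refine Finset.sum_congr rfl fun t _ => ?_
    rw [add_comm]
    rfl
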